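/- Let $\Delta=2^l$ and $n=\Delta^2=4^l$. For $0\le i\le l$ let $G_i$ be the grid of cells of side $2^i$ on $[\Delta]^2$. The $t=\sum_{d=0}^{l}4^d=\lfloor 4n/3\rfloor$ cells form the complete $4$-ary tree $G=\bigcup_i G_i$, in which the children $C(c)$ of a cell $c\in G_i$ ($i\ge 1$) are the four cells of $G_{i-1}$ inside it; $[t]$ is identified with the set of cells. For $s\in\mathbb N$ let $T^s$ be the family of sets $S\subseteq[t]$ that are connected in $G$, contain the root, and satisfy $|S\cap G_i|\le s$ for all $i$. Put $$\mathcal M=\mathcal M_s=\{y\in\mathbb R^t:\ \operatorname{supp}(y)\subseteq S\text{ for some }S\in T^s,\ \text{and } y_i\ge 2\|y_{C(i)}\|_1\ \text{for all } i\in[t]\}.$$ Algorithms run on a unit-cost real RAM: natural-number registers and arrays with addition, truncated subtraction and comparison; real registers and arrays with $+,-,\times,\div$ and comparison; indirect addressing; conversion of natural numbers to reals but no rounding. The program is a fixed finite text. Its input consists of $l,k,s,m$, random access to the vector $Ay$, and random access to $A$ in sparse column format (for each column, the ordered list of its nonzero entries with their row indices). Its output is a list of pairs (coordinate, value) that represents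 $y^*$, and the length of the list is included in the running time. **Theorem.** There is an absolute constant $C>0$ such that for all constants $c_1,c_2>0$ there are constants $C_m,C_T,a>0$ and a program with the following property. Let $l,k,s\in\mathbb N$, $n=4^l$ and $0<\epsilon\le1$ with $1\le k<n/2$, $s\le c_1k/\epsilon^2$ and $k\ge c_2\log\log n$. Then there are $m\le C_m\,\epsilon^{-2}k\log(n/k)$ and a probability distribution over real $m\times t$ matrices $A$ such that 1. for every $A$ in the support of the distribution and every $y\in\mathbb R^t$, the program, given $A$ and $Ay$, outputs a vector $y^*\in\mathbb R^t$ in time at most $C_T\,\epsilon^{-2}k\log(n/k)$; 2. for every $y\in\mathbb R^t$, with probability at least $1-k^{-a}$ over the choice of $A$, $$\|y^*-y\|_1\le C\,\|y-y'\|_1\quad\text{for all } y'\in\mathcal M,$$ that is, $\|y^*-y\|_1\le C\min_{y'\in\mathcal M}\|y-y'\|_1$ when $s\ge1$. -/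

import Mathlib

/-! ### The tree of cells and the signal model -/

/-- The number `t` of cells in the nested grids over a `2^l × 2^l` image: for each of the levels
there are `4^d` cells at distance `d` from the root, `0 ≤ d ≤ l`. -/
def numCells (l : ℕ) : ℕ := ∑ d ∈ Finset.range (l + 1), 4 ^ d

theorem numCells_pos (l : ℕ) : 0 < numCells l :=
  Finset.sum_pos (fun _ _ => by positivity) ⟨0, by simp⟩

/-- With `n = 4^l` pixels the number of cells is `⌊4n/3⌋`. -/
theorem numCells_eq (l : ℕ) : numCells l = 4 * 4 ^ l / 3 := by
  have h : 3 * numCells l + 1 = 4 * 4 ^ l := by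
    induction l with
    | zero => simp [numCells]
    | succ l ih =>
      have : numCells (l + 1) = numCells l + 4 ^ (l + 1) := by
        simp [numCells, Finset.sum_range_succ]
      rw [this, pow_succ]
      omega
  omega

/-- The cells form the complete 4-ary tree `G` with levels `0, …, l` (a cell of side `2^i` has its
four quadrants as children).  They are numbered from the root down, level after level, siblings
consecutively, so that the root is `0` and the children of `p` are `4p+1, …, 4p+4`. -/
abbrev Cell (l : ℕ) : Type := Fin (numCells l)

/-- The cell that covers the whole image. -/
def rootCell (l : ℕ) : Cell l := ⟨0, numCells_pos l⟩

/-- `c` is a child of `p`. -/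
def IsChild {l : ℕ} (p c : Cell l) : Prop := (c : ℕ) ≠ 0 ∧ ((c : ℕ) - 1) / 4 = p

instance {l : ℕ} (p c : Cell l) : Decidable (IsChild p c) :=
  inferInstanceAs (Decidable (_ ∧ _))

/-- The set `C(p)` of children of `p`. -/
def children {l : ℕ} (p : Cell l) : Finset (Cell l) := Finset.univ.filter (fun c => IsChild p c)

/-- The tree `G` as a graph. -/
def cellTree (l : ℕ) : SimpleGraph (Cell l) := SimpleGraph.fromRel IsChild

/-- The distance of a cell from the root.  The cells at depth `d` are those with
`4^d ≤ 3c + 1 < 4^(d+1)`. -/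
def cellDepth {l : ℕ} (c : Cell l) : ℕ := Nat.log 4 (3 * (c : ℕ) + 1)

/-- The grid `G_i` of cells of side `2^i`, which lie at depth `l - i`. -/
def grid (l i : ℕ) : Finset (Cell l) := Finset.univ.filter (fun c => cellDepth c + i = l)

/-- The tree-sparse supports of width `s`: connected sets of cells that contain the root and have
at most `s` cells in each grid. -/
def treeSupports (l s : ℕ) : Set (Finset (Cell l)) :=
  {S | rootCell l ∈ S ∧ ((cellTree l).induce (S : Set (Cell l))).Connected ∧
    ∀ i ≤ l, (S ∩ grid l i).card ≤ s}

/-- The model `𝓜`: vectors supported on a tree of width `s`, with each value at least twice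
the `ℓ₁` norm of the values at the children. -/
def treeModel (l s : ℕ) : Set (Cell l → ℝ) :=
  {y | (∃ S ∈ treeSupports l s, Function.support y ⊆ (S : Set (Cell l))) ∧
    ∀ i, 2 * ∑ j ∈ children i, |y j| ≤ y i}

/-- The `ℓ₁` norm. -/
def l1norm {ι : Type*} [Fintype ι] (y : ι → ℝ) : ℝ := ∑ i, |y i|

/-! ### A unit-cost real RAM

The machine has natural-number registers and arrays (for counters, addresses and pointers) and real
registers and arrays (for data).  A program is a fixed finite text that names finitely many
registers and arrays; arrays are addressed indirectly.  There is no rounding of reals to integers,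
and natural numbers can only be added, subtracted (truncated) and compared. -/

/-- The read-only input: the measurement vector, and the measurement matrix in sparse column
format. -/
structure SketchInput where
  /-- `meas r` is the `r`-th measurement. -/
  meas : ℕ → ℝ
  /-- `colLen j` is the number of nonzero entries in column `j`. -/
  colLen : ℕ → ℕ
  /-- `colRow j q` is the row of the `q`-th nonzero entry in column `j`. -/
  colRow : ℕ → ℕ → ℕ
  /-- `colVal j q` is the value of the `q`-th nonzero entry in column `j`. -/
  colVal : ℕ → ℕ → ℝ

/-- The memory of the machine. -/
structure RAMState where
  nat : ℕ → ℕ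
  real : ℕ → ℝ
  natArr : ℕ → ℕ → ℕ
  realArr : ℕ → ℕ → ℝ

/-- The instructions.  All arguments are names of registers or arrays, except for the constant `v`
in `natConst`. -/
inductive RAMInstr where
  | natConst (x v : ℕ)
  | natAdd (x y z : ℕ)
  | natSub (x y z : ℕ)
  | natLoad (x a i : ℕ)
  | natStore (a i x : ℕ)
  | realOfNat (x y : ℕ)
  | realAdd (x y z : ℕ)
  | realSub (x y z : ℕ)
  | realMul (x y z : ℕ)
  | realDiv (x y z : ℕ)
  | realLoad (x a i : ℕ)
  | realStore (a i x : ℕ)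
  | getMeas (x r : ℕ)
  | getColLen (x j : ℕ)
  | getColRow (x j q : ℕ)
  | getColVal (x j q : ℕ)

namespace RAMState

/-- Write a natural-number register. -/
def setNat (σ : RAMState) (x v : ℕ) : RAMState := { σ with nat := Function.update σ.nat x v }

/-- Write a real register. -/
noncomputable def setReal (σ : RAMState) (x : ℕ) (v : ℝ) : RAMState :=
  { σ with real := Function.update σ.real x v }

/-- Write an entry of a natural-number array. -/
def setNatArr (σ : RAMState) (a i v : ℕ) : RAMState :=
  { σ with natArr := Function.update σ.natArr a (Function.update (σ.natArr a) i v) }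

/-- Write an entry of a real array. -/
noncomputable def setRealArr (σ : RAMState) (a i : ℕ) (v : ℝ) : RAMState :=
  { σ with realArr := Function.update σ.realArr a (Function.update (σ.realArr a) i v) }

end RAMState

/-- The effect of one instruction. -/
noncomputable def RAMInstr.apply (I : SketchInput) (σ : RAMState) : RAMInstr → RAMState
  | natConst x v => σ.setNat x v
  | natAdd x y z => σ.setNat x (σ.nat y + σ.nat z)
  | natSub x y z => σ.setNat x (σ.nat y - σ.nat z)
  | natLoad x a i => σ.setNat x (σ.natArr a (σ.nat i))
  | natStore a i x => σ.setNatArr a (σ.nat i) (σ.nat x)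
  | realOfNat x y => σ.setReal x (σ.nat y : ℝ)
  | realAdd x y z => σ.setReal x (σ.real y + σ.real z)
  | realSub x y z => σ.setReal x (σ.real y - σ.real z)
  | realMul x y z => σ.setReal x (σ.real y * σ.real z)
  | realDiv x y z => σ.setReal x (σ.real y / σ.real z)
  | realLoad x a i => σ.setReal x (σ.realArr a (σ.nat i))
  | realStore a i x => σ.setRealArr a (σ.nat i) (σ.real x)
  | getMeas x r => σ.setReal x (I.meas (σ.nat r))
  | getColLen x j => σ.setNat x (I.colLen (σ.nat j))
  | getColRow x j q => σ.setNat x (I.colRow (σ.nat j) (σ.nat q))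
  | getColVal x j q => σ.setReal x (I.colVal (σ.nat j) (σ.nat q))

/-- The tests: strict comparison of two registers. -/
inductive RAMTest where
  | natLt (x y : ℕ)
  | realLt (x y : ℕ)

/-- The test succeeds. -/
def RAMTest.Holds (σ : RAMState) : RAMTest → Prop
  | natLt x y => σ.nat x < σ.nat y
  | realLt x y => σ.real x < σ.real y

/-- Programs. -/
inductive RAMProg where
  | instr (c : RAMInstr)
  | seq (p q : RAMProg)
  | ite (b : RAMTest) (p q : RAMProg)
  | loop (b : RAMTest) (p : RAMProg)

/-- `p.Exec I σ τ σ'`: started in `σ` on the input `I`, the program `p` halts in `σ'` after exactly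
`τ` steps; every instruction and every evaluation of a test is one step.
`loop b p` repeats `p` as long as `b` holds. -/
inductive RAMProg.Exec (I : SketchInput) : RAMProg → RAMState → ℕ → RAMState → Prop where
  | instr (c : RAMInstr) (σ : RAMState) : Exec I (.instr c) σ 1 (c.apply I σ)
  | seq {p q : RAMProg} {σ σ₁ σ₂ : RAMState} {τ₁ τ₂ : ℕ} :
      Exec I p σ τ₁ σ₁ → Exec I q σ₁ τ₂ σ₂ → Exec I (.seq p q) σ (τ₁ + τ₂) σ₂
  | iteTrue {b : RAMTest} {p q : RAMProg} {σ σ₁ : RAMState} {τ : ℕ} :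
      b.Holds σ → Exec I p σ τ σ₁ → Exec I (.ite b p q) σ (τ + 1) σ₁
  | iteFalse {b : RAMTest} {p q : RAMProg} {σ σ₁ : RAMState} {τ : ℕ} :
      ¬ b.Holds σ → Exec I q σ τ σ₁ → Exec I (.ite b p q) σ (τ + 1) σ₁
  | loopDone {b : RAMTest} {p : RAMProg} {σ : RAMState} :
      ¬ b.Holds σ → Exec I (.loop b p) σ 1 σ
  | loopStep {b : RAMTest} {p : RAMProg} {σ σ₁ σ₂ : RAMState} {τ₁ τ₂ : ℕ} :
      b.Holds σ → Exec I p σ τ₁ σ₁ → Exec I (.loop b p) σ₁ τ₂ σ₂ →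
      Exec I (.loop b p) σ (τ₁ + τ₂ + 1) σ₂

/-- Initially the natural-number registers `0, 1, 2, 3` hold the parameters `l, k, s, m`, and
everything else is zero. -/
def RAMState.init (l k s m : ℕ) : RAMState where
  nat := fun x => if x = 0 then l else if x = 1 then k else if x = 2 then s
    else if x = 3 then m else 0
  real := fun _ => 0
  natArr := fun _ _ => 0
  realArr := fun _ _ => 0

/-- The length of the output list. -/
def RAMState.outLen (σ : RAMState) : ℕ := σ.nat 0

/-- The output is a vector given as a list of coordinates (natural-number array `0`) and values
(real array `0`), whose length is in the natural-number register `0`. -/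
noncomputable def RAMState.output (σ : RAMState) (l : ℕ) : Cell l → ℝ := fun c =>
  ∑ q ∈ Finset.range σ.outLen, if σ.natArr 0 q = (c : ℕ) then σ.realArr 0 q else 0

/-- The rows of the nonzero entries in column `j`, in increasing order. -/
noncomputable def columnRows {m t : ℕ} (A : Matrix (Fin m) (Fin t) ℝ) (j : Fin t) : List (Fin m) :=
  (Finset.univ.filter (fun i => A i j ≠ 0)).sort (· ≤ ·)

/-- The input that consists of the matrix `A`, in sparse column format, and the measurements `b`.
Reading outside the given ranges returns zero. -/
noncomputable def sketchInput {m t : ℕ} (A : Matrix (Fin m) (Fin t) ℝ) (b : Fin m → ℝ) :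
    SketchInput where
  meas := fun r => if h : r < m then b ⟨r, h⟩ else 0
  colLen := fun j => if h : j < t then (columnRows A ⟨j, h⟩).length else 0
  colRow := fun j q => if h : j < t then
    (((columnRows A ⟨j, h⟩)[q]?).map (fun i => (i : ℕ))).getD 0 else 0
  colVal := fun j q => if h : j < t then
    (((columnRows A ⟨j, h⟩)[q]?).map (fun i => A i ⟨j, h⟩)).getD 0 else 0

/-- Given the parameters `l, k, s, m`, the matrix `A` and the measurements `b`, the program halts
and outputs `z`, and the number of steps plus the length of the output list is at most `T`. -/
def RAMProg.ComputesWithin (p : RAMProg) (l k s : ℕ) {m : ℕ}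
    (A : Matrix (Fin m) (Cell l) ℝ) (b : Fin m → ℝ) (z : Cell l → ℝ) (T : ℝ) : Prop :=
  ∃ (τ : ℕ) (σ : RAMState), p.Exec (sketchInput A b) (RAMState.init l k s m) τ σ ∧
    σ.output l = z ∧ ((τ + σ.outLen : ℕ) : ℝ) ≤ T

/-!
The measurements and the recovery do not depend on `ε`.  Let `X = 4 ^ d` be the least power of four
that is at least `K (k + s)`, for a large constant `K`, or `X = n` if there is no such power up
to `n`.  All `O(X)` cells down to depth `d` are selected.  From there a descent through the tree
keeps `X` cells at each of the `l - d ≤ log (n / k)` further depths.  So `q = O(X log (n / k))` cells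
are selected, and the output is an approximation of `y` on them and zero elsewhere.

*Selection.*  At each depth, the cells are hashed to `2 ^ 131 * X` buckets, and the sum of `y` over
each bucket is measured.  Among the `4X` children of the cells that were kept, those with a bucket
sum above a pivot are kept, together with others up to the number `X`.  The pivot is an approximate
quantile (`pivot_spec`), found in time `O(X)` by sorting blocks of increasing length and keeping
every fourth entry.  Let `y'` be in the model.  As `y' ≥ 0`, bucket sums underestimate `y'` only
by the noise `|y - y'|`, and as `y'` has at most `s ≤ X / 16` nonzero entries at a depth, the pivot
is small compared with the noise and the mass missed earlier (`sum_dropped_le`).  The model condition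
says that the children of missed cells carry at most half of the mass of these cells.  Hence the
missed mass contracts by a factor `3 / 4` per depth, up to noise, and the mass of `y` outside the
selected cells is at most `7 ‖y - y'‖₁` (`sum_outside_le`).  This needs only that few of the `4X`
candidates collide.  The candidates depend on the hash values at smaller depths, which are
independent of those at their own depth, so this fails with probability at most
`2 ^ (-X / 32)` at each depth (`card_level_failure_le`).  The hypothesis `k ≥ c₂ log log n` allows
for the union bound over the depths.

*Values.*  Every cell is hashed into eight more tables of `128 q` rows.  With probability
`1 - 1 / (2q)`, each nonempty set of selected cells has fewer than twice its size of repeated table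
positions (`card_table_failure_le`); then some cell in the set has at least five of its eight rows
for itself.  The algorithm evaluates such a cell by the mean of the measurements in these rows, takes
it out of the tables, and goes on with the other cells.  The rows that determine a value are not used
again, and at most three rows pass the error on, so that errors do not accumulate: the total error
is at most half of the total noise in the tables (`Peel.total_error_le`), which comes from the cells
that were not selected.  Peeling takes linear time if for each row the number of its unevaluated
cells, the sum of their positions and the residual are maintained, together with a stack of cells
that may have become ready (`peelProg_spec`).

The programs are analyzed with a small Hoare logic for running times (`RAMProg.Reaches`), in which
every program leaves alone what it does not mention (`RAMProg.Frame`).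
-/

/-! ### Reasoning about programs -/

/-- Sequential composition of programs. -/
infixr:60 " ;; " => RAMProg.seq

namespace RAMState

variable (σ : RAMState) (x y a b i : ℕ)

@[simp] theorem setNat_nat (v : ℕ) :
    (σ.setNat x v).nat y = if y = x then v else σ.nat y := by
  simp [setNat, Function.update_apply]
@[simp] theorem setNat_real (v : ℕ) : (σ.setNat x v).real = σ.real := rfl
@[simp] theorem setNat_natArr (v : ℕ) : (σ.setNat x v).natArr = σ.natArr := rfl
@[simp] theorem setNat_realArr (v : ℕ) : (σ.setNat x v).realArr = σ.realArr := rfl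
@[simp] theorem setReal_real (v : ℝ) :
    (σ.setReal x v).real y = if y = x then v else σ.real y := by
  simp [setReal, Function.update_apply]
@[simp] theorem setReal_nat (v : ℝ) : (σ.setReal x v).nat = σ.nat := rfl
@[simp] theorem setReal_natArr (v : ℝ) : (σ.setReal x v).natArr = σ.natArr := rfl
@[simp] theorem setReal_realArr (v : ℝ) : (σ.setReal x v).realArr = σ.realArr := rfl
@[simp] theorem setNatArr_natArr (v : ℕ) :
    (σ.setNatArr a i v).natArr b =
      if b = a then Function.update (σ.natArr a) i v else σ.natArr b := by
  simp [setNatArr, Function.update_apply]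
@[simp] theorem setNatArr_nat (v : ℕ) : (σ.setNatArr a i v).nat = σ.nat := rfl
@[simp] theorem setNatArr_real (v : ℕ) : (σ.setNatArr a i v).real = σ.real := rfl
@[simp] theorem setNatArr_realArr (v : ℕ) : (σ.setNatArr a i v).realArr = σ.realArr := rfl
@[simp] theorem setRealArr_realArr (v : ℝ) :
    (σ.setRealArr a i v).realArr b =
      if b = a then Function.update (σ.realArr a) i v else σ.realArr b := by
  simp [setRealArr, Function.update_apply]
@[simp] theorem setRealArr_nat (v : ℝ) : (σ.setRealArr a i v).nat = σ.nat := rfl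
@[simp] theorem setRealArr_real (v : ℝ) : (σ.setRealArr a i v).real = σ.real := rfl
@[simp] theorem setRealArr_natArr (v : ℝ) : (σ.setRealArr a i v).natArr = σ.natArr := rfl

end RAMState

namespace RAMInstr

/-- The natural-number registers that the instruction may change. -/
def natWrites : RAMInstr → List ℕ
  | natConst x _ | natAdd x _ _ | natSub x _ _ | natLoad x _ _ | getColLen x _
  | getColRow x _ _ => [x]
  | _ => []

/-- The real registers that the instruction may change. -/
def realWrites : RAMInstr → List ℕ
  | realOfNat x _ | realAdd x _ _ | realSub x _ _ | realMul x _ _ | realDiv x _ _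
  | realLoad x _ _ | getMeas x _ | getColVal x _ _ => [x]
  | _ => []

/-- The natural-number arrays that the instruction may change. -/
def natArrWrites : RAMInstr → List ℕ
  | natStore a _ _ => [a]
  | _ => []

/-- The real arrays that the instruction may change. -/
def realArrWrites : RAMInstr → List ℕ
  | realStore a _ _ => [a]
  | _ => []

end RAMInstr

namespace RAMProg

/-- The instructions that occur in a program. -/
def instrs : RAMProg → List RAMInstr
  | .instr c => [c]
  | .seq p q => p.instrs ++ q.instrs
  | .ite _ p q => p.instrs ++ q.instrs
  | .loop _ p => p.instrs

/-- Outside the registers and arrays that `p` writes, the states `σ` and `σ'` agree.  The premises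
are Boolean, so that `decide` proves them for a concrete program. -/
structure Frame (p : RAMProg) (σ σ' : RAMState) : Prop where
  nat : ∀ x, (p.instrs.all fun c => x ∉ c.natWrites) = true → σ'.nat x = σ.nat x
  real : ∀ x, (p.instrs.all fun c => x ∉ c.realWrites) = true → σ'.real x = σ.real x
  natArr : ∀ x, (p.instrs.all fun c => x ∉ c.natArrWrites) = true → σ'.natArr x = σ.natArr x
  realArr : ∀ x, (p.instrs.all fun c => x ∉ c.realArrWrites) = true → σ'.realArr x = σ.realArr x

theorem Frame.refl (p : RAMProg) (σ : RAMState) : p.Frame σ σ :=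
  ⟨fun _ _ => rfl, fun _ _ => rfl, fun _ _ => rfl, fun _ _ => rfl⟩

theorem Frame.trans {p : RAMProg} {σ σ₁ σ₂ : RAMState} (h₁ : p.Frame σ σ₁) (h₂ : p.Frame σ₁ σ₂) :
    p.Frame σ σ₂ :=
  ⟨fun x h => (h₂.nat x h).trans (h₁.nat x h), fun x h => (h₂.real x h).trans (h₁.real x h),
   fun x h => (h₂.natArr x h).trans (h₁.natArr x h),
   fun x h => (h₂.realArr x h).trans (h₁.realArr x h)⟩

theorem Frame.mono {p q : RAMProg} {σ σ' : RAMState} (h : p.Frame σ σ')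
    (hs : p.instrs ⊆ q.instrs) : q.Frame σ σ' := by
  refine ⟨fun x hx => h.nat x ?_, fun x hx => h.real x ?_, fun x hx => h.natArr x ?_,
    fun x hx => h.realArr x ?_⟩ <;>
  · rw [List.all_eq_true] at hx ⊢
    exact fun c hc => hx c (hs hc)

theorem frame_instr (I : SketchInput) (c : RAMInstr) (σ : RAMState) :
    (instr c).Frame σ (c.apply I σ) := by
  constructor <;> intro x hx <;> cases c <;>
    simp_all [instrs, RAMInstr.natWrites, RAMInstr.realWrites, RAMInstr.natArrWrites,
      RAMInstr.realArrWrites, RAMInstr.apply]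

theorem Exec.frame {I : SketchInput} {p : RAMProg} {σ σ' : RAMState} {τ : ℕ}
    (h : p.Exec I σ τ σ') : p.Frame σ σ' := by
  induction h with
  | instr c σ => exact frame_instr I c σ
  | seq _ _ ih₁ ih₂ =>
    exact (ih₁.mono (by simp [instrs])).trans (ih₂.mono (by simp [instrs]))
  | iteTrue _ _ ih => exact ih.mono (by simp [instrs])
  | iteFalse _ _ ih => exact ih.mono (by simp [instrs])
  | loopDone _ => exact Frame.refl _ _
  | loopStep _ _ _ ih₁ ih₂ => exact (ih₁.mono (by simp [instrs])).trans ih₂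

/-- Started in `σ`, the program halts within `T` steps in a state that satisfies `Q`. -/
def Reaches (I : SketchInput) (p : RAMProg) (σ : RAMState) (T : ℕ) (Q : RAMState → Prop) : Prop :=
  ∃ τ σ', p.Exec I σ τ σ' ∧ τ ≤ T ∧ Q σ'

section Rules

variable {I : SketchInput} {p q : RAMProg} {b : RAMTest} {σ : RAMState} {T T₁ T₂ : ℕ}
  {Q Q₁ : RAMState → Prop}

theorem Reaches.weaken (h : p.Reaches I σ T₁ Q₁) (hT : T₁ ≤ T)
    (hQ : ∀ σ', Q₁ σ' → p.Frame σ σ' → Q σ') : p.Reaches I σ T Q := by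
  obtain ⟨τ, σ', he, ht, hq⟩ := h
  exact ⟨τ, σ', he, ht.trans hT, hQ σ' hq he.frame⟩

theorem reaches_instr (c : RAMInstr) (hT : 1 ≤ T) (h : Q (c.apply I σ)) :
    (instr c).Reaches I σ T Q := ⟨1, _, .instr c σ, hT, h⟩

theorem Reaches.seq (h₁ : p.Reaches I σ T₁ Q₁)
    (h₂ : ∀ σ', Q₁ σ' → p.Frame σ σ' → q.Reaches I σ' T₂ Q) (hT : T₁ + T₂ ≤ T) :
    (p ;; q).Reaches I σ T Q := by
  obtain ⟨τ, σ', he, ht, hq⟩ := h₁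
  obtain ⟨τ', σ'', he', ht', hq'⟩ := h₂ σ' hq he.frame
  exact ⟨_, _, .seq he he', by omega, hq'⟩

theorem reaches_ite (hT : T₁ + 1 ≤ T) (h₁ : b.Holds σ → p.Reaches I σ T₁ Q)
    (h₂ : ¬ b.Holds σ → q.Reaches I σ T₁ Q) : (ite b p q).Reaches I σ T Q := by
  by_cases hb : b.Holds σ
  · obtain ⟨τ, σ', he, ht, hq⟩ := h₁ hb
    exact ⟨_, _, .iteTrue hb he, by omega, hq⟩
  · obtain ⟨τ, σ', he, ht, hq⟩ := h₂ hb
    exact ⟨_, _, .iteFalse hb he, by omega, hq⟩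

/-- A loop that keeps an invariant `Inv`, which relates the state to a bound on the remaining
running time. -/
theorem reaches_loop (Inv : ℕ → RAMState → Prop)
    (hstep : ∀ n σ₁, Inv n σ₁ → (loop b p).Frame σ σ₁ → b.Holds σ₁ →
      ∃ T₁ n', T₁ + n' + 1 ≤ n ∧ p.Reaches I σ₁ T₁ (Inv n'))
    (hdone : ∀ n σ₁, Inv n σ₁ → (loop b p).Frame σ σ₁ → ¬ b.Holds σ₁ → 1 ≤ n ∧ Q σ₁)
    (h0 : Inv T σ) : (loop b p).Reaches I σ T Q := by
  have key : ∀ n σ₁, Inv n σ₁ → (loop b p).Frame σ σ₁ → (loop b p).Reaches I σ₁ n Q := by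
    intro n
    induction n using Nat.strong_induction_on with
    | _ n ih =>
      intro σ₁ h hf
      by_cases hb : b.Holds σ₁
      · obtain ⟨T₁, n', hn, τ, σ₂, he, ht, hi⟩ := hstep n σ₁ h hf hb
        obtain ⟨τ', σ₃, he', ht', hq⟩ := ih n' (by omega) σ₂ hi
          (hf.trans (he.frame.mono (by simp [instrs])))
        exact ⟨_, _, .loopStep hb he he', by omega, hq⟩
      · obtain ⟨h1, hq⟩ := hdone n σ₁ h hf hb
        exact ⟨_, _, .loopDone hb, h1, hq⟩
  exact key T σ h0 (Frame.refl _ _)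

/-- A loop with `n` rounds of at most `c` steps each. -/
theorem reaches_for (n c : ℕ) (Inv : ℕ → RAMState → Prop) (h0 : Inv 0 σ)
    (htest : ∀ i ≤ n, ∀ σ₁, Inv i σ₁ → (loop b p).Frame σ σ₁ → (b.Holds σ₁ ↔ i < n))
    (hstep : ∀ i < n, ∀ σ₁, Inv i σ₁ → (loop b p).Frame σ σ₁ → p.Reaches I σ₁ c (Inv (i + 1)))
    (hT : n * (c + 1) + 1 ≤ T) (hQ : ∀ σ₁, Inv n σ₁ → (loop b p).Frame σ σ₁ → Q σ₁) :
    (loop b p).Reaches I σ T Q := by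
  refine Reaches.weaken (T₁ := n * (c + 1) + 1) (Q₁ := Q) ?_ hT (fun _ h _ => h)
  refine reaches_loop (fun t σ₁ => ∃ i ≤ n, t = (n - i) * (c + 1) + 1 ∧ Inv i σ₁) ?_ ?_
    ⟨0, Nat.zero_le _, by simp, h0⟩
  · rintro t σ₁ ⟨i, hi, rfl, hI⟩ hf hb
    have hin : i < n := (htest i hi σ₁ hI hf).1 hb
    refine ⟨c, (n - (i + 1)) * (c + 1) + 1, ?_, ?_⟩
    · obtain ⟨d, rfl⟩ : ∃ d, n = i + 1 + d := ⟨n - (i + 1), by omega⟩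
      have : i + 1 + d - i = d + 1 := by omega
      rw [this, Nat.add_sub_cancel_left, add_mul]
      omega
    · exact (hstep i hin σ₁ hI hf).weaken le_rfl fun σ' h _ => ⟨i + 1, hin, rfl, h⟩
  · rintro t σ₁ ⟨i, hi, rfl, hI⟩ hf hb
    have : i = n := by
      have := (htest i hi σ₁ hI hf).not.1 hb
      omega
    subst this
    exact ⟨by omega, hQ σ₁ hI hf⟩

end Rules

/-- A straight-line program. -/
def block (c : RAMInstr) : List RAMInstr → RAMProg
  | [] => instr c
  | c' :: cs => instr c ;; block c' cs

theorem reaches_block {I : SketchInput} {Q : RAMState → Prop} {T : ℕ} (cs : List RAMInstr) :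
    ∀ (c : RAMInstr) (σ : RAMState), cs.length + 1 ≤ T →
      Q (cs.foldl (fun σ c => c.apply I σ) (c.apply I σ)) → (block c cs).Reaches I σ T Q := by
  induction cs generalizing T with
  | nil => exact fun c σ hT hQ => reaches_instr c (by simpa using hT) hQ
  | cons c' cs ih =>
    intro c σ hT hQ
    obtain ⟨T, rfl⟩ : ∃ T', T = T' + 1 := ⟨T - 1, by simp at hT; omega⟩
    refine Reaches.seq (T₁ := 1) (T₂ := T) (Q₁ := fun σ' => σ' = c.apply I σ)
      (reaches_instr c le_rfl rfl) ?_ (by omega)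
    rintro _ rfl _
    exact ih c' _ (by simpa using hT) hQ

end RAMProg

/-! ### Approximate selection in linear time -/

/-- One comparison of a sort: the larger of `a t` and `a i` moves to position `t`. -/
noncomputable def cswap (a : ℕ → ℝ) (t i : ℕ) : ℕ → ℝ :=
  if a t < a i then Function.update (Function.update a t (a i)) i (a t) else a

/-- The first `n` comparisons of the insertion of `a i` into the segment that starts at `st`. -/
noncomputable def insertN (a : ℕ → ℝ) (st i : ℕ) : ℕ → ℕ → ℝ
  | 0 => a
  | n + 1 => cswap (insertN a st i n) (st + n) i

/-- The first `n` entries of the array are sorted in decreasing order, separately in each block of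
length `g`. -/
noncomputable def blockSort (a : ℕ → ℝ) (g : ℕ) : ℕ → ℕ → ℝ
  | 0 => a
  | i + 1 => insertN (blockSort a g i) (i / g * g) i (i % g)

/-- Every fourth entry is moved to the front, until there are `n` of them. -/
noncomputable def compressN (a : ℕ → ℝ) : ℕ → ℕ → ℝ
  | 0 => a
  | n + 1 => Function.update (compressN a n) n (compressN a n (4 * n + 3))

/-- The approximate quantile of `a 0, …, a (M - 1)`, and the final content of the array.  While
`g ≤ M`, blocks of length `g` are sorted and every fourth entry is kept; then `g` doubles.  The
sampling errors form a geometric series because the blocks grow. -/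
noncomputable def pivot (g M : ℕ) (a : ℕ → ℝ) : ℝ × (ℕ → ℝ) :=
  if h : g ≤ M ∧ 0 < g then
    pivot (g + g) (M / 4) (compressN (blockSort a g M) (M / 4))
  else
    (blockSort a g M ((M + 15) / 16 - 1), blockSort a g M)
termination_by M
decreasing_by omega

/-- The number of entries among `a 0, …, a (M - 1)` that satisfy `P`. -/
noncomputable def countN (P : ℝ → Prop) (a : ℕ → ℝ) (M : ℕ) : ℕ :=
  open Classical in ∑ x ∈ Finset.range M, if P (a x) then 1 else 0

theorem countN_cswap (P : ℝ → Prop) (a : ℕ → ℝ) {t i M : ℕ} (ht : t < M) (hi : i < M) :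
    countN P (cswap a t i) M = countN P a M := by
  classical
  unfold cswap
  split_ifs with h
  · have : Function.update (Function.update a t (a i)) i (a t) = a ∘ Equiv.swap t i := by
      funext x
      by_cases hx : x = i
      · subst hx; simp
      · by_cases hx' : x = t
        · subst hx'; simp [hx]
        · simp [hx, hx', Equiv.swap_apply_of_ne_of_ne]
    rw [this]
    unfold countN
    refine Finset.sum_bij (fun x _ => Equiv.swap t i x) ?_ ?_ ?_ ?_
    · intro x hx
      simp only [Finset.mem_range] at hx ⊢
      rw [Equiv.swap_apply_def]; split_ifs <;> assumption
    · intro x _ y _ h; exact (Equiv.swap t i).injective h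
    · intro x hx
      refine ⟨Equiv.swap t i x, ?_, by simp⟩
      simp only [Finset.mem_range] at hx ⊢
      rw [Equiv.swap_apply_def]; split_ifs <;> assumption
    · intro x hx; simp
  · rfl

theorem countN_insertN (P : ℝ → Prop) (a : ℕ → ℝ) {st i M : ℕ} (hi : i < M) :
    ∀ n, st + n ≤ i → countN P (insertN a st i n) M = countN P a M
  | 0, _ => rfl
  | n + 1, h => by
    rw [insertN, countN_cswap P _ (by omega) hi, countN_insertN P a hi n (by omega)]

theorem countN_blockSort (P : ℝ → Prop) (a : ℕ → ℝ) (g : ℕ) {M : ℕ} :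
    ∀ n ≤ M, countN P (blockSort a g n) M = countN P a M
  | 0, _ => rfl
  | n + 1, h => by
    rw [blockSort, countN_insertN P _ (by omega) _ (Nat.div_add_mod' n g).le,
      countN_blockSort P a g n (by omega)]

theorem cswap_of_ne (a : ℕ → ℝ) {t i x : ℕ} (h : x ≠ t) (h' : x ≠ i) : cswap a t i x = a x := by
  unfold cswap
  split_ifs <;> simp [h, h']

theorem insertN_of_lt (a : ℕ → ℝ) {st i x : ℕ} (h' : x ≠ i) :
    ∀ n, (x < st ∨ st + n ≤ x) → insertN a st i n x = a x
  | 0, _ => rfl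
  | n + 1, h => by
    rw [insertN, cswap_of_ne _ (by omega) h', insertN_of_lt a h' n (by omega)]

/-- After `n` comparisons, the segment is still decreasing, and the entry to be inserted is at most
each of the first `n`. -/
theorem insertN_spec (a : ℕ → ℝ) {st i : ℕ} (ha : ∀ x y, st ≤ x → x ≤ y → y < i → a y ≤ a x) :
    ∀ n, st + n ≤ i →
      (∀ x y, st ≤ x → x ≤ y → y < i → insertN a st i n y ≤ insertN a st i n x) ∧
      ∀ x, st ≤ x → x < st + n → insertN a st i n i ≤ insertN a st i n x
  | 0, _ => ⟨ha, fun x h h' => by omega⟩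
  | n + 1, h => by
    obtain ⟨h1, h2⟩ := insertN_spec a ha n (by omega)
    rw [insertN]
    set b := insertN a st i n with hb
    unfold cswap
    have hti : st + n ≠ i := by omega
    split_ifs with hc
    · constructor
      · intro x y hx hxy hy
        by_cases hxt : x = st + n
        · subst hxt
          by_cases hyt : y = st + n
          · subst hyt; exact le_rfl
          · have := h1 (st + n) y hx hxy hy
            rw [Function.update_of_ne (by omega), Function.update_of_ne hyt,
              Function.update_of_ne hti, Function.update_self]
            linarith
        · by_cases hyt : y = st + n
          · subst hyt
            rw [Function.update_of_ne (by omega), Function.update_self,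
              Function.update_of_ne (by omega), Function.update_of_ne hxt]
            exact h2 x hx (by omega)
          · rw [Function.update_of_ne (by omega), Function.update_of_ne hyt,
              Function.update_of_ne (by omega), Function.update_of_ne hxt]
            exact h1 x y hx hxy hy
      · intro x hx hxn
        rw [Function.update_self, Function.update_of_ne (by omega)]
        by_cases hxt : x = st + n
        · subst hxt; rw [Function.update_self]; exact hc.le
        · rw [Function.update_of_ne hxt]
          exact h1 x (st + n) hx (by omega) (by omega)
    · refine ⟨h1, fun x hx hxn => ?_⟩
      by_cases hxt : x = st + n
      · subst hxt; exact not_lt.1 hc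
      · exact h2 x hx (by omega)

theorem blockSort_antitone (a : ℕ → ℝ) {g : ℕ} (hg : 0 < g) :
    ∀ n x y, x ≤ y → y < n → x / g = y / g → blockSort a g n y ≤ blockSort a g n x
  | 0, x, y, _, h, _ => by omega
  | n + 1, x, y, hxy, hy, hd => by
    have ih := blockSort_antitone a hg n
    have hdm := Nat.div_add_mod' n g
    have hblock : ∀ z, n / g * g ≤ z → z ≤ n → z / g = n / g := fun z h1 h2 =>
      le_antisymm (Nat.div_le_div_right h2) ((Nat.le_div_iff_mul_le hg).2 h1)
    have hs := insertN_spec (blockSort a g n) (st := n / g * g) (i := n)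
      (fun u v hu huv hv => ih u v huv hv
        ((hblock u hu (by omega)).trans (hblock v (by omega) hv.le).symm)) (n % g) hdm.le
    rw [blockSort]
    by_cases hst : n / g * g ≤ x
    · rcases Nat.lt_or_ge y n with hyn | hyn
      · exact hs.1 x y hst hxy hyn
      · have : y = n := by omega
        subst this
        rcases Nat.lt_or_ge x y with hx | hx
        · exact hs.2 x hst (by omega)
        · have : x = y := by omega
          rw [this]
    · have hylt : y < n / g * g := by
        have h1 : x / g < n / g := (Nat.div_lt_iff_lt_mul hg).2 (by omega)
        rw [hd] at h1
        exact (Nat.div_lt_iff_lt_mul hg).1 h1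
      rw [insertN_of_lt _ (by omega) _ (by omega), insertN_of_lt _ (by omega) _ (by omega)]
      exact ih x y hxy (by omega) hd

theorem compressN_apply (a : ℕ → ℝ) :
    ∀ n i, compressN a n i = if i < n then a (4 * i + 3) else a i
  | 0, i => by simp [compressN]
  | n + 1, i => by
    rw [compressN, Function.update_apply, compressN_apply a n, compressN_apply a n]
    by_cases h : i = n
    · subst h; simp [show ¬ (4 * i + 3 < i) by omega]
    · simp only [h, if_false]
      congr 1
      simp only [eq_iff_iff]; omega

theorem countN_congr {P : ℝ → Prop} {a b : ℕ → ℝ} {M : ℕ} (h : ∀ x < M, a x = b x) :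
    countN P a M = countN P b M := by
  classical
  exact Finset.sum_congr rfl fun x hx => by rw [h x (Finset.mem_range.1 hx)]

theorem countN_add (P : ℝ → Prop) (a : ℕ → ℝ) (M N : ℕ) :
    countN P a (M + N) = countN P a M + countN P (fun x => a (M + x)) N := by
  classical
  simp only [countN, Finset.sum_range_add]

theorem countN_succ (P : ℝ → Prop) (a : ℕ → ℝ) (M : ℕ) [Decidable (P (a M))] :
    countN P a (M + 1) = countN P a M + if P (a M) then 1 else 0 := by
  classical
  simp only [countN, Finset.sum_range_succ]
  congr 1
  split_ifs <;> rfl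

/-- In one sorted block, every fourth entry determines the number of large entries up to `3`. -/
theorem countN_block {P : ℝ → Prop} (hP : ∀ x y, x ≤ y → P x → P y) (f : ℕ → ℝ) (h : ℕ)
    (hf : ∀ x y, x ≤ y → y < 4 * h → f y ≤ f x) :
    4 * countN P (fun i => f (4 * i + 3)) h ≤ countN P f (4 * h) ∧
      countN P f (4 * h) ≤ 4 * countN P (fun i => f (4 * i + 3)) h + 3 := by
  classical
  have key : ∀ k, k + 1 ≤ h →
      4 * countN P (fun i => f (4 * i + 3)) (k + 1) ≤ countN P f (4 * (k + 1)) ∧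
      countN P f (4 * (k + 1)) + 3 * (if P (f (4 * k + 3)) then 1 else 0)
        ≤ 4 * countN P (fun i => f (4 * i + 3)) (k + 1) + 3 := by
    intro k
    induction k with
    | zero =>
      intro hk
      have e : countN P f (4 * (0 + 1)) = (if P (f 0) then 1 else 0) + (if P (f 1) then 1 else 0)
          + (if P (f 2) then 1 else 0) + (if P (f 3) then 1 else 0) := by
        simp only [countN, Finset.sum_range_succ, Finset.sum_range_zero, zero_add, mul_one]
      have h0 := hP _ _ (hf 0 3 (by omega) (by omega))
      have h1 := hP _ _ (hf 1 3 (by omega) (by omega))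
      have h2 := hP _ _ (hf 2 3 (by omega) (by omega))
      rw [e]
      simp only [countN, Finset.sum_range_one, zero_add, mul_zero]
      by_cases h3 : P (f 3)
      · simp [h0 h3, h1 h3, h2 h3, h3]
      · simp only [h3]
        constructor
        · simp
        · split_ifs <;> simp
    | succ k ih =>
      intro hk
      obtain ⟨i1, i2⟩ := ih (by omega)
      have e : countN P f (4 * (k + 1 + 1)) = countN P f (4 * (k + 1))
          + ((if P (f (4 * (k + 1))) then 1 else 0)
          + (if P (f (4 * (k + 1) + 1)) then 1 else 0) + (if P (f (4 * (k + 1) + 2)) then 1 else 0)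
          + (if P (f (4 * (k + 1) + 3)) then 1 else 0)) := by
        rw [show 4 * (k + 1 + 1) = 4 * (k + 1) + 4 by ring, countN_add]
        congr 1
        simp only [countN, Finset.sum_range_succ, Finset.sum_range_zero, zero_add, add_zero]
      have h0 := hP _ _ (hf (4 * (k + 1)) (4 * (k + 1) + 3) (by omega) (by omega))
      have h1 := hP _ _ (hf (4 * (k + 1) + 1) (4 * (k + 1) + 3) (by omega) (by omega))
      have h2 := hP _ _ (hf (4 * (k + 1) + 2) (4 * (k + 1) + 3) (by omega) (by omega))
      have g0 := hP _ _ (hf (4 * k + 3) (4 * (k + 1)) (by omega) (by omega))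
      have g1 := hP _ _ (hf (4 * k + 3) (4 * (k + 1) + 1) (by omega) (by omega))
      have g2 := hP _ _ (hf (4 * k + 3) (4 * (k + 1) + 2) (by omega) (by omega))
      rw [e, countN_succ P _ (k + 1)]
      by_cases h3 : P (f (4 * (k + 1) + 3))
      · simp only [h0 h3, h1 h3, h2 h3, h3, if_true]
        simp only [g0 (h0 h3), if_true] at i2
        omega
      · simp only [h3, if_false]
        by_cases h4 : P (f (4 * k + 3))
        · simp only [h4, if_true] at i2
          split_ifs <;> omega
        · have a0 := mt g0 h4
          have a1 := mt g1 h4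
          have a2 := mt g2 h4
          simp only [h4, if_false] at i2
          simp only [a0, a1, a2, if_false]
          omega
  cases h with
  | zero => simp [countN]
  | succ k => exact ⟨(key k le_rfl).1, by have := (key k le_rfl).2; omega⟩

/-- For `n` sorted blocks, the error of sampling is at most three for each block. -/
theorem countN_blocks {P : ℝ → Prop} (hP : ∀ x y, x ≤ y → P x → P y) (f : ℕ → ℝ) (h : ℕ) :
    ∀ n, (∀ x y, x ≤ y → y < 4 * h * n → x / (4 * h) = y / (4 * h) → f y ≤ f x) →
      4 * countN P (fun i => f (4 * i + 3)) (h * n) ≤ countN P f (4 * h * n) ∧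
        countN P f (4 * h * n) ≤ 4 * countN P (fun i => f (4 * i + 3)) (h * n) + 3 * n
  | 0, _ => by simp [countN]
  | n + 1, hf => by
    obtain ⟨i1, i2⟩ := countN_blocks hP f h n fun x y hxy hy hd =>
      hf x y hxy (by rw [Nat.mul_succ]; omega) hd
    obtain ⟨j1, j2⟩ := countN_block hP (fun x => f (4 * h * n + x)) h fun x y hxy hy => by
      refine hf _ _ (by omega) (by rw [Nat.mul_succ]; omega) ?_
      rw [Nat.mul_add_div (by omega), Nat.mul_add_div (by omega), Nat.div_eq_of_lt hy,
        Nat.div_eq_of_lt (by omega)]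
    rw [Nat.mul_succ, Nat.mul_succ, countN_add, countN_add]
    have e : (fun x => f (4 * (h * n + x) + 3)) = fun x => f (4 * h * n + (4 * x + 3)) := by
      funext x; congr 1; ring
    rw [e]
    omega

/-- At least a sixteenth of the entries are `≥` the pivot, and at most a sixteenth plus `6M/g` are
larger. -/
theorem pivot_spec (M : ℕ) : ∀ (j e : ℕ) (a : ℕ → ℝ), 2 ≤ j → M = 4 ^ e →
    M ≤ 16 * countN (fun x => (pivot (2 ^ j) M a).1 ≤ x) a M ∧
    (countN (fun x => (pivot (2 ^ j) M a).1 < x) a M : ℝ) ≤ M / 16 + 6 * M / 2 ^ j := by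
  induction M using Nat.strong_induction_on with
  | _ M ih =>
  intro j e a hj hM
  rw [pivot]
  have hMpos : 0 < M := hM ▸ by positivity
  split_ifs with hc
  · -- one round of sampling
    obtain ⟨hc, hg⟩ := hc
    have h4j : 2 ^ j = 4 * 2 ^ (j - 2) := by
      obtain ⟨i, rfl⟩ : ∃ i, j = i + 2 := ⟨j - 2, by omega⟩
      rw [pow_add]; simp; ring
    have hle : j ≤ 2 * e := by
      have : (2 : ℕ) ^ j ≤ 2 ^ (2 * e) := by rw [pow_mul]; simpa [hM] using hc
      exact (Nat.pow_le_pow_iff_right (by norm_num)).1 this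
    obtain ⟨n, hn⟩ : (2 : ℕ) ^ j ∣ M := by
      rw [hM, show (4 : ℕ) = 2 ^ 2 by norm_num, ← pow_mul]
      exact pow_dvd_pow 2 hle
    have hM4 : M / 4 = 2 ^ (j - 2) * n := by rw [hn, h4j]; rw [mul_assoc]; simp
    have he : M / 4 = 4 ^ (e - 1) := by
      obtain ⟨i, rfl⟩ : ∃ i, e = i + 1 := ⟨e - 1, by omega⟩
      rw [hM, pow_succ]; simp
    obtain ⟨i1, i2⟩ := ih (M / 4) (by omega) (j + 1) (e - 1)
      (compressN (blockSort a (2 ^ j) M) (M / 4)) (by omega) he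
    rw [← mul_two, ← pow_succ]
    set p := (pivot (2 ^ (j + 1)) (M / 4) (compressN (blockSort a (2 ^ j) M) (M / 4))).1
    have sand : ∀ P : ℝ → Prop, (∀ x y, x ≤ y → P x → P y) →
        4 * countN P (compressN (blockSort a (2 ^ j) M) (M / 4)) (M / 4) ≤ countN P a M ∧
        countN P a M ≤
          4 * countN P (compressN (blockSort a (2 ^ j) M) (M / 4)) (M / 4) + 3 * n := by
      intro P hP
      have h1 := countN_blocks hP (blockSort a (2 ^ j) M) (2 ^ (j - 2)) n (fun x y hxy hy hd => by
        rw [← h4j] at hy hd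
        exact blockSort_antitone a hg M x y hxy (hn ▸ hy) hd)
      rw [← h4j, ← hn, ← hM4, countN_blockSort P a _ M le_rfl] at h1
      rwa [countN_congr (b := fun i => blockSort a (2 ^ j) M (4 * i + 3))]
      intro x hx
      rw [compressN_apply, if_pos hx]
    have s1 := sand (fun x => p ≤ x) (fun x y h h' => h'.trans h)
    have s2 := sand (fun x => p < x) (fun x y h h' => h'.trans_le h)
    constructor
    · have : 4 * (M / 4) = M := by rw [hn, h4j, mul_assoc]; simp
      omega
    · have hr : (M : ℝ) = 2 ^ j * n := by exact_mod_cast hn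
      have hr4 : ((M / 4 : ℕ) : ℝ) = M / 4 := by
        rw [hM4, hr]; push_cast
        have : (2 : ℝ) ^ j = 4 * 2 ^ (j - 2) := by exact_mod_cast h4j
        rw [this]; ring
      have hs : (countN (fun x => p < x) a M : ℝ) ≤
          4 * countN (fun x => p < x) (compressN (blockSort a (2 ^ j) M) (M / 4)) (M / 4)
            + 3 * n := by exact_mod_cast s2.2
      rw [hr4, pow_succ] at i2
      have h2 : (0 : ℝ) < 2 ^ j := by positivity
      have hn' : (M : ℝ) / 2 ^ j = n := by rw [hr]; field_simp
      have : 6 * ((M : ℝ) / 4) / (2 ^ j * 2) = 3 / 4 * n := by rw [← hn']; field_simp; norm_num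
      have h3 : 6 * (M : ℝ) / 2 ^ j = 6 * n := by rw [← hn']; ring
      rw [this] at i2
      rw [h3]
      linarith
  · have hg : 0 < 2 ^ j := by positivity
    have hgM : M < 2 ^ j := by
      by_contra h
      exact hc ⟨not_lt.1 h, hg⟩
    have anti : ∀ x y, x ≤ y → y < M → blockSort a (2 ^ j) M y ≤ blockSort a (2 ^ j) M x :=
      fun x y hxy hy => blockSort_antitone a hg M x y hxy hy (by
        rw [Nat.div_eq_of_lt (by omega), Nat.div_eq_of_lt (by omega)])
    set b := blockSort a (2 ^ j) M with hb
    set f := (M + 15) / 16 - 1 with hf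
    have hfM : f < M := by omega
    classical
    dsimp only
    rw [← countN_blockSort _ a (2 ^ j) M le_rfl, ← countN_blockSort _ a (2 ^ j) M le_rfl, ← hb]
    constructor
    · have : f + 1 ≤ countN (fun x => b f ≤ x) b M := by
        calc f + 1 = ∑ x ∈ Finset.range (f + 1), 1 := by simp
          _ = ∑ x ∈ Finset.range (f + 1), if b f ≤ b x then 1 else 0 :=
            Finset.sum_congr rfl fun x hx => by
              rw [if_pos]; exact anti x f (by simp at hx; omega) hfM
          _ ≤ ∑ x ∈ Finset.range M, if b f ≤ b x then 1 else 0 :=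
            Finset.sum_le_sum_of_subset (by simpa using hfM)
          _ = _ := by simp only [countN]
      omega
    · have : countN (fun x => b f < x) b M ≤ f := by
        simp only [countN]
        rw [← Finset.sum_filter, Finset.sum_const, smul_eq_mul, mul_one]
        calc _ ≤ (Finset.range f).card := Finset.card_le_card fun x hx => by
              simp only [Finset.mem_filter, Finset.mem_range] at hx ⊢
              by_contra h
              exact absurd (anti f x (not_lt.1 h) hx.1) (not_le.2 hx.2)
          _ = f := by simp
      have h16 : 16 * f ≤ M := by omega
      have h1 : (countN (fun x => b f < x) b M : ℝ) ≤ f := by exact_mod_cast this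
      have h2 : (16 : ℝ) * f ≤ M := by exact_mod_cast h16
      have : (0 : ℝ) ≤ 6 * M / 2 ^ j := by positivity
      linarith

open RAMProg RAMInstr RAMTest

/-! ### A program for approximate selection -/

/-- A program without effect on the registers in use. -/
def skipProg : RAMProg := instr (natConst 39 0)

/-- Insertion of entry `nat 27` of the real array `1` into the segment from `nat 33` on. -/
def insertProg : RAMProg :=
  loop (natLt 33 27)
    (block (realLoad 3 1 33) [realLoad 4 1 27] ;;
     ite (realLt 3 4) (block (realStore 1 33 4) [realStore 1 27 3]) skipProg ;;
     instr (natAdd 33 33 30))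

/-- Sorting of the first `nat 24` entries of the real array `1` in blocks of length `nat 25`. -/
def blockSortProg : RAMProg :=
  block (natConst 27 0) [natConst 28 0, natConst 32 0] ;;
  loop (natLt 27 24)
    (instr (natAdd 33 28 29) ;;
     insertProg ;;
     block (natAdd 27 27 30) [natAdd 32 32 30] ;;
     ite (natLt 32 25) skipProg (block (natAdd 28 27 29) [natConst 32 0]))

/-- Every fourth entry of the real array `1` moves to the front. -/
def compressProg : RAMProg :=
  block (natConst 27 0) [natConst 28 3] ;;
  loop (natLt 28 24)
    (block (realLoad 3 1 28) [realStore 1 27 3, natAdd 27 27 30, natAdd 28 28 35])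

/-- The pivot of the first `nat 24` entries of the real array `1`. -/
def pivotProg : RAMProg :=
  block (natConst 35 4) [natConst 36 16, natConst 25 64, natAdd 26 24 30] ;;
  loop (natLt 25 26)
    (blockSortProg ;;
     compressProg ;;
     block (natAdd 24 27 29) [natAdd 25 25 25, natAdd 26 24 30]) ;;
  blockSortProg ;;
  block (natConst 27 0) [natConst 28 0] ;;
  loop (natLt 27 24) (block (natAdd 27 27 36) [natAdd 28 28 30]) ;;
  block (natSub 28 28 30) [realLoad 1 1 28]

theorem insertProg_spec (I : SketchInput) (σ : RAMState) (a : ℕ → ℝ) (st n : ℕ)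
    (h33 : σ.nat 33 = st) (h27 : σ.nat 27 = st + n) (h30 : σ.nat 30 = 1)
    (ha : σ.realArr 1 = a) :
    insertProg.Reaches I σ (7 * n + 1) (fun σ' => σ'.realArr 1 = insertN a st (st + n) n) := by
  refine reaches_for n 6 (fun i σ' => σ'.nat 33 = st + i ∧
    σ'.realArr 1 = insertN a st (st + n) i) ⟨by simpa using h33, ha⟩ ?_ ?_ (by omega)
    (fun σ' h _ => h.2)
  · rintro i hi σ' ⟨h1, h2⟩ hf
    have := hf.nat 27 (by decide)
    simp only [Holds, h1, this, h27]; omega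
  · rintro i hi σ' ⟨h1, h2⟩ hf
    have f27 := hf.nat 27 (by decide)
    have f30 := hf.nat 30 (by decide)
    rw [h27] at f27
    rw [h30] at f30
    refine Reaches.seq (T₁ := 2) (T₂ := 4) (Q₁ := fun σ'' => σ''.nat = σ'.nat ∧
      σ''.realArr = σ'.realArr ∧ σ''.real 3 = σ'.realArr 1 (st + i) ∧
      σ''.real 4 = σ'.realArr 1 (st + n)) (reaches_block _ _ _ (by simp) ?_) ?_ (by omega)
    · simp [apply, h1, f27]
    · rintro σ'' ⟨g1, g2, g3, g4⟩ -
      refine Reaches.seq (T₁ := 3) (T₂ := 1) (Q₁ := fun τ => τ.nat 33 = σ'.nat 33 ∧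
        τ.nat 30 = σ'.nat 30 ∧
        τ.realArr 1 = cswap (σ'.realArr 1) (st + i) (st + n)) ?_ ?_ (by omega)
      · refine reaches_ite (T₁ := 2) (by omega) (fun hb => ?_) (fun hb => ?_)
        · refine reaches_block _ _ _ (by simp) ?_
          simp only [Holds, g3, g4] at hb
          simp [apply, g1, g2, g3, g4, h1, f27, cswap, hb]
        · refine reaches_instr _ (by omega) ?_
          simp only [Holds, g3, g4] at hb
          simp [apply, g1, g2, cswap, hb]
      · rintro τ ⟨k1, k2, k3⟩ -
        refine reaches_instr _ (by omega) ?_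
        simp [apply, k1, k2, k3, h1, f30, h2, insertN, add_assoc]

theorem div_mul_succ {i g : ℕ} (hg : 0 < g) :
    (i + 1) / g * g = (if i % g + 1 < g then i / g * g else i + 1) ∧
      (i + 1) % g = if i % g + 1 < g then i % g + 1 else 0 := by
  have h1 := Nat.div_add_mod' i g
  have h2 := Nat.mod_lt i hg
  split_ifs with h
  · have e : i + 1 = (i % g + 1) + g * (i / g) := by rw [mul_comm g]; omega
    have a1 : (i + 1) / g = i / g := by
      rw [e, Nat.add_mul_div_left _ _ hg, Nat.div_eq_of_lt h, zero_add]
    refine ⟨by rw [a1], ?_⟩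
    rw [e, Nat.add_mul_mod_self_left, Nat.mod_eq_of_lt h]
  · have e : i + 1 = (i / g + 1) * g := by rw [add_mul]; omega
    rw [e, Nat.mul_div_cancel _ hg, Nat.mul_mod_left]
    simp

theorem blockSortProg_spec (I : SketchInput) (σ : RAMState) (a : ℕ → ℝ) (g M : ℕ) (hg : 0 < g)
    (h24 : σ.nat 24 = M) (h25 : σ.nat 25 = g) (h29 : σ.nat 29 = 0) (h30 : σ.nat 30 = 1)
    (ha : σ.realArr 1 = a) :
    blockSortProg.Reaches I σ (M * (7 * g + 9) + 4)
      (fun σ' => σ'.realArr 1 = blockSort a g M) := by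
  refine Reaches.seq (T₁ := 3) (T₂ := M * (7 * g + 9) + 1) (Q₁ := fun σ' => σ'.nat 27 = 0 ∧
    σ'.nat 28 = 0 ∧ σ'.nat 32 = 0 ∧ σ'.realArr 1 = a ∧ σ'.nat 24 = M ∧ σ'.nat 25 = g ∧
    σ'.nat 29 = 0 ∧ σ'.nat 30 = 1)
    (reaches_block _ _ _ (by simp) (by simp [apply, *])) ?_ (by omega)
  rintro σ ⟨h27, h28, h32, ha, h24, h25, h29, h30⟩ -
  refine reaches_for M (7 * g + 8) (fun i σ' => σ'.nat 27 = i ∧ σ'.nat 28 = i / g * g ∧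
    σ'.nat 32 = i % g ∧ σ'.realArr 1 = blockSort a g i)
      ⟨h27, by simpa using h28, by simpa using h32,
    ha⟩ ?_ ?_ le_rfl (fun σ' h _ => h.2.2.2)
  · rintro i hi σ' ⟨h1, -⟩ hf
    have := hf.nat 24 (by decide)
    simp only [Holds, h1, this, h24]
  · rintro i hi σ' ⟨h1, h2, h3, h4⟩ hf
    have f25 := (hf.nat 25 (by decide)).trans h25
    have f29 := (hf.nat 29 (by decide)).trans h29
    have f30 := (hf.nat 30 (by decide)).trans h30
    have hm := Nat.mod_lt i hg
    have hdm := Nat.div_add_mod' i g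
    refine Reaches.seq (T₁ := 1) (T₂ := 7 * g + 7) (Q₁ := fun τ => τ.nat 33 = i / g * g ∧
      τ.realArr 1 = blockSort a g i ∧ τ.nat 27 = i ∧ τ.nat 30 = 1 ∧ τ.nat 32 = i % g ∧
      τ.nat 25 = g ∧ τ.nat 29 = 0 ∧ τ.nat 28 = i / g * g)
      (reaches_instr _ le_rfl (by simp [apply, *])) ?_ (by omega)
    rintro τ ⟨k33, ka, k27, k30, k32, k25, k29, k28⟩ -
    refine Reaches.seq (T₁ := 7 * (i % g) + 1) (T₂ := 5) (insertProg_spec I τ _ (i / g * g) (i % g)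
      k33 (by omega) k30 ka) ?_ (by omega)
    rintro τ' hτ' hf'
    have f25 := (hf'.nat 25 (by decide)).trans k25
    have f27 := (hf'.nat 27 (by decide)).trans k27
    have f28 := (hf'.nat 28 (by decide)).trans k28
    have f29 := (hf'.nat 29 (by decide)).trans k29
    have f30 := (hf'.nat 30 (by decide)).trans k30
    have f32 := (hf'.nat 32 (by decide)).trans k32
    refine Reaches.seq (T₁ := 2) (T₂ := 3) (Q₁ := fun υ => υ.nat 27 = i + 1 ∧
      υ.nat 28 = i / g * g ∧ υ.nat 32 = i % g + 1 ∧ υ.nat 25 = g ∧ υ.nat 29 = 0 ∧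
      υ.realArr 1 = blockSort a g (i + 1))
      (reaches_block _ _ _ (by simp) ?_) ?_ (by omega)
    · simp [apply, *, blockSort]
    rintro υ ⟨u27, u28, u32, u25, u29, ua⟩ -
    obtain ⟨e1, e2⟩ := div_mul_succ (i := i) hg
    refine reaches_ite (T₁ := 2) (by omega) (fun hb => ?_) (fun hb => ?_)
    · refine reaches_instr _ (by omega) ?_
      simp only [Holds, u32, u25] at hb
      rw [if_pos hb] at e1 e2
      simp [apply, u27, u28, u32, ua, e1, e2]
    · refine reaches_block _ _ _ (by simp) ?_
      simp only [Holds, u32, u25] at hb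
      rw [if_neg hb] at e1 e2
      simp [apply, u27, u29, ua, e1, e2]

theorem compressProg_spec (I : SketchInput) (σ : RAMState) (a : ℕ → ℝ) (M : ℕ)
    (h24 : σ.nat 24 = M) (h30 : σ.nat 30 = 1) (h35 : σ.nat 35 = 4) (ha : σ.realArr 1 = a) :
    compressProg.Reaches I σ (2 * M + 3)
      (fun σ' => σ'.realArr 1 = compressN a (M / 4) ∧ σ'.nat 27 = M / 4) := by
  refine Reaches.seq (T₁ := 2) (T₂ := 2 * M + 1) (Q₁ := fun σ' => σ'.nat 27 = 0 ∧
    σ'.nat 28 = 3 ∧ σ'.realArr 1 = a ∧ σ'.nat 24 = M ∧ σ'.nat 30 = 1 ∧ σ'.nat 35 = 4)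
    (reaches_block _ _ _ (by simp) (by simp [apply, *])) ?_ (by omega)
  rintro σ ⟨h27, h28, ha, h24, h30, h35⟩ -
  refine reaches_for (M / 4) 4 (fun i σ' => σ'.nat 27 = i ∧ σ'.nat 28 = 4 * i + 3 ∧
    σ'.realArr 1 = compressN a i) ⟨h27, h28, ha⟩ ?_ ?_ (by omega)
    (fun σ' h _ => ⟨h.2.2, h.1⟩)
  · rintro i hi σ' ⟨h1, h2, -⟩ hf
    have := hf.nat 24 (by decide)
    simp only [Holds, h2, this, h24]; omega
  · rintro i hi σ' ⟨h1, h2, h3⟩ hf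
    have f30 := (hf.nat 30 (by decide)).trans h30
    have f35 := (hf.nat 35 (by decide)).trans h35
    refine reaches_block _ _ _ (by simp) ?_
    simp [apply, *, compressN, mul_add]

/-- The pivot is found in linear time: the sampling rounds cost `O(M * g)`, and `M * g` halves from
each round to the next.  Registers `29` and `30` hold the constants `0` and `1` throughout. -/
theorem pivotProg_spec (I : SketchInput) (σ : RAMState) (a : ℕ → ℝ) (M : ℕ) (hM : 0 < M)
    (h24 : σ.nat 24 = M) (h29 : σ.nat 29 = 0) (h30 : σ.nat 30 = 1) (ha : σ.realArr 1 = a) :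
    pivotProg.Reaches I σ (5000 * M)
      (fun σ' => σ'.real 1 = (pivot 64 M a).1 ∧ σ'.realArr 1 = (pivot 64 M a).2) := by
  refine Reaches.seq (T₁ := 6) (T₂ := 2560 * M + (1030 * M + 10)) (Q₁ := fun σ' => σ'.nat 29 = 0 ∧
    σ'.nat 30 = 1 ∧ σ'.nat 35 = 4 ∧ σ'.nat 36 = 16 ∧ σ'.nat 25 = 64 ∧ σ'.nat 26 = M + 1 ∧
    σ'.realArr 1 = a ∧ σ'.nat 24 = M)
    (reaches_block _ _ _ (by simp) (by simp [apply, *])) ?_ (by omega)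
  rintro σ ⟨h29, h30, h35, h36, h25, h26, ha, h24⟩ -
  -- `M * g` halves in every round
  refine Reaches.seq (T₁ := 2560 * M) (T₂ := 1030 * M + 10) (Q₁ := fun σ' => ∃ g' M' a',
    0 < g' ∧ 0 < M' ∧ M' * g' ≤ 64 * M ∧ M' ≤ M ∧ M' < g' ∧ σ'.nat 24 = M' ∧ σ'.nat 25 = g' ∧
    σ'.realArr 1 = a' ∧ pivot g' M' a' = pivot 64 M a)
    (reaches_loop (fun n σ' => ∃ g' M' a', 1 < g' ∧ 0 < M' ∧ 40 * (M' * g') ≤ n ∧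
      M' * g' ≤ 64 * M ∧ M' ≤ M ∧ 4 ∣ g' ∧ σ'.nat 24 = M' ∧ σ'.nat 25 = g' ∧ σ'.nat 26 = M' + 1 ∧
      σ'.realArr 1 = a' ∧ pivot g' M' a' = pivot 64 M a) ?_ ?_ ?_) ?_ (by omega)
  · rintro n σ' ⟨g', M', a', hg, hM', hn, hMg, hMM, h4, k24, k25, k26, ka, kp⟩ hf hb
    simp only [Holds, k25, k26] at hb
    have f29 := (hf.nat 29 (by decide)).trans h29
    have f30 := (hf.nat 30 (by decide)).trans h30
    have f35 := (hf.nat 35 (by decide)).trans h35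
    have hgM : g' ≤ M' := by omega
    have h2 : M' / 4 * (g' + g') * 2 ≤ M' * g' := by
      have : M' / 4 * 4 ≤ M' := Nat.div_mul_le_self _ _
      calc M' / 4 * (g' + g') * 2 = M' / 4 * 4 * g' := by ring
        _ ≤ _ := Nat.mul_le_mul_right _ this
    have h3 : 2 * M' ≤ M' * g' := by rw [mul_comm]; exact Nat.mul_le_mul_left _ hg
    have h4g : 4 ≤ g' := Nat.le_of_dvd (by omega) h4
    have h5 : 4 * M' ≤ M' * g' := by rw [mul_comm]; exact Nat.mul_le_mul_left _ h4g
    have h6 : M' * (7 * g' + 9) = 7 * (M' * g') + 9 * M' := by ring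
    refine ⟨M' * (7 * g' + 9) + 4 + (2 * M' + 3) + 3, 40 * (M' / 4 * (g' + g')), ?_, ?_⟩
    · omega
    refine Reaches.seq (T₂ := 2 * M' + 3 + 3)
      (blockSortProg_spec I σ' a' g' M' (by omega) k24 k25 f29 f30 ka) ?_ (by omega)
    intro τ hτ hf1
    refine Reaches.seq (T₂ := 3)
      (compressProg_spec I τ _ M' ((hf1.nat 24 (by decide)).trans k24)
        ((hf1.nat 30 (by decide)).trans f30) ((hf1.nat 35 (by decide)).trans f35) hτ) ?_ (by omega)
    rintro υ ⟨hυ, hυ27⟩ hf2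
    have f29 := (hf2.nat 29 (by decide)).trans ((hf1.nat 29 (by decide)).trans f29)
    have f30 := (hf2.nat 30 (by decide)).trans ((hf1.nat 30 (by decide)).trans f30)
    have f25 := (hf2.nat 25 (by decide)).trans ((hf1.nat 25 (by decide)).trans k25)
    refine reaches_block _ _ _ (by simp) ?_
    refine ⟨g' + g', M' / 4, compressN (blockSort a' g' M') (M' / 4), by omega, by omega, le_rfl,
      by omega, by omega, by omega, ?_⟩
    refine ⟨by simp [apply, *], by simp [apply, *], by simp [apply, *], by simp [apply, *], ?_⟩
    rw [← kp, pivot.eq_def g', dif_pos ⟨hgM, by omega⟩]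
  · rintro n σ' ⟨g', M', a', hg, hM', hn, hMg, hMM, h4, k24, k25, k26, ka, kp⟩ hf hb
    simp only [Holds, k25, k26] at hb
    refine ⟨?_, g', M', a', by omega, by omega, hMg, hMM, by omega, k24, k25, ka, kp⟩
    have : 1 ≤ M' * g' := Nat.mul_pos hM' (by omega)
    omega
  · exact ⟨64, M, a, by norm_num, hM, by omega, by omega, le_rfl, by norm_num, h24, h25, h26, ha,
      rfl⟩
  · rintro σ' ⟨g', M', a', hg, hM', hMg, hMM, hlt, k24, k25, ka, kp⟩ hf
    have f29 := (hf.nat 29 (by decide)).trans h29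
    have f30 := (hf.nat 30 (by decide)).trans h30
    have f36 := (hf.nat 36 (by decide)).trans h36
    rw [pivot.eq_def g', dif_neg (by omega)] at kp
    rw [← kp]
    have h6 : M' * (7 * g' + 9) = 7 * (M' * g') + 9 * M' := by ring
    refine Reaches.seq (T₂ := 3 * M' + 5)
      (blockSortProg_spec I σ' a' g' M' hg k24 k25 f29 f30 ka) ?_ (by omega)
    intro τ hτ hf1
    have f24 := (hf1.nat 24 (by decide)).trans k24
    have f30 := (hf1.nat 30 (by decide)).trans f30
    have f36 := (hf1.nat 36 (by decide)).trans f36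
    refine Reaches.seq (T₁ := 2) (T₂ := 3 * M' + 3) (Q₁ := fun υ => υ.nat 27 = 0 ∧ υ.nat 28 = 0 ∧
      υ.nat 24 = M' ∧ υ.nat 30 = 1 ∧ υ.nat 36 = 16 ∧ υ.realArr 1 = blockSort a' g' M')
      (reaches_block _ _ _ (by simp) (by simp [apply, *])) ?_ (by omega)
    rintro υ ⟨u27, u28, u24, u30, u36, ua⟩ -
    refine Reaches.seq (T₁ := 3 * M' + 1) (T₂ := 2) (Q₁ := fun υ => υ.nat 28 = (M' + 15) / 16 ∧
      υ.nat 30 = 1 ∧ υ.realArr 1 = blockSort a' g' M') ?_ ?_ (by omega)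
    · refine reaches_for ((M' + 15) / 16) 2 (fun i σ' => σ'.nat 27 = 16 * i ∧ σ'.nat 28 = i)
        ⟨u27, u28⟩ ?_ ?_ (by omega) ?_
      · rintro i hi ρ ⟨r1, r2⟩ hf
        have := hf.nat 24 (by decide)
        simp only [Holds, r1, this, u24]; omega
      · rintro i hi ρ ⟨r1, r2⟩ hf
        have r30 := (hf.nat 30 (by decide)).trans u30
        have r36 := (hf.nat 36 (by decide)).trans u36
        refine reaches_block _ _ _ (by simp) ?_
        simp [apply, *]; omega
      · rintro ρ ⟨r1, r2⟩ hf
        exact ⟨r2, (hf.nat 30 (by decide)).trans u30, (hf.realArr 1 (by decide)).trans ua⟩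
    · rintro ρ ⟨r28, r30, ra⟩ -
      refine reaches_block _ _ _ (by simp) ?_
      simp [apply, *]

/-! ### Descent through the tree -/

/-- From position `off` on, the array `f` contains the list `l`. -/
def ListAt {α : Type*} (f : ℕ → α) (off : ℕ) (l : List α) : Prop :=
  ∀ i (h : i < l.length), f (off + i) = l[i]

section ListAt

variable {α : Type*} {f g : ℕ → α} {off : ℕ} {l l₁ l₂ : List α}

theorem listAt_nil : ListAt f off [] := fun i h => by simp at h

theorem listAt_append :
    ListAt f off (l₁ ++ l₂) ↔ ListAt f off l₁ ∧ ListAt f (off + l₁.length) l₂ := by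
  constructor
  · intro h
    refine ⟨fun i hi => ?_, fun i hi => ?_⟩
    · rw [h i (by simp; omega), List.getElem_append_left hi]
    · rw [add_assoc, h (l₁.length + i) (by simp; omega), List.getElem_append_right (by omega)]
      simp
  · rintro ⟨h₁, h₂⟩ i hi
    by_cases h : i < l₁.length
    · rw [h₁ i h, List.getElem_append_left h]
    · have := h₂ (i - l₁.length) (by simp at hi; omega)
      rw [List.getElem_append_right (by omega), ← this]
      congr 1; omega

theorem ListAt.congr (h : ListAt f off l) (hg : ∀ i, off ≤ i → i < off + l.length → g i = f i) :
    ListAt g off l := fun i hi => by rw [hg _ (by omega) (by omega), h i hi]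

theorem ListAt.concat (h : ListAt f 0 l) (x : α) :
    ListAt (Function.update f l.length x) 0 (l ++ [x]) := by
  rw [listAt_append]
  refine ⟨h.congr fun i _ hi => Function.update_of_ne (by omega) _ _, fun i hi => ?_⟩
  have : i = 0 := by simpa using hi
  subst this
  simp

theorem ListAt.take (h : ListAt f off l) (n : ℕ) : ListAt f off (l.take n) := by
  rw [← List.take_append_drop n l, listAt_append] at h
  exact h.1

end ListAt

/-- The array `a` with its first entries replaced by the list `l`. -/
noncomputable def overwrite (a : ℕ → ℝ) (l : List ℝ) : ℕ → ℝ :=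
  fun i => if h : i < l.length then l[i] else a i

theorem overwrite_concat (a : ℕ → ℝ) (l : List ℝ) (x : ℝ) :
    overwrite a (l ++ [x]) = Function.update (overwrite a l) l.length x := by
  funext i
  unfold overwrite
  rcases lt_trichotomy i l.length with h | h | h
  · rw [Function.update_of_ne h.ne, dif_pos h, dif_pos (by rw [List.length_append]; omega),
      List.getElem_append_left h]
  · subst h; simp
  · rw [Function.update_of_ne h.ne',
      dif_neg (by rw [List.length_append, List.length_singleton]; omega),
      dif_neg (by omega)]

/-- The children of the cells in a list. -/
def childList (ks : List ℕ) : List ℕ :=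
  ks.flatMap fun p => [4 * p + 1, 4 * p + 2, 4 * p + 3, 4 * p + 4]

theorem length_childList (ks : List ℕ) : (childList ks).length = 4 * ks.length := by
  simp [childList, List.length_flatMap, mul_comm]

/-- One step of the descent.  Among the children of the selected cells, those with a value above
the pivot are selected, and others to keep their number constant.  The state consists of the
selected cells and the content of the work array. -/
noncomputable def levelStep (val : ℕ → ℝ) (st : List ℕ × (ℕ → ℝ)) : List ℕ × (ℕ → ℝ) :=
  let cand := childList st.1
  let pv := pivot 64 cand.length (overwrite st.2 (cand.map val))
  ((cand.filter (fun c => pv.1 < val c) ++ cand.filter (fun c => ¬ pv.1 < val c)).take st.1.length,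
    pv.2)

/-- The state of the descent after some steps. -/
noncomputable def levelState (val : ℕ → ℝ) (st : List ℕ × (ℕ → ℝ)) : ℕ → List ℕ × (ℕ → ℝ)
  | 0 => st
  | j + 1 => levelStep val (levelState val st j)

/-- The list of all cells selected after some steps. -/
noncomputable def outList (val : ℕ → ℝ) (st : List ℕ × (ℕ → ℝ)) (out : List ℕ) : ℕ → List ℕ
  | 0 => out
  | j + 1 => outList val st out j ++ (levelState val st (j + 1)).1

theorem length_levelState (val : ℕ → ℝ) (st : List ℕ × (ℕ → ℝ)) :
    ∀ j, (levelState val st j).1.length = st.1.length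
  | 0 => rfl
  | j + 1 => by
    have h : ∀ (l : List ℕ) (P : ℕ → Prop) [DecidablePred P],
        (l.filter (fun c => P c)).length + (l.filter (fun c => ¬ P c)).length = l.length := by
      intro l P _
      have := List.length_eq_length_filter_add (l := l) (fun c => decide (P c))
      simpa using this.symm
    rw [levelState, levelStep]
    simp only [List.length_take, List.length_append, h, length_childList,
      length_levelState val st j]
    omega

/-- The value that the input assigns to a cell: the measurement in the first row of its column. -/
def SketchInput.cellVal (I : SketchInput) (c : ℕ) : ℝ := I.meas (I.colRow c 0)

/-- The cell after the one in `nat 20` is appended to the candidates. -/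
def visitProg : RAMProg :=
  block (natAdd 20 20 30) [natStore 1 17 20, getColRow 21 20 29, getMeas 0 21, realStore 1 17 0,
    realStore 2 17 0, natAdd 17 17 30]

/-- The children of the `nat 4` selected cells, which stand at position `nat 14`, are listed. -/
def gatherProg : RAMProg :=
  block (natConst 16 0) [natConst 17 0] ;;
  loop (natLt 16 4)
    (block (natAdd 18 14 16) [natLoad 19 0 18, natAdd 20 19 19, natAdd 20 20 20] ;;
     visitProg ;; visitProg ;; visitProg ;; visitProg ;;
     instr (natAdd 16 16 30))

/-- The candidates with a value above the pivot (or, if `flip`, the others) are appended to the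
list. -/
def passProg (flip : Bool) : RAMProg :=
  instr (natConst 16 0) ;;
  loop (natLt 16 17)
    (instr (realLoad 2 2 16) ;;
     ite (realLt 1 2)
      (if flip then skipProg
        else block (natLoad 19 1 16) [natStore 0 22 19, natAdd 22 22 30])
      (if flip then block (natLoad 19 1 16) [natStore 0 22 19, natAdd 22 22 30]
        else skipProg) ;;
     instr (natAdd 16 16 30))

/-- One step of the descent. -/
def levelProg : RAMProg :=
  gatherProg ;;
  instr (natAdd 24 17 29) ;;
  pivotProg ;;
  instr (natAdd 22 13 29) ;;
  passProg false ;;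
  passProg true ;;
  block (natAdd 14 13 29) [natAdd 13 13 4]

/-- The candidates `cs` have been listed. -/
structure Gathered (I : SketchInput) (w : ℕ → ℝ) (cs : List ℕ) (σ : RAMState) : Prop where
  len : σ.nat 17 = cs.length
  cells : ListAt (σ.natArr 1) 0 cs
  vals : ListAt (σ.realArr 2) 0 (cs.map I.cellVal)
  work : σ.realArr 1 = overwrite w (cs.map I.cellVal)

theorem visitProg_spec (I : SketchInput) (w : ℕ → ℝ) (cs : List ℕ) (σ : RAMState) (c : ℕ)
    (h : Gathered I w cs σ) (h20 : σ.nat 20 = c) (h29 : σ.nat 29 = 0) (h30 : σ.nat 30 = 1) :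
    visitProg.Reaches I σ 7 (fun σ' => Gathered I w (cs ++ [c + 1]) σ' ∧ σ'.nat 20 = c + 1 ∧
      σ'.nat 29 = 0 ∧ σ'.nat 30 = 1) := by
  refine reaches_block _ _ _ (by simp) ⟨⟨?_, ?_, ?_, ?_⟩, ?_, ?_, ?_⟩
  · simp [apply, h.len, h30]
  · have := h.cells.concat (c + 1)
    simpa [apply, h.len, h30, h20] using this
  · have := h.vals.concat (I.cellVal (c + 1))
    simpa [apply, h.len, h30, h20, h29, SketchInput.cellVal] using this
  · simp [apply, h.len, h30, h20, h29, SketchInput.cellVal, h.work, overwrite_concat]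
  all_goals simp [apply, *]

theorem gatherProg_spec (I : SketchInput) (w : ℕ → ℝ) (ks : List ℕ) (σ : RAMState) (lo : ℕ)
    (h4 : σ.nat 4 = ks.length) (h14 : σ.nat 14 = lo) (h29 : σ.nat 29 = 0) (h30 : σ.nat 30 = 1)
    (hks : ListAt (σ.natArr 0) lo ks) (hw : σ.realArr 1 = w) :
    gatherProg.Reaches I σ (34 * ks.length + 3) (Gathered I w (childList ks)) := by
  refine Reaches.seq (T₁ := 2) (T₂ := 34 * ks.length + 1) (Q₁ := fun σ' => σ'.nat 16 = 0 ∧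
    σ'.nat 17 = 0 ∧ σ'.nat 4 = ks.length ∧ σ'.nat 14 = lo ∧ σ'.nat 29 = 0 ∧ σ'.nat 30 = 1 ∧
    ListAt (σ'.natArr 0) lo ks ∧ σ'.realArr 1 = w)
    (reaches_block _ _ _ (by simp) (by simp [apply, *])) ?_ (by omega)
  rintro σ ⟨h16, h17, h4, h14, h29, h30, hks, hw⟩ -
  refine reaches_for ks.length 33 (fun i σ' => σ'.nat 16 = i ∧
    Gathered I w (childList (ks.take i)) σ') ⟨h16, ?_⟩ ?_ ?_ (by omega) ?_
  · exact ⟨by simp [childList, h17], listAt_nil, listAt_nil,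
      by rw [hw]; funext i; simp [childList, overwrite]⟩
  · rintro i hi σ' ⟨h1, -⟩ hf
    have := hf.nat 4 (by decide)
    simp only [Holds, h1, this, h4]
  · rintro i hi σ' ⟨h1, hG⟩ hf
    have f14 := (hf.nat 14 (by decide)).trans h14
    have f29 := (hf.nat 29 (by decide)).trans h29
    have f30 := (hf.nat 30 (by decide)).trans h30
    have fks := hks i hi
    rw [← hf.natArr 0 (by decide)] at fks
    refine Reaches.seq (T₁ := 4) (T₂ := 29) (Q₁ := fun τ => τ.nat 20 = 4 * ks[i] ∧
      τ.nat 16 = i ∧ τ.nat 29 = 0 ∧ τ.nat 30 = 1 ∧ Gathered I w (childList (ks.take i)) τ)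
      (reaches_block _ _ _ (by simp) ⟨?_, ?_, ?_, ?_, ?_, ?_, ?_, ?_⟩) ?_ (by omega)
    · simp [apply, *]; omega
    · simp [apply, *]
    · simp [apply, *]
    · simp [apply, *]
    · simpa [apply] using hG.len
    · simpa [apply] using hG.cells
    · simpa [apply] using hG.vals
    · simpa [apply] using hG.work
    rintro τ ⟨k20, k16, k29, k30, kG⟩ -
    refine Reaches.seq (T₂ := 22) (visitProg_spec I w _ τ _ kG k20 k29 k30) ?_ (by omega)
    rintro τ1 ⟨kG, k20, k29, k30⟩ hf1
    refine Reaches.seq (T₂ := 15) (visitProg_spec I w _ τ1 _ kG k20 k29 k30) ?_ (by omega)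
    rintro τ2 ⟨kG, k20, k29, k30⟩ hf2
    refine Reaches.seq (T₂ := 8) (visitProg_spec I w _ τ2 _ kG k20 k29 k30) ?_ (by omega)
    rintro τ3 ⟨kG, k20, k29, k30⟩ hf3
    refine Reaches.seq (T₂ := 1) (visitProg_spec I w _ τ3 _ kG k20 k29 k30) ?_ (by omega)
    rintro τ4 ⟨kG, k20, k29, k30⟩ hf4
    have k16 : τ4.nat 16 = i := by
      rw [hf4.nat 16 (by decide), hf3.nat 16 (by decide), hf2.nat 16 (by decide),
        hf1.nat 16 (by decide), k16]
    have e : childList (ks.take (i + 1)) = childList (ks.take i) ++ [4 * ks[i] + 1] ++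
        [4 * ks[i] + 1 + 1] ++ [4 * ks[i] + 1 + 1 + 1] ++ [4 * ks[i] + 1 + 1 + 1 + 1] := by
      rw [childList, List.take_succ_eq_append_getElem hi, List.flatMap_append]
      simp [childList]
    refine reaches_instr _ le_rfl ⟨by simp [apply, *], ?_⟩
    rw [e]
    exact ⟨by simpa [apply] using kG.len, by simpa [apply] using kG.cells,
      by simpa [apply] using kG.vals, by simpa [apply] using kG.work⟩
  · rintro σ' ⟨-, h⟩ -
    rwa [List.take_length] at h

theorem passProg_spec (I : SketchInput) (cs out : List ℕ) (flip : Bool) (σ : RAMState)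
    (p : ℝ) (h17 : σ.nat 17 = cs.length) (hcs : ListAt (σ.natArr 1) 0 cs)
    (hvs : ListAt (σ.realArr 2) 0 (cs.map I.cellVal)) (h30 : σ.nat 30 = 1)
    (hp : σ.real 1 = p) (h22 : σ.nat 22 = out.length) (hout : ListAt (σ.natArr 0) 0 out) :
    (passProg flip).Reaches I σ (7 * cs.length + 2) (fun σ' =>
      σ'.nat 22 = (out ++ cs.filter (fun c => decide (p < I.cellVal c) != flip)).length ∧
      ListAt (σ'.natArr 0) 0 (out ++ cs.filter (fun c => decide (p < I.cellVal c) != flip))) := by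
  refine Reaches.seq (T₁ := 1) (T₂ := 7 * cs.length + 1) (Q₁ := fun σ' => σ'.nat 16 = 0 ∧
    σ'.nat 17 = cs.length ∧ ListAt (σ'.natArr 1) 0 cs ∧
    ListAt (σ'.realArr 2) 0 (cs.map I.cellVal) ∧ σ'.nat 30 = 1 ∧ σ'.real 1 = p ∧
    σ'.nat 22 = out.length ∧ ListAt (σ'.natArr 0) 0 out)
    (reaches_instr _ le_rfl (by simp [apply, *])) ?_ (by omega)
  rintro σ ⟨h16, h17, hcs, hvs, h30, hp, h22, hout⟩ -
  refine reaches_for cs.length 6 (fun i σ' => σ'.nat 16 = i ∧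
    σ'.nat 22 = (out ++ (cs.take i).filter (fun c => decide (p < I.cellVal c) != flip)).length ∧
    ListAt (σ'.natArr 0) 0
      (out ++ (cs.take i).filter (fun c => decide (p < I.cellVal c) != flip)))
    ⟨h16, by simpa using h22, by simpa using hout⟩ ?_ ?_ (by omega) ?_
  · rintro i hi σ' ⟨h1, -⟩ hf
    have := hf.nat 17 (by cases flip <;> decide)
    simp only [Holds, h1, this, h17]
  · rintro i hi σ' ⟨h1, h2, h3⟩ hf
    have f30 := (hf.nat 30 (by cases flip <;> decide)).trans h30
    have fp := (hf.real 1 (by cases flip <;> decide)).trans hp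
    have fc := hcs i hi
    have fv := hvs i (by simpa using hi)
    rw [← hf.natArr 1 (by cases flip <;> decide), zero_add] at fc
    rw [← hf.realArr 2 (by cases flip <;> decide), zero_add, List.getElem_map] at fv
    rw [List.take_succ_eq_append_getElem hi, List.filter_append, ← List.append_assoc]
    set o := out ++ (cs.take i).filter (fun c => decide (p < I.cellVal c) != flip)
    refine Reaches.seq (T₁ := 1) (T₂ := 5) (Q₁ := fun τ => τ.real 2 = I.cellVal cs[i] ∧
      τ.real 1 = p ∧ τ.nat 16 = i ∧ τ.nat 22 = o.length ∧ ListAt (τ.natArr 0) 0 o ∧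
      τ.nat 30 = 1 ∧ τ.natArr 1 i = cs[i])
      (reaches_instr _ le_rfl (by simp [apply, *])) ?_ (by omega)
    rintro τ ⟨k2, k1, k16, k22, ko, k30, kc⟩ -
    refine Reaches.seq (T₁ := 4) (T₂ := 1) (Q₁ := fun υ => υ.nat 16 = i ∧ υ.nat 30 = 1 ∧
      υ.nat 22 = (o ++ [cs[i]].filter (fun c => decide (p < I.cellVal c) != flip)).length ∧
      ListAt (υ.natArr 0) 0
        (o ++ [cs[i]].filter (fun c => decide (p < I.cellVal c) != flip))) ?_ ?_ (by omega)
    · have kcat := ko.concat cs[i]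
      refine reaches_ite (T₁ := 3) (by omega) (fun hb => ?_) (fun hb => ?_) <;>
        simp only [Holds, k1, k2] at hb <;> cases flip
      · exact reaches_block _ _ _ (by simp) (by simp [apply, *])
      · exact reaches_instr _ (by omega) (by simp [apply, *])
      · exact reaches_instr _ (by omega) (by simp [apply, *])
      · exact reaches_block _ _ _ (by simp) (by simp [apply, *])
    · rintro υ ⟨u16, u30, u22, uo⟩ -
      exact reaches_instr _ le_rfl ⟨by simp [apply, *], by simpa [apply] using u22,
        by simpa [apply] using uo⟩
  · rintro σ' ⟨-, h⟩ -
    rwa [List.take_length] at h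

/-- The program state during the descent: the list `out` is complete, and the cells selected last
stand at position `lo`. -/
structure Descending (out : List ℕ) (st : List ℕ × (ℕ → ℝ)) (X : ℕ) (σ : RAMState) : Prop where
  n4 : σ.nat 4 = X
  len : st.1.length = X
  n13 : σ.nat 13 = out.length
  n29 : σ.nat 29 = 0
  n30 : σ.nat 30 = 1
  cells : ListAt (σ.natArr 0) 0 out
  last : ListAt (σ.natArr 0) (σ.nat 14) st.1
  work : σ.realArr 1 = st.2

/-- The program carries out one step of the descent, in time proportional to the number of selected
cells. -/
theorem levelProg_spec (I : SketchInput) (out : List ℕ) (st : List ℕ × (ℕ → ℝ)) (X : ℕ)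
    (hX : 0 < X) (σ : RAMState) (h : Descending out st X σ) :
    levelProg.Reaches I σ (20200 * X) (Descending (out ++ (levelStep I.cellVal st).1)
      (levelStep I.cellVal st) X) := by
  have hlen' : (levelStep I.cellVal st).1.length = st.1.length :=
    length_levelState I.cellVal st 1
  obtain ⟨h4, hX', h13, h29, h30, hc, hl, hw⟩ := h
  have hcl := length_childList st.1
  refine Reaches.seq (T₂ := 20160 * X) (gatherProg_spec I st.2 st.1 σ _ (h4.trans hX'.symm) rfl
    h29 h30 hl hw) ?_ (by omega)
  rintro σ1 hG hf
  have f29 := (hf.nat 29 (by decide)).trans h29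
  have f30 := (hf.nat 30 (by decide)).trans h30
  have f13 := (hf.nat 13 (by decide)).trans h13
  have f4 := (hf.nat 4 (by decide)).trans h4
  have fc := hc
  rw [← hf.natArr 0 (by decide)] at fc
  have fcells := hc
  rw [← hf.natArr 0 (by decide)] at fcells
  refine Reaches.seq (T₁ := 1) (T₂ := 20000 * X + 100 * X) (Q₁ := fun τ =>
    (τ.nat 24 = (childList st.1).length ∧
    τ.realArr 1 = overwrite st.2 ((childList st.1).map I.cellVal) ∧
    τ.nat 17 = (childList st.1).length ∧ τ.nat 13 = out.length ∧
    ListAt (τ.natArr 0) 0 out ∧ τ.nat 4 = X ∧ τ.nat 29 = 0 ∧ τ.nat 30 = 1) ∧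
    ListAt (τ.natArr 1) 0 (childList st.1) ∧
    ListAt (τ.realArr 2) 0 ((childList st.1).map I.cellVal))
    (reaches_instr _ le_rfl
      ⟨by simp [apply, hG.len, hG.work, f29, f30, f13, fcells, f4],
        by simpa [apply] using And.intro hG.cells hG.vals⟩) ?_ (by omega)
  rintro σ2 ⟨⟨g24, gw, g17, g13, go, g4, g29, g30⟩, gc, gv⟩ -
  refine Reaches.seq (T₂ := 100 * X) (pivotProg_spec I σ2 _ _ (by omega) g24 g29 g30 gw) ?_
    (by omega)
  rintro σ3 ⟨kp, kw⟩ hf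
  rw [← hf.nat 17 (by decide)] at g17
  rw [← hf.nat 13 (by decide)] at g13
  rw [← hf.nat 4 (by decide)] at g4
  rw [← hf.nat 29 (by decide)] at g29
  rw [← hf.nat 30 (by decide)] at g30
  rw [← hf.natArr 0 (by decide)] at go
  rw [← hf.natArr 1 (by decide)] at gc
  rw [← hf.realArr 2 (by decide)] at gv
  set pv := pivot 64 (childList st.1).length (overwrite st.2 ((childList st.1).map I.cellVal))
    with hpv
  refine Reaches.seq (T₁ := 1) (T₂ := 90 * X) (Q₁ := fun τ => (τ.nat 22 = out.length ∧
    τ.nat 17 = (childList st.1).length ∧ τ.nat 13 = out.length ∧ τ.nat 4 = X ∧ τ.nat 29 = 0 ∧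
    τ.nat 30 = 1 ∧ τ.real 1 = pv.1 ∧ τ.realArr 1 = pv.2) ∧ ListAt (τ.natArr 0) 0 out ∧
    ListAt (τ.natArr 1) 0 (childList st.1) ∧
    ListAt (τ.realArr 2) 0 ((childList st.1).map I.cellVal))
    (reaches_instr _ le_rfl ⟨by simp [apply, *], by
      simpa [apply] using And.intro go (And.intro gc gv)⟩) ?_ (by omega)
  rintro σ4 ⟨⟨a22, a17, a13, a4, a29, a30, ap, aw⟩, ao, ac, av⟩ -
  refine Reaches.seq (T₂ := 50 * X) (passProg_spec I _ out false σ4 pv.1 a17 ac av a30 ap a22 ao)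
    ?_ (by omega)
  rintro σ5 ⟨b22, bo⟩ hf
  rw [← hf.nat 17 (by decide)] at a17
  rw [← hf.nat 13 (by decide)] at a13
  rw [← hf.nat 4 (by decide)] at a4
  rw [← hf.nat 29 (by decide)] at a29
  rw [← hf.nat 30 (by decide)] at a30
  rw [← hf.real 1 (by decide)] at ap
  rw [← hf.natArr 1 (by decide)] at ac
  rw [← hf.realArr 2 (by decide)] at av
  rw [← hf.realArr 1 (by decide)] at aw
  refine Reaches.seq (T₂ := 10 * X) (passProg_spec I _ _ true σ5 pv.1 a17 ac av a30 ap b22 bo)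
    ?_ (by omega)
  rintro σ6 ⟨-, co⟩ hf
  rw [← hf.nat 13 (by decide)] at a13
  rw [← hf.nat 4 (by decide)] at a4
  rw [← hf.nat 29 (by decide)] at a29
  rw [← hf.nat 30 (by decide)] at a30
  rw [← hf.realArr 1 (by decide)] at aw
  have hstep : levelStep I.cellVal st = (((childList st.1).filter (fun c => decide (pv.1 <
      I.cellVal c) != false) ++ (childList st.1).filter (fun c => decide (pv.1 <
      I.cellVal c) != true)).take st.1.length, pv.2) := by
    simp only [levelStep, ← hpv]
    congr 4 <;> funext c <;> by_cases hcp : pv.1 < I.cellVal c <;> simp [hcp, -not_lt]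
  rw [List.append_assoc, listAt_append, zero_add] at co
  have cs := co.2.take st.1.length
  rw [hstep] at hlen' ⊢
  refine reaches_block _ _ _ (by simp; omega) ⟨?_, hlen'.trans hX', ?_, ?_, ?_, ?_, ?_, ?_⟩
  · simp [apply, *]
  · rw [List.length_append, hlen']
    simp [apply, *]
  · simp [apply, *]
  · simp [apply, *]
  · rw [listAt_append, zero_add]
    simpa [apply] using And.intro co.1 cs
  · simpa [apply, a13, a29] using cs
  · simpa [apply] using aw

/-- The depth at which the descent starts: the first one with at least `T` cells, but at most the
number `i` of levels. -/
def startDepth (T : ℕ) : ℕ → ℕ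
  | 0 => 0
  | i + 1 => if 4 ^ startDepth T i < T then startDepth T i + 1 else startDepth T i

theorem numCells_succ (d : ℕ) : numCells (d + 1) = numCells d + 4 ^ (d + 1) := by
  simp [numCells, Finset.sum_range_succ]

theorem pow_le_numCells (d : ℕ) : 4 ^ d ≤ numCells d := by
  cases d with
  | zero => simp [numCells]
  | succ d => rw [numCells_succ]; omega

theorem startDepth_le (T : ℕ) : ∀ i, startDepth T i ≤ i
  | 0 => le_rfl
  | i + 1 => by
    have := startDepth_le T i
    rw [startDepth]; split_ifs <;> omega

theorem startDepth_lt (T : ℕ) (hT : 0 < T) : ∀ i, 4 ^ startDepth T i < 4 * T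
  | 0 => by simp [startDepth]; omega
  | i + 1 => by
    have := startDepth_lt T hT i
    rw [startDepth]; split_ifs <;> [(rw [pow_succ]; omega); exact this]

theorem le_startDepth (T : ℕ) : ∀ i, startDepth T i = i ∨ T ≤ 4 ^ startDepth T i
  | 0 => Or.inl rfl
  | i + 1 => by
    rw [startDepth]
    split_ifs with h
    · rcases le_startDepth T i with h' | h'
      · left; rw [h']
      · omega
    · right; omega

/-- Sets `nat 4`, `nat 5`, `nat 11` to the numbers of cells at, respectively down to, the depth
where the descent starts, and to this depth, and `nat 12` to the number of steps of the descent. -/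
def prepProg (K : ℕ) : RAMProg :=
  block (natConst 29 0) [natConst 30 1, natAdd 6 1 2, natConst 7 K, natConst 8 0, natConst 9 0] ;;
  loop (natLt 9 7) (block (natAdd 8 8 6) [natAdd 9 9 30]) ;;
  block (natConst 4 1) [natConst 5 1, natConst 9 0, natConst 11 0] ;;
  loop (natLt 9 0)
    (ite (natLt 4 8)
      (block (natAdd 4 4 4) [natAdd 4 4 4, natAdd 5 5 4, natAdd 11 11 30]) skipProg ;;
     instr (natAdd 9 9 30)) ;;
  instr (natSub 12 0 11)

/-- Puts all cells down to the start of the descent on the list. -/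
def fillProg : RAMProg :=
  instr (natConst 9 0) ;;
  loop (natLt 9 5) (block (natStore 0 9 9) [natAdd 9 9 30]) ;;
  block (natAdd 13 5 29) [natSub 14 5 4]

/-- The program that selects the cells in which the image is approximated. -/
def descentProg (K : ℕ) : RAMProg :=
  prepProg K ;;
  fillProg ;;
  instr (natConst 15 0) ;;
  loop (natLt 15 12) (levelProg ;; instr (natAdd 15 15 30))

/-- The state before the descent from depth `d`: all cells at this depth are selected. -/
def startState (d : ℕ) : List ℕ × (ℕ → ℝ) :=
  ((List.range (4 ^ d)).map (fun i => numCells d - 4 ^ d + i), fun _ => 0)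

/-- The list of all cells that are selected in a descent of `j` steps from depth `d`. -/
noncomputable def descentList (I : SketchInput) (d j : ℕ) : List ℕ :=
  outList I.cellVal (startState d) (List.range (numCells d)) j

theorem length_descentList (I : SketchInput) (d : ℕ) :
    ∀ j, (descentList I d j).length = numCells d + j * 4 ^ d
  | 0 => by simp [descentList, outList]
  | j + 1 => by
    have := length_descentList I d j
    rw [descentList] at this ⊢
    rw [outList, List.length_append, this, length_levelState]
    simp [startState]; ring

theorem prepProg_spec (I : SketchInput) (K l k s m : ℕ) :
    (prepProg K).Reaches I (RAMState.init l k s m) (3 * K + 7 * l + 20) (fun σ =>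
      σ.nat 29 = 0 ∧ σ.nat 30 = 1 ∧ σ.nat 4 = 4 ^ startDepth (K * (k + s)) l ∧
      σ.nat 5 = numCells (startDepth (K * (k + s)) l) ∧
      σ.nat 12 = l - startDepth (K * (k + s)) l) := by
  refine Reaches.seq (T₁ := 6) (T₂ := 3 * K + 7 * l + 10) (Q₁ := fun σ => σ.nat 29 = 0 ∧
    σ.nat 30 = 1 ∧ σ.nat 6 = k + s ∧ σ.nat 7 = K ∧ σ.nat 8 = 0 ∧ σ.nat 9 = 0 ∧ σ.nat 0 = l)
    (reaches_block _ _ _ (by simp) (by simp [apply, RAMState.init])) ?_ (by omega)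
  rintro σ ⟨h29, h30, h6, h7, h8, h9, h0⟩ -
  refine Reaches.seq (T₁ := 3 * K + 1) (T₂ := 7 * l + 8) (Q₁ := fun σ => σ.nat 8 = K * (k + s) ∧
    σ.nat 29 = 0 ∧ σ.nat 30 = 1 ∧ σ.nat 0 = l) ?_ ?_ (by omega)
  · refine reaches_for K 2 (fun i σ => σ.nat 9 = i ∧ σ.nat 8 = i * (k + s)) ⟨h9, by simpa using h8⟩
      ?_ ?_ (by omega) ?_
    · rintro i hi σ' ⟨h1, -⟩ hf
      have := (hf.nat 7 (by decide)).trans h7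
      simp only [Holds, h1, this]
    · rintro i hi σ' ⟨h1, h2⟩ hf
      have f6 := (hf.nat 6 (by decide)).trans h6
      have f30 := (hf.nat 30 (by decide)).trans h30
      exact reaches_block _ _ _ (by simp) (by simp [apply, *]; ring)
    · rintro σ' ⟨-, h2⟩ hf
      exact ⟨h2, (hf.nat 29 (by decide)).trans h29, (hf.nat 30 (by decide)).trans h30,
        (hf.nat 0 (by decide)).trans h0⟩
  rintro σ ⟨h8, h29, h30, h0⟩ -
  refine Reaches.seq (T₁ := 4) (T₂ := 7 * l + 3) (Q₁ := fun σ => σ.nat 4 = 1 ∧ σ.nat 5 = 1 ∧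
    σ.nat 9 = 0 ∧ σ.nat 11 = 0 ∧ σ.nat 8 = K * (k + s) ∧ σ.nat 29 = 0 ∧ σ.nat 30 = 1 ∧
    σ.nat 0 = l) (reaches_block _ _ _ (by simp) (by simp [apply, *])) ?_ (by omega)
  rintro σ ⟨h4, h5, h9, h11, h8, h29, h30, h0⟩ -
  refine Reaches.seq (T₁ := 7 * l + 1) (T₂ := 1) (Q₁ := fun σ =>
      σ.nat 29 = 0 ∧ σ.nat 30 = 1 ∧ σ.nat 4 = 4 ^ startDepth (K * (k + s)) l ∧
      σ.nat 5 = numCells (startDepth (K * (k + s)) l) ∧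
      σ.nat 11 = startDepth (K * (k + s)) l ∧ σ.nat 0 = l) ?_ ?_ (by omega)
  · refine reaches_for l 6 (fun i σ => σ.nat 9 = i ∧ σ.nat 4 = 4 ^ startDepth (K * (k + s)) i ∧
      σ.nat 5 = numCells (startDepth (K * (k + s)) i) ∧ σ.nat 11 = startDepth (K * (k + s)) i)
      ⟨h9, by simp [startDepth, h4], by simp [startDepth, numCells, h5],
        by simp [startDepth, h11]⟩ ?_ ?_ (by omega) ?_
    · rintro i hi σ' ⟨h1, -⟩ hf
      have := (hf.nat 0 (by decide)).trans h0
      simp only [Holds, h1, this]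
    · rintro i hi σ' ⟨h1, k4, k5, k11⟩ hf
      have f8 := (hf.nat 8 (by decide)).trans h8
      have f30 := (hf.nat 30 (by decide)).trans h30
      refine Reaches.seq (T₁ := 5) (T₂ := 1) (Q₁ := fun σ => σ.nat 9 = i ∧ σ.nat 30 = 1 ∧
        σ.nat 4 = 4 ^ startDepth (K * (k + s)) (i + 1) ∧
        σ.nat 5 = numCells (startDepth (K * (k + s)) (i + 1)) ∧
        σ.nat 11 = startDepth (K * (k + s)) (i + 1)) ?_ ?_ (by omega)
      · rw [startDepth]
        refine reaches_ite (T₁ := 4) (by omega) (fun hb => ?_) (fun hb => ?_)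
        · simp only [Holds, k4, f8] at hb
          refine reaches_block _ _ _ (by simp) ?_
          rw [if_pos hb, numCells_succ, pow_succ]
          simp [apply, *]
          omega
        · simp only [Holds, k4, f8] at hb
          refine reaches_instr _ (by omega) ?_
          rw [if_neg hb]
          simp [apply, *]
      · rintro υ ⟨u9, u30, u4, u5, u11⟩ -
        exact reaches_instr _ le_rfl (by simp [apply, *])
    · rintro σ' ⟨-, k4, k5, k11⟩ hf
      exact ⟨(hf.nat 29 (by decide)).trans h29, (hf.nat 30 (by decide)).trans h30, k4, k5, k11,
        (hf.nat 0 (by decide)).trans h0⟩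
  rintro σ ⟨h29, h30, h4, h5, h11, h0⟩ -
  exact reaches_instr _ le_rfl (by simp [apply, *])

theorem fillProg_spec (I : SketchInput) (σ : RAMState) (d : ℕ) (h29 : σ.nat 29 = 0)
    (h30 : σ.nat 30 = 1) (h4 : σ.nat 4 = 4 ^ d) (h5 : σ.nat 5 = numCells d)
    (hw : σ.realArr 1 = fun _ => 0) :
    fillProg.Reaches I σ (3 * numCells d + 4)
      (Descending (List.range (numCells d)) (startState d) (4 ^ d)) := by
  refine Reaches.seq (T₁ := 1) (T₂ := 3 * numCells d + 3) (Q₁ := fun σ => σ.nat 29 = 0 ∧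
    σ.nat 30 = 1 ∧ σ.nat 4 = 4 ^ d ∧ σ.nat 5 = numCells d ∧ σ.realArr 1 = (fun _ => 0) ∧
    σ.nat 9 = 0) (reaches_instr _ le_rfl (by simp [apply, *])) ?_ (by omega)
  rintro σ ⟨h29, h30, h4, h5, hw, h9⟩ -
  refine Reaches.seq (T₁ := 3 * numCells d + 1) (T₂ := 2) (Q₁ := fun σ => σ.nat 29 = 0 ∧
    σ.nat 30 = 1 ∧ σ.nat 4 = 4 ^ d ∧ σ.nat 5 = numCells d ∧ σ.realArr 1 = (fun _ => 0) ∧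
    ListAt (σ.natArr 0) 0 (List.range (numCells d))) ?_ ?_ (by omega)
  · refine reaches_for (numCells d) 2 (fun i σ => σ.nat 9 = i ∧
      ListAt (σ.natArr 0) 0 (List.range i)) ⟨h9, listAt_nil⟩ ?_ ?_ (by omega) ?_
    · rintro i hi σ' ⟨h1, -⟩ hf
      have := (hf.nat 5 (by decide)).trans h5
      simp only [Holds, h1, this]
    · rintro i hi σ' ⟨h1, h2⟩ hf
      have f30 := (hf.nat 30 (by decide)).trans h30
      refine reaches_block _ _ _ (by simp) ⟨by simp [apply, *], ?_⟩
      have := h2.concat i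
      rw [List.length_range, ← List.range_succ] at this
      simp [apply, *]
    · rintro σ' ⟨-, h2⟩ hf
      exact ⟨(hf.nat 29 (by decide)).trans h29, (hf.nat 30 (by decide)).trans h30,
        (hf.nat 4 (by decide)).trans h4, (hf.nat 5 (by decide)).trans h5,
        (hf.realArr 1 (by decide)).trans hw, h2⟩
  rintro σ ⟨h29, h30, h4, h5, hw, hl⟩ -
  refine reaches_block _ _ _ (by simp) ⟨?_, by simp [startState], ?_, ?_, ?_, ?_, ?_, ?_⟩
  · simp [apply, *]
  · simp [apply, *]
  · simp [apply, *]
  · simp [apply, *]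
  · simpa [apply] using hl
  · intro i hi
    have hi' : i < 4 ^ d := by simpa [startState] using hi
    have hle := pow_le_numCells d
    have := hl (numCells d - 4 ^ d + i) (by simp; omega)
    simpa [apply, h4, h5, startState] using this
  · simp [apply, *, startState]

theorem Descending.congr {out : List ℕ} {st : List ℕ × (ℕ → ℝ)} {X : ℕ} {σ σ' : RAMState}
    (h : Descending out st X σ)
    (hn : ∀ x, x = 4 ∨ x = 13 ∨ x = 14 ∨ x = 29 ∨ x = 30 → σ'.nat x = σ.nat x)
    (ha : σ'.natArr 0 = σ.natArr 0) (hw : σ'.realArr 1 = σ.realArr 1) :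
    Descending out st X σ' := by
  refine ⟨(hn 4 (by simp)).trans h.n4, h.len, (hn 13 (by simp)).trans h.n13,
    (hn 29 (by simp)).trans h.n29, (hn 30 (by simp)).trans h.n30, ?_, ?_, hw.trans h.work⟩
  · rw [ha]; exact h.cells
  · rw [ha, hn 14 (by simp)]; exact h.last

theorem descentProg_spec (I : SketchInput) (K l k s m : ℕ) (d : ℕ)
    (hd : d = startDepth (K * (k + s)) l) :
    (descentProg K).Reaches I (RAMState.init l k s m)
      (20202 * ((l - d) * 4 ^ d) + 3 * numCells d + 7 * l + 3 * K + 30)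
      (fun σ => Descending (descentList I d (l - d))
        (levelState I.cellVal (startState d) (l - d)) (4 ^ d) σ ∧
        (∀ a, a = 2 ∨ a = 3 ∨ a = 4 ∨ a = 5 → σ.natArr a = fun _ => 0) ∧
        (∀ a, a = 0 ∨ a = 3 → σ.realArr a = fun _ => 0)) := by
  refine Reaches.weaken (Q₁ := Descending (descentList I d (l - d))
        (levelState I.cellVal (startState d) (l - d)) (4 ^ d)) ?_ le_rfl fun σ h hf =>
    ⟨h, ?_, ?_⟩
  rotate_left
  · rintro a (rfl | rfl | rfl | rfl)
    · exact hf.natArr 2 rfl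
    · exact hf.natArr 3 rfl
    · exact hf.natArr 4 rfl
    · exact hf.natArr 5 rfl
  · rintro a (rfl | rfl)
    · exact hf.realArr 0 rfl
    · exact hf.realArr 3 rfl
  refine Reaches.seq (T₂ := 20202 * ((l - d) * 4 ^ d) + 3 * numCells d + 10)
    (prepProg_spec I K l k s m) ?_ (by omega)
  rw [← hd]
  rintro σ ⟨h29, h30, h4, h5, h12⟩ hf
  refine Reaches.seq (T₂ := 20202 * ((l - d) * 4 ^ d) + 2) (fillProg_spec I σ d h29 h30 h4 h5
    (hf.realArr 1 rfl)) ?_ (by omega)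
  rintro σ' hD hf
  have f12 := (hf.nat 12 (by decide)).trans h12
  refine Reaches.seq (T₁ := 1) (T₂ := 20202 * ((l - d) * 4 ^ d) + 1) (Q₁ := fun τ =>
    τ.nat 15 = 0 ∧ τ.nat 12 = l - d ∧ Descending (List.range (numCells d)) (startState d) (4 ^ d) τ)
    (reaches_instr _ le_rfl ⟨by simp [apply], by simpa [apply] using f12,
      hD.congr (by simp [apply]) rfl rfl⟩) ?_ (by omega)
  rintro τ ⟨k15, k12, kD⟩ -
  refine reaches_for (l - d) (20200 * 4 ^ d + 1) (fun i σ => σ.nat 15 = i ∧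
    Descending (descentList I d i) (levelState I.cellVal (startState d) i) (4 ^ d) σ)
    ⟨k15, kD⟩ ?_ ?_ ?_ (fun σ h _ => h.2)
  · rintro i hi σ' ⟨h1, -⟩ hf
    have := (hf.nat 12 (by decide)).trans k12
    simp only [Holds, h1, this]
  · rintro i hi υ ⟨h1, h2⟩ hf
    refine Reaches.seq (T₂ := 1) (levelProg_spec I _ _ _ (by positivity) υ h2) ?_ le_rfl
    rintro υ' hυ hf'
    have f15 := (hf'.nat 15 (by decide)).trans h1
    exact reaches_instr _ le_rfl ⟨by simp [apply, f15, hυ.n30],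
      Descending.congr hυ (by simp [apply]) rfl rfl⟩
  · have : 1 ≤ 4 ^ d := Nat.one_le_pow _ _ (by norm_num)
    have h2 : (l - d) * (20200 * 4 ^ d + 1 + 1) ≤ (l - d) * (20202 * 4 ^ d) :=
      Nat.mul_le_mul_left _ (by omega)
    have h3 : (l - d) * (20202 * 4 ^ d) = 20202 * ((l - d) * 4 ^ d) := by ring
    omega

/-! ### Recovery of the values by peeling -/

/-- The slots in `P` whose row is `r`.  A slot is a pair of an item and the number of one of its
rows. -/
def inRow (row : ℕ → ℕ → ℕ) (P : Finset (ℕ × ℕ)) (r : ℕ) : Finset (ℕ × ℕ) :=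
  P.filter (fun x => row x.1 x.2 = r)

/-- The slots of all items in `U`. -/
def slots (U : Finset ℕ) : Finset (ℕ × ℕ) := U ×ˢ Finset.range 8

/-- The slots of item `i` that share their row with no other slot of an item in `U`. -/
def isoSlots (row : ℕ → ℕ → ℕ) (U : Finset ℕ) (i : ℕ) : Finset ℕ :=
  (Finset.range 8).filter (fun j => (inRow row (slots U) (row i j)).card = 1)

/-- The measurement in row `r`, minus the values in the slots in `P`. -/
noncomputable def rowResidual (row : ℕ → ℕ → ℕ) (b : ℕ → ℝ) (P : Finset (ℕ × ℕ)) (val : ℕ → ℝ)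
    (r : ℕ) : ℝ := b r - ∑ x ∈ inRow row P r, val x.1

/-- The mean of the residuals in the isolated rows of item `i`, when the items in `U` have not been
evaluated. -/
noncomputable def peelValue (row : ℕ → ℕ → ℕ) (b : ℕ → ℝ) (q : ℕ) (U : Finset ℕ) (val : ℕ → ℝ)
    (i : ℕ) : ℝ :=
  (∑ j ∈ isoSlots row U i, rowResidual row b (slots (Finset.range q) \ slots U) val (row i j)) /
    (isoSlots row U i).card

/-- The values `val` of the items `0, …, q - 1` outside `U` come from the evaluation of items,
one after the other, that have at least five isolated rows. -/
inductive Peel (row : ℕ → ℕ → ℕ) (b : ℕ → ℝ) (q : ℕ) : Finset ℕ → (ℕ → ℝ) → Prop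
  | start (val : ℕ → ℝ) : Peel row b q (Finset.range q) val
  | step {U : Finset ℕ} {val : ℕ → ℝ} {i : ℕ} : Peel row b q U val → i ∈ U →
      5 ≤ (isoSlots row U i).card →
      Peel row b q (U.erase i) (Function.update val i (peelValue row b q U val i))

theorem Peel.subset {row : ℕ → ℕ → ℕ} {b : ℕ → ℝ} {q : ℕ} {U : Finset ℕ} {val : ℕ → ℝ}
    (h : Peel row b q U val) : U ⊆ Finset.range q := by
  induction h with
  | start => exact subset_rfl
  | step _ _ _ ih => exact (Finset.erase_subset _ _).trans ih

/-- Initializes the tables: for each row, the number of slots (natural-number array `2`), the sum of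
their items (natural-number array `3`) and the residual (real array `3`).  All items are put on the
stack (natural-number array `4`, with height `nat 34`). -/
def tableProg : RAMProg :=
  block (natConst 9 0) [natConst 37 9] ;;
  loop (natLt 9 13)
    (block (natLoad 19 0 9) [natStore 4 9 9, natConst 16 1] ;;
     loop (natLt 16 37)
      (block (getColRow 21 19 16) [natLoad 20 2 21, natAdd 20 20 30, natStore 2 21 20,
        natLoad 20 3 21, natAdd 20 20 9, natStore 3 21 20, getMeas 0 21, realStore 3 21 0,
        natAdd 16 16 30]) ;;
     instr (natAdd 9 9 30)) ;;
  block (natAdd 34 13 29) [natConst 38 4, natConst 40 2]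

/-- Counts the isolated rows of the item `nat 9` and adds up their residuals. -/
def scanProg : RAMProg :=
  block (natLoad 19 0 9) [natConst 16 1, natConst 17 0, realOfNat 5 29] ;;
  loop (natLt 16 37)
    (block (getColRow 21 19 16) [natLoad 20 2 21] ;;
     ite (natLt 20 40) (block (realLoad 2 3 21) [realAdd 5 5 2, natAdd 17 17 30]) skipProg ;;
     instr (natAdd 16 16 30))

/-- Takes the slot `nat 16` of the item `nat 9` out of the tables.  Then `nat 20` is the number of
slots left in its row, and `nat 22` is the sum of their items, which identifies the item if only one
is left. -/
def removeProg : RAMProg :=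
  block (getColRow 21 19 16) [natLoad 20 2 21, natSub 20 20 30, natStore 2 21 20,
    natLoad 22 3 21, natSub 22 22 9, natStore 3 21 22, realLoad 2 3 21, realSub 2 2 7,
    realStore 3 21 2]

/-- Evaluates the item `nat 9`, takes it out of the tables, and pushes the items onto the stack
that become alone in a row. -/
def evalProg : RAMProg :=
  block (realOfNat 6 17) [realDiv 7 5 6, realStore 0 9 7, natStore 5 9 30, natConst 16 1] ;;
  loop (natLt 16 37)
    (removeProg ;;
     ite (natLt 20 40)
       (ite (natLt 29 20) (block (natStore 4 34 22) [natAdd 34 34 30]) skipProg) skipProg ;;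
     instr (natAdd 16 16 30))

/-- Evaluates items from the stack until it is empty.  The natural-number array `5` marks the items
that have been evaluated. -/
def peelProg : RAMProg :=
  loop (natLt 29 34)
    (block (natSub 34 34 30) [natLoad 9 4 34, natLoad 20 5 9] ;;
     ite (natLt 20 30) (scanProg ;; ite (natLt 38 17) evalProg skipProg) skipProg)

/-- The tables describe the slots in `P`, and the residuals are taken for the values of the other
slots. -/
structure Tables (row : ℕ → ℕ → ℕ) (b : ℕ → ℝ) (q : ℕ) (P : Finset (ℕ × ℕ)) (val : ℕ → ℝ)
    (σ : RAMState) : Prop where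
  cnt : ∀ r, σ.natArr 2 r = (inRow row P r).card
  sum : ∀ r, σ.natArr 3 r = ∑ x ∈ inRow row P r, x.1
  res : ∀ i < q, ∀ j < 8, σ.realArr 3 (row i j) =
    rowResidual row b (slots (Finset.range q) \ P) val (row i j)

/-- The registers and arrays that stay the same during the peeling. -/
structure PeelEnv (cell : ℕ → ℕ) (q : ℕ) (σ : RAMState) : Prop where
  n13 : σ.nat 13 = q
  n29 : σ.nat 29 = 0
  n30 : σ.nat 30 = 1
  n37 : σ.nat 37 = 9
  n38 : σ.nat 38 = 4
  n40 : σ.nat 40 = 2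
  cells : ∀ i < q, σ.natArr 0 i = cell i

theorem PeelEnv.congr {cell : ℕ → ℕ} {q : ℕ} {σ σ' : RAMState} (h : PeelEnv cell q σ)
    (hn : ∀ x, x = 13 ∨ x = 29 ∨ x = 30 ∨ x = 37 ∨ x = 38 ∨ x = 40 → σ'.nat x = σ.nat x)
    (ha : σ'.natArr 0 = σ.natArr 0) : PeelEnv cell q σ' := by
  refine ⟨(hn 13 (by simp)).trans h.n13, (hn 29 (by simp)).trans h.n29,
    (hn 30 (by simp)).trans h.n30, (hn 37 (by simp)).trans h.n37, (hn 38 (by simp)).trans h.n38,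
    (hn 40 (by simp)).trans h.n40, ?_⟩
  rw [ha]; exact h.cells

section Spec

variable (I : SketchInput) (cell : ℕ → ℕ)

/-- The rows of the items: all rows of the column of the item's cell except the first. -/
def itemRow (i j : ℕ) : ℕ := I.colRow (cell i) (j + 1)

variable {I cell}

theorem inRow_insert (row : ℕ → ℕ → ℕ) (P : Finset (ℕ × ℕ)) (x : ℕ × ℕ) (r : ℕ) :
    inRow row (insert x P) r = if row x.1 x.2 = r then insert x (inRow row P r)
      else inRow row P r := by
  unfold inRow; rw [Finset.filter_insert]

theorem tableProg_spec (σ : RAMState) (q : ℕ) (h13 : σ.nat 13 = q) (h29 : σ.nat 29 = 0)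
    (h30 : σ.nat 30 = 1) (hc : ∀ i < q, σ.natArr 0 i = cell i)
    (h2 : σ.natArr 2 = fun _ => 0) (h3 : σ.natArr 3 = fun _ => 0) :
    tableProg.Reaches I σ (94 * q + 6) (fun σ' => PeelEnv cell q σ' ∧
      Tables (itemRow I cell) I.meas q (slots (Finset.range q)) (fun _ => 0) σ' ∧
      σ'.nat 34 = q ∧ ∀ i < q, σ'.natArr 4 i = i) := by
  have hr : ∀ i j, I.colRow (cell i) (j + 1) = itemRow I cell i j := fun _ _ => rfl
  generalize itemRow I cell = row at *
  -- the tables when the slots in `P` have been entered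
  let Tab : Finset (ℕ × ℕ) → RAMState → Prop := fun P σ =>
    (∀ r, σ.natArr 2 r = (inRow row P r).card) ∧
    (∀ r, σ.natArr 3 r = ∑ x ∈ inRow row P r, x.1) ∧
    ∀ x ∈ P, σ.realArr 3 (row x.1 x.2) = I.meas (row x.1 x.2)
  refine Reaches.seq (T₁ := 2) (T₂ := 94 * q + 4) (Q₁ := fun σ => σ.nat 13 = q ∧
    σ.nat 29 = 0 ∧ σ.nat 30 = 1 ∧ σ.natArr 2 = (fun _ => 0) ∧
    σ.natArr 3 = (fun _ => 0) ∧ σ.nat 9 = 0 ∧ σ.nat 37 = 9 ∧ ∀ i < q, σ.natArr 0 i = cell i)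
    (reaches_block _ _ _ (by simp) ?_) ?_ (by omega)
  · refine ⟨?_, ?_, ?_, ?_, ?_, ?_, ?_, ?_⟩ <;> simp [apply, *]
    exact hc
  rintro σ ⟨h13, h29, h30, h2, h3, h9, h37, hc⟩ -
  refine Reaches.seq (T₁ := 94 * q + 1) (T₂ := 3) (Q₁ := fun σ => (∀ i < q, σ.natArr 4 i = i) ∧
    Tab (slots (Finset.range q)) σ ∧ σ.nat 13 = q ∧
    σ.nat 29 = 0 ∧ σ.nat 30 = 1 ∧ σ.nat 37 = 9 ∧ ∀ i < q, σ.natArr 0 i = cell i) ?_ ?_ (by omega)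
  · refine reaches_for q 93 (fun n σ => σ.nat 9 = n ∧ (∀ i < n, σ.natArr 4 i = i) ∧
      Tab (slots (Finset.range n)) σ) ?_ ?_ ?_ (by omega) ?_
    · refine ⟨h9, by simp, ?_, ?_, ?_⟩ <;> simp [slots, inRow, h2, h3]
    · rintro i hi σ' ⟨h1, -⟩ hf
      have := (hf.nat 13 (by decide)).trans h13
      simp only [Holds, h1, this]
    · rintro n hn τ ⟨k9, kst, kT⟩ hf
      have f30 := (hf.nat 30 (by decide)).trans h30
      have f37 := (hf.nat 37 (by decide)).trans h37
      have fc := hc n hn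
      rw [← hf.natArr 0 (by decide)] at fc
      refine Reaches.seq (T₁ := 3) (T₂ := 90) (Q₁ := fun υ => (υ.nat 9 = n ∧ υ.nat 30 = 1 ∧
        υ.nat 37 = 9 ∧ υ.nat 19 = cell n ∧ υ.nat 16 = 1) ∧ (∀ i < n + 1, υ.natArr 4 i = i) ∧
        Tab (slots (Finset.range n)) υ) (reaches_block _ _ _ (by simp) ⟨?_, ?_, ?_⟩) ?_ (by omega)
      · simp [apply, *]
      · intro i hi
        rcases Nat.lt_succ_iff_lt_or_eq.1 hi with h | h
        · simp [apply, k9, Function.update_of_ne h.ne, kst i h]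
        · subst h; simp [apply, k9]
      · simpa [apply, Tab] using kT
      rintro υ ⟨⟨u9, u30, u37, u19, u16⟩, ust, uT⟩ -
      refine Reaches.seq (T₁ := 89) (T₂ := 1) (Q₁ := fun υ => υ.nat 9 = n ∧ υ.nat 30 = 1 ∧
        (∀ i < n + 1, υ.natArr 4 i = i) ∧ Tab (slots (Finset.range (n + 1))) υ) ?_ ?_ (by omega)
      · refine reaches_for 8 10 (fun j υ => υ.nat 16 = j + 1 ∧
          Tab (slots (Finset.range n) ∪ {n} ×ˢ Finset.range j) υ) ⟨u16, by simpa using uT⟩ ?_ ?_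
          (by omega) ?_
        · rintro j hj ρ ⟨r16, -⟩ hf
          have := (hf.nat 37 (by decide)).trans u37
          simp only [Holds, r16, this]; omega
        · rintro j hj ρ ⟨r16, r2, r3, rr⟩ hf
          have r9 := (hf.nat 9 (by decide)).trans u9
          have r19 := (hf.nat 19 (by decide)).trans u19
          have r30 := (hf.nat 30 (by decide)).trans u30
          have hP : slots (Finset.range n) ∪ {n} ×ˢ Finset.range (j + 1) =
              insert (n, j) (slots (Finset.range n) ∪ {n} ×ˢ Finset.range j) := by
            ext ⟨x, y⟩; simp only [slots, Finset.mem_union, Finset.mem_product, Finset.mem_range,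
              Finset.mem_singleton, Finset.mem_insert, Prod.mk.injEq]; omega
          have hnot : ∀ r, (n, j) ∉ inRow row
              (slots (Finset.range n) ∪ {n} ×ˢ Finset.range j) r := by
            intro r h
            simp [inRow, slots] at h
          rw [hP]
          clear hP
          generalize slots (Finset.range n) ∪ {n} ×ˢ Finset.range j = P at hnot r2 r3 rr ⊢
          refine reaches_block _ _ _ (by simp) ⟨by simp [apply, *], ?_, ?_, ?_⟩
          · intro r
            rw [inRow_insert]
            by_cases h : r = row n j
            · subst h
              simp [apply, *]
            · simp [apply, *, Ne.symm h]
          · intro r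
            rw [inRow_insert]
            by_cases h : r = row n j
            · subst h
              simp [apply, *, Finset.sum_insert (hnot _), add_comm]
            · simp [apply, *, Ne.symm h]
          · intro x hx
            by_cases h : row x.1 x.2 = row n j
            · simp [apply, *]
            · have hx' := Finset.mem_of_mem_insert_of_ne hx (by rintro rfl; exact h rfl)
              have := rr x hx'
              simp [apply, *]
        · rintro ρ ⟨-, rT⟩ hf
          refine ⟨(hf.nat 9 (by decide)).trans u9, (hf.nat 30 (by decide)).trans u30, ?_, ?_⟩
          · rw [hf.natArr 4 (by decide)]; exact ust
          · convert rT using 1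
            ext ⟨x, y⟩; simp only [slots, Finset.mem_union, Finset.mem_product, Finset.mem_range,
              Finset.mem_singleton]; omega
      · rintro ρ ⟨r9, r30, rs, rT⟩ -
        refine reaches_instr _ le_rfl ⟨by simp [apply, *], ?_, ?_⟩
        · simpa [apply] using rs
        · simpa [apply, Tab] using rT
    · rintro τ ⟨-, kst, kT⟩ hf
      refine ⟨kst, kT, (hf.nat 13 (by decide)).trans h13, (hf.nat 29 (by decide)).trans h29,
        (hf.nat 30 (by decide)).trans h30, (hf.nat 37 (by decide)).trans h37, ?_⟩
      rw [hf.natArr 0 (by decide)]; exact hc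
  · rintro σ ⟨hst, ⟨t2, t3, tr⟩, h13, h29, h30, h37, hc⟩ -
    refine reaches_block _ _ _ (by simp) ⟨⟨?_, ?_, ?_, ?_, ?_, ?_, ?_⟩, ⟨?_, ?_, ?_⟩, ?_, ?_⟩
    case refine_8 => simpa [apply] using t2
    case refine_9 => simpa [apply] using t3
    case refine_10 =>
      intro i hi j hj
      have := tr (i, j) (by simp [slots, hi, hj])
      simpa [apply, rowResidual, inRow] using this
    all_goals simp [apply, *]
    · exact hc
    · exact hst

theorem scanProg_spec (σ : RAMState) (q : ℕ) (hE : PeelEnv cell q σ) (U : Finset ℕ)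
    (val : ℕ → ℝ) (hT : Tables (itemRow I cell) I.meas q (slots U) val σ) (i : ℕ) (hi : i < q)
    (hiU : i ∈ U) (h9 : σ.nat 9 = i) :
    scanProg.Reaches I σ 77 (fun σ' => σ'.nat 17 = (isoSlots (itemRow I cell) U i).card ∧
      σ'.real 5 = ∑ j ∈ isoSlots (itemRow I cell) U i,
        rowResidual (itemRow I cell) I.meas (slots (Finset.range q) \ slots U) val
          (itemRow I cell i j) ∧ σ'.nat 19 = cell i) := by
  have hr : ∀ i j, I.colRow (cell i) (j + 1) = itemRow I cell i j := fun _ _ => rfl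
  generalize itemRow I cell = row at *
  obtain ⟨h13, h29, h30, h37, h38, h40, hc⟩ := hE
  have hci := hc i hi
  refine Reaches.seq (T₁ := 4) (T₂ := 73) (Q₁ := fun τ => τ.nat 19 = cell i ∧ τ.nat 16 = 1 ∧
    τ.nat 17 = 0 ∧ τ.real 5 = 0 ∧ τ.nat 30 = 1 ∧ τ.nat 37 = 9 ∧ τ.nat 40 = 2 ∧
    τ.natArr 2 = σ.natArr 2 ∧ τ.realArr 3 = σ.realArr 3)
    (reaches_block _ _ _ (by simp) (by simp [apply, *])) ?_ (by omega)
  rintro τ ⟨k19, k16, k17, k5, k30, k37, k40, ka, kr⟩ -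
  refine reaches_for 8 8 (fun n τ => τ.nat 16 = n + 1 ∧
    τ.nat 17 = ((Finset.range n).filter (fun j => (inRow row (slots U) (row i j)).card = 1)).card ∧
    τ.real 5 = ∑ j ∈ (Finset.range n).filter (fun j => (inRow row (slots U) (row i j)).card = 1),
      rowResidual row I.meas (slots (Finset.range q) \ slots U) val (row i j))
    ⟨k16, by simpa using k17, by simpa using k5⟩ ?_ ?_ (by omega) ?_
  · rintro j hj ρ ⟨r16, -⟩ hf
    have := (hf.nat 37 (by decide)).trans k37
    simp only [Holds, r16, this]; omega
  · rintro j hj ρ ⟨r16, r17, r5⟩ hf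
    have f19 := (hf.nat 19 (by decide)).trans k19
    have f30 := (hf.nat 30 (by decide)).trans k30
    have f40 := (hf.nat 40 (by decide)).trans k40
    have f2 := (hf.natArr 2 (by decide)).trans ka
    have f3 := (hf.realArr 3 (by decide)).trans kr
    have hcnt := hT.cnt (row i j)
    have hres := hT.res i hi j hj
    have hpos : 0 < (inRow row (slots U) (row i j)).card :=
      Finset.card_pos.2 ⟨(i, j), by simp [inRow, slots, hiU, hj]⟩
    refine Reaches.seq (T₁ := 2) (T₂ := 6) (Q₁ := fun υ => υ.nat 21 = row i j ∧
      υ.nat 20 = (inRow row (slots U) (row i j)).card ∧ υ.nat 16 = ρ.nat 16 ∧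
      υ.nat 17 = ρ.nat 17 ∧ υ.real 5 = ρ.real 5 ∧ υ.nat 30 = 1 ∧ υ.nat 40 = 2 ∧
      υ.realArr 3 = σ.realArr 3) (reaches_block _ _ _ (by simp) (by simp [apply, *])) ?_ (by omega)
    rintro υ ⟨u21, u20, u16, u17, u5, u30, u40, u3⟩ -
    rw [Finset.range_add_one, Finset.filter_insert]
    refine Reaches.seq (T₁ := 4) (T₂ := 1) (Q₁ := fun υ => υ.nat 16 = j + 1 ∧ υ.nat 30 = 1 ∧
      υ.nat 17 = (if (inRow row (slots U) (row i j)).card = 1 then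
        insert j ((Finset.range j).filter (fun j => (inRow row (slots U) (row i j)).card = 1))
        else (Finset.range j).filter (fun j => (inRow row (slots U) (row i j)).card = 1)).card ∧
      υ.real 5 = ∑ j ∈ (if (inRow row (slots U) (row i j)).card = 1 then
        insert j ((Finset.range j).filter (fun j => (inRow row (slots U) (row i j)).card = 1))
        else (Finset.range j).filter (fun j => (inRow row (slots U) (row i j)).card = 1)),
        rowResidual row I.meas (slots (Finset.range q) \ slots U) val (row i j)) ?_ ?_ (by omega)
    · refine reaches_ite (T₁ := 3) (by omega) (fun hb => ?_) (fun hb => ?_) <;>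
        simp only [Holds, u20, u40] at hb
      · have h1 : (inRow row (slots U) (row i j)).card = 1 := by omega
        rw [if_pos h1]
        refine reaches_block _ _ _ (by simp) ?_
        rw [Finset.card_insert_of_notMem (by simp), Finset.sum_insert (by simp)]
        simp [apply, u16, u17, u21, u5, u3, r16, r17, r5, u30, hres, add_comm]
      · rw [if_neg (by omega)]
        exact reaches_instr _ (by omega) (by simp [apply, u16, u17, u5, r16, r17, r5, u30])
    · rintro ξ ⟨x16, x30, x17, x5⟩ -
      exact reaches_instr _ le_rfl ⟨by simp [apply, x16, x30], by simpa [apply] using x17,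
        by simpa [apply] using x5⟩
  · rintro ρ ⟨-, r17, r5⟩ hf
    exact ⟨r17, r5, (hf.nat 19 (by decide)).trans k19⟩

end Spec

section Spec

variable {I : SketchInput} {cell : ℕ → ℕ}

theorem inRow_erase (row : ℕ → ℕ → ℕ) (P : Finset (ℕ × ℕ)) (x : ℕ × ℕ) (r : ℕ) :
    inRow row (P.erase x) r = if row x.1 x.2 = r then (inRow row P r).erase x
      else inRow row P r := by
  unfold inRow
  ext y
  split_ifs with h <;> simp only [Finset.mem_filter, Finset.mem_erase]
  · tauto
  · constructor
    · tauto
    · rintro ⟨h1, h2⟩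
      exact ⟨⟨fun h3 => h (h3 ▸ h2), h1⟩, h2⟩

/-- A slot is removed from the tables. -/
theorem removeProg_spec (σ : RAMState) (q : ℕ) (P : Finset (ℕ × ℕ)) (val : ℕ → ℝ)
    (hT : Tables (itemRow I cell) I.meas q P val σ) (i n : ℕ) (hiq : i < q) (hn : n < 8)
    (hP : (i, n) ∈ P) (h9 : σ.nat 9 = i) (h16 : σ.nat 16 = n + 1) (h19 : σ.nat 19 = cell i)
    (h30 : σ.nat 30 = 1) (h7 : σ.real 7 = val i) :
    removeProg.Reaches I σ 10 (fun υ =>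
      υ.nat 20 = (inRow (itemRow I cell) (P.erase (i, n)) (itemRow I cell i n)).card ∧
      υ.nat 22 = ∑ x ∈ inRow (itemRow I cell) (P.erase (i, n)) (itemRow I cell i n), x.1 ∧
      Tables (itemRow I cell) I.meas q (P.erase (i, n)) val υ) := by
  have hr : ∀ i j, I.colRow (cell i) (j + 1) = itemRow I cell i j := fun _ _ => rfl
  generalize itemRow I cell = row at *
  obtain ⟨t2, t3, tr⟩ := hT
  have hmem : (i, n) ∈ inRow row P (row i n) := by simp [inRow, hP]
  have hcard : ((inRow row P (row i n)).erase (i, n)).card =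
      (inRow row P (row i n)).card - 1 := Finset.card_erase_of_mem hmem
  have hsum : ∑ x ∈ (inRow row P (row i n)).erase (i, n), x.1 =
      ∑ x ∈ inRow row P (row i n), x.1 - i := by
    have := Finset.add_sum_erase (inRow row P (row i n)) (fun x => x.1) hmem
    simp only at this
    omega
  have hcpl : slots (Finset.range q) \ P.erase (i, n) =
      insert (i, n) (slots (Finset.range q) \ P) := by
    ext x
    have : x = (i, n) → x ∈ slots (Finset.range q) := by
      rintro rfl; simp [slots, hiq, hn]
    simp only [Finset.mem_sdiff, Finset.mem_erase, Finset.mem_insert]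
    tauto
  have hnot : ∀ r, (i, n) ∉ inRow row (slots (Finset.range q) \ P) r := by
    intro r h
    simp only [inRow, Finset.mem_filter, Finset.mem_sdiff] at h
    exact h.1.2 hP
  refine reaches_block _ _ _ (by simp) ⟨?_, ?_, ?_, ?_, ?_⟩
  · rw [inRow_erase, if_pos rfl, hcard]
    simp [apply, h16, h19, h30, hr, t2]
  · rw [inRow_erase, if_pos rfl, hsum]
    simp [apply, h16, h19, h9, hr, t3]
  · intro r
    rw [inRow_erase]
    by_cases h : r = row i n
    · subst h
      rw [if_pos rfl, hcard]
      simp [apply, h16, h19, h30, hr, t2]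
    · rw [if_neg (Ne.symm h)]
      simp [apply, h16, h19, hr, t2, h]
  · intro r
    rw [inRow_erase]
    by_cases h : r = row i n
    · subst h
      rw [if_pos rfl, hsum]
      simp [apply, h16, h19, h9, hr, t3]
    · rw [if_neg (Ne.symm h)]
      simp [apply, h16, h19, hr, t3, h]
  · intro i' hi' j hj
    have h1 := tr i' hi' j hj
    unfold rowResidual at h1 ⊢
    rw [hcpl, inRow_insert]
    by_cases h : row i' j = row i n
    · rw [h] at h1 ⊢
      rw [if_pos rfl, Finset.sum_insert (hnot _)]
      simp [apply, h16, h19, h7, hr, h1]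
      ring
    · rw [if_neg (Ne.symm h)]
      simp [apply, h16, h19, hr, h1, h]

set_option maxHeartbeats 1000000 in
/-- The evaluation of an item takes it out of the tables, and every item that gains an isolated row
is pushed onto the stack. -/
theorem evalProg_spec (σ : RAMState) (q : ℕ) (hE : PeelEnv cell q σ) (U : Finset ℕ)
    (hU : U ⊆ Finset.range q) (val : ℕ → ℝ)
    (hT : Tables (itemRow I cell) I.meas q (slots U) val σ) (i : ℕ)
    (hiU : i ∈ U) (h9 : σ.nat 9 = i) (h19 : σ.nat 19 = cell i) (v : ℝ)
    (hv : σ.real 5 / (σ.nat 17 : ℝ) = v) (hst : ∀ x < σ.nat 34, σ.natArr 4 x < q) :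
    evalProg.Reaches I σ 150 (fun σ' =>
      Tables (itemRow I cell) I.meas q (slots (U.erase i)) (Function.update val i v) σ' ∧
      σ'.realArr 0 = Function.update (σ.realArr 0) i v ∧
      σ'.natArr 5 = Function.update (σ.natArr 5) i 1 ∧
      σ.nat 34 ≤ σ'.nat 34 ∧ σ'.nat 34 ≤ σ.nat 34 + 8 ∧ (∀ x < σ'.nat 34, σ'.natArr 4 x < q) ∧
      (∀ x < σ.nat 34, σ'.natArr 4 x = σ.natArr 4 x) ∧
      ∀ x ∈ slots (U.erase i),
        (inRow (itemRow I cell) (slots (U.erase i)) (itemRow I cell x.1 x.2)).card = 1 →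
        (inRow (itemRow I cell) (slots U) (itemRow I cell x.1 x.2)).card = 1 ∨
          ∃ y < σ'.nat 34, σ'.natArr 4 y = x.1) := by
  generalize hrow : itemRow I cell = row at *
  obtain ⟨h13, h29, h30, h37, h38, h40, hc⟩ := hE
  have hiq : i < q := Finset.mem_range.1 (hU hiU)
  obtain ⟨t2, t3, tr⟩ := hT
  refine Reaches.seq (T₁ := 5) (T₂ := 145) (Q₁ := fun τ => (τ.nat 9 = i ∧ τ.nat 19 = cell i ∧
    τ.nat 16 = 1 ∧ τ.nat 29 = 0 ∧ τ.nat 30 = 1 ∧ τ.nat 37 = 9 ∧ τ.nat 40 = 2 ∧ τ.real 7 = v ∧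
    τ.nat 34 = σ.nat 34) ∧
    τ.natArr 2 = σ.natArr 2 ∧ τ.natArr 3 = σ.natArr 3 ∧ τ.natArr 4 = σ.natArr 4 ∧
    τ.realArr 3 = σ.realArr 3 ∧ τ.realArr 0 = Function.update (σ.realArr 0) i v ∧
    τ.natArr 5 = Function.update (σ.natArr 5) i 1)
    (reaches_block _ _ _ (by simp) (by simp [apply, *])) ?_ (by omega)
  rintro τ ⟨⟨k9, k19, k16, k29, k30, k37, k40, k7, k34⟩, ka2, ka3, ka4, kr3, kr0, ka5⟩ -
  set val' := Function.update val i v with hval'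
  -- the slots that are still in the tables after `n` rounds of the loop
  let P : ℕ → Finset (ℕ × ℕ) := fun n => slots U \ ({i} ×ˢ Finset.range n)
  have hP0 : P 0 = slots U := by simp [P]
  have hP8 : P 8 = slots (U.erase i) := by
    ext ⟨x, y⟩
    simp only [P, slots, Finset.mem_sdiff, Finset.mem_product, Finset.mem_range,
      Finset.mem_singleton, Finset.mem_erase]
    tauto
  have hPsucc : ∀ n, P (n + 1) = (P n).erase (i, n) := by
    intro n
    ext ⟨x, y⟩
    simp only [P, slots, Finset.mem_sdiff, Finset.mem_product, Finset.mem_range,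
      Finset.mem_singleton, Finset.mem_erase, ne_eq, Prod.mk.injEq, Nat.lt_succ_iff_lt_or_eq]
    tauto
  have hPmem : ∀ n < 8, (i, n) ∈ P n := by
    intro n hn
    simp [P, slots, hiU, hn]
  have hPU : ∀ n x, x ∈ P n → x.1 ∈ U := by
    rintro n ⟨x, y⟩ hx
    simp only [P, slots, Finset.mem_sdiff, Finset.mem_product] at hx
    exact hx.1.1
  refine reaches_for 8 17 (fun n ρ => ρ.nat 16 = n + 1 ∧
      Tables row I.meas q (P n) val' ρ ∧
      σ.nat 34 ≤ ρ.nat 34 ∧ ρ.nat 34 ≤ σ.nat 34 + n ∧ (∀ x < ρ.nat 34, ρ.natArr 4 x < q) ∧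
      (∀ x < σ.nat 34, ρ.natArr 4 x = σ.natArr 4 x) ∧
      ∀ x ∈ P n, (inRow row (P n) (row x.1 x.2)).card = 1 →
        (inRow row (slots U) (row x.1 x.2)).card = 1 ∨ ∃ y < ρ.nat 34, ρ.natArr 4 y = x.1)
    ⟨k16, ⟨?_, ?_, ?_⟩, k34.ge, k34.le, ?_, ?_, ?_⟩ ?_ ?_ (by omega) ?_
  · rw [hP0, ka2]; exact t2
  · rw [hP0, ka3]; exact t3
  · intro i' hi' j hj
    rw [hP0, kr3, tr i' hi' j hj]
    unfold rowResidual
    congr 1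
    refine Finset.sum_congr rfl fun x hx => ?_
    have : x.1 ≠ i := by
      rintro h
      simp only [inRow, slots, Finset.mem_filter, Finset.mem_sdiff, Finset.mem_product, h] at hx
      exact hx.1.2 ⟨hiU, hx.1.1.2⟩
    rw [hval', Function.update_of_ne this]
  · rw [k34, ka4]; exact hst
  · rw [ka4]; exact fun _ _ => rfl
  · intro x hx h
    rw [hP0] at h
    exact Or.inl h
  · rintro n hn ρ ⟨r16, -⟩ hf
    have := (hf.nat 37 (by decide)).trans k37
    simp only [Holds, r16, this]; omega
  · rintro n hn ρ ⟨r16, ⟨rT2, rT3, rTr⟩, r34, r34', rst, rold, rnew⟩ hf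
    have f9 := (hf.nat 9 (by decide)).trans k9
    have f19 := (hf.nat 19 (by decide)).trans k19
    have f29 := (hf.nat 29 (by decide)).trans k29
    have f30 := (hf.nat 30 (by decide)).trans k30
    have f40 := (hf.nat 40 (by decide)).trans k40
    have f7 := (hf.real 7 (by decide)).trans k7
    refine Reaches.seq (T₁ := 10) (T₂ := 6) (removeProg_spec (I := I) (cell := cell) ρ q (P n) val'
      (by rw [hrow]; exact ⟨rT2, rT3, rTr⟩) i n hiq
      hn (hPmem n hn) f9 r16 f19 f30 (by rw [f7, hval', Function.update_self])) ?_ (by omega)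
    rintro υ ⟨u20, u22, uT⟩ hf1
    have u16 := (hf1.nat 16 (by decide)).trans r16
    have u29 := (hf1.nat 29 (by decide)).trans f29
    have u30 := (hf1.nat 30 (by decide)).trans f30
    have u40 := (hf1.nat 40 (by decide)).trans f40
    have u34 := hf1.nat 34 (by decide)
    have ust := hf1.natArr 4 (by decide)
    rw [← hPsucc, hrow] at u20 u22 uT
    -- the row of the removed slot is the only one whose counter has changed
    have hother : ∀ x ∈ P (n + 1), (inRow row (P (n + 1)) (row x.1 x.2)).card = 1 →
        row x.1 x.2 ≠ row i n → (inRow row (slots U) (row x.1 x.2)).card = 1 ∨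
          ∃ y < ρ.nat 34, ρ.natArr 4 y = x.1 := by
      intro x hx h1 hne
      have h2 : inRow row (P (n + 1)) (row x.1 x.2) = inRow row (P n) (row x.1 x.2) := by
        rw [hPsucc, inRow_erase, if_neg (Ne.symm hne)]
      rw [h2] at h1
      rw [hPsucc] at hx
      exact rnew x (Finset.mem_of_mem_erase hx) h1
    refine Reaches.seq (T₁ := 5) (T₂ := 1) (Q₁ := fun ξ => ξ.nat 16 = n + 1 ∧ ξ.nat 30 = 1 ∧
      Tables row I.meas q (P (n + 1)) val' ξ ∧
      σ.nat 34 ≤ ξ.nat 34 ∧ ξ.nat 34 ≤ σ.nat 34 + (n + 1) ∧ (∀ x < ξ.nat 34, ξ.natArr 4 x < q) ∧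
      (∀ x < σ.nat 34, ξ.natArr 4 x = σ.natArr 4 x) ∧
      ∀ x ∈ P (n + 1), (inRow row (P (n + 1)) (row x.1 x.2)).card = 1 →
        (inRow row (slots U) (row x.1 x.2)).card = 1 ∨ ∃ y < ξ.nat 34, ξ.natArr 4 y = x.1)
      ?_ ?_ (by omega)
    · have hskip : (inRow row (P (n + 1)) (row i n)).card ≠ 1 →
          skipProg.Reaches I υ 3 (fun ξ => ξ.nat 16 = n + 1 ∧ ξ.nat 30 = 1 ∧
            Tables row I.meas q (P (n + 1)) val' ξ ∧
            σ.nat 34 ≤ ξ.nat 34 ∧ ξ.nat 34 ≤ σ.nat 34 + (n + 1) ∧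
            (∀ x < ξ.nat 34, ξ.natArr 4 x < q) ∧
            (∀ x < σ.nat 34, ξ.natArr 4 x = σ.natArr 4 x) ∧
            ∀ x ∈ P (n + 1), (inRow row (P (n + 1)) (row x.1 x.2)).card = 1 →
              (inRow row (slots U) (row x.1 x.2)).card = 1 ∨
                ∃ y < ξ.nat 34, ξ.natArr 4 y = x.1) := by
        intro hne
        refine reaches_instr _ (by omega) ⟨by simp [apply, u16], by simp [apply, u30],
          ⟨by simpa [apply] using uT.cnt, by simpa [apply] using uT.sum,
            by simpa [apply] using uT.res⟩, ?_⟩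
        simp only [apply, RAMState.setNat_nat, RAMState.setNat_natArr, u34, ust,
          show (34 : ℕ) = 39 ↔ False by simp, if_false]
        refine ⟨r34, by omega, rst, rold, fun x hx h1 => hother x hx h1 fun h => ?_⟩
        rw [h] at h1
        exact hne h1
      refine reaches_ite (T₁ := 4) (by omega) (fun hb => ?_) (fun hb => ?_) <;>
        simp only [Holds, u20, u40] at hb
      · refine reaches_ite (T₁ := 3) (by omega) (fun hb' => ?_) (fun hb' => ?_) <;>
          simp only [Holds, u20, u29] at hb'
        · have h1 : (inRow row (P (n + 1)) (row i n)).card = 1 := by omega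
          obtain ⟨z, hz⟩ := Finset.card_eq_one.1 h1
          have hzP : z ∈ P (n + 1) := by
            have : z ∈ inRow row (P (n + 1)) (row i n) := by rw [hz]; simp
            exact (Finset.mem_filter.1 this).1
          rw [hz, Finset.sum_singleton] at u22
          refine reaches_block _ _ _ (by simp) ⟨by simp [apply, u16], by simp [apply, u30],
            ⟨by simpa [apply] using uT.cnt, by simpa [apply] using uT.sum,
              by simpa [apply] using uT.res⟩, ?_⟩
          have e34 : (List.foldl (fun σ c => c.apply I σ) ((natStore 4 34 22).apply I υ)
              [natAdd 34 34 30]).nat 34 = ρ.nat 34 + 1 := by simp [apply, u34, u30]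
          have e4 : (List.foldl (fun σ c => c.apply I σ) ((natStore 4 34 22).apply I υ)
              [natAdd 34 34 30]).natArr 4 = Function.update (ρ.natArr 4) (ρ.nat 34) z.1 := by
            simp [apply, u34, ust, u22]
          rw [e34, e4]
          refine ⟨by omega, by omega, fun x hx => ?_, fun x hx => ?_, fun x hx h2 => ?_⟩
          · by_cases h : x = ρ.nat 34
            · subst h
              rw [Function.update_self]
              exact Finset.mem_range.1 (hU (hPU _ _ hzP))
            · rw [Function.update_of_ne h]
              exact rst x (by omega)
          · rw [Function.update_of_ne (by omega)]
            exact rold x hx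
          · by_cases h : row x.1 x.2 = row i n
            · right
              have : x ∈ inRow row (P (n + 1)) (row i n) := by simp [inRow, hx, h]
              rw [hz, Finset.mem_singleton] at this
              exact ⟨ρ.nat 34, by omega, by rw [Function.update_self, this]⟩
            · refine (hother x hx h2 h).imp id ?_
              rintro ⟨y, hy, hy'⟩
              exact ⟨y, by omega, by rw [Function.update_of_ne (by omega), hy']⟩
        · exact hskip (by omega)
      · exact (hskip (by omega)).weaken (by omega) fun _ h _ => h
    · rintro ξ ⟨x16, x30, xT, x34, x34', xst, xold, xnew⟩ -
      exact reaches_instr _ le_rfl ⟨by simp [apply, x16, x30],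
        ⟨by simpa [apply] using xT.cnt, by simpa [apply] using xT.sum,
            by simpa [apply] using xT.res⟩, by simpa [apply] using x34,
        by simpa [apply] using x34', by simpa [apply] using xst, by simpa [apply] using xold,
        by simpa [apply] using xnew⟩
  · rintro ρ ⟨-, rT, r34, r34', rst, rold, rnew⟩ hf
    rw [hP8] at rT rnew
    exact ⟨rT, (hf.realArr 0 (by decide)).trans kr0, (hf.natArr 5 (by decide)).trans ka5, r34,
      r34', rst, rold, rnew⟩

end Spec

section Spec

variable {I : SketchInput} {cell : ℕ → ℕ}

theorem Tables.congr {row : ℕ → ℕ → ℕ} {b : ℕ → ℝ} {q : ℕ} {P : Finset (ℕ × ℕ)} {val : ℕ → ℝ}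
    {σ σ' : RAMState} (h : Tables row b q P val σ) (h2 : σ'.natArr 2 = σ.natArr 2)
    (h3 : σ'.natArr 3 = σ.natArr 3) (hr : σ'.realArr 3 = σ.realArr 3) :
    Tables row b q P val σ' := by
  refine ⟨?_, ?_, ?_⟩
  · rw [h2]; exact h.cnt
  · rw [h3]; exact h.sum
  · rw [hr]; exact h.res

/-- The state between two evaluations, with values `val` for the items outside `U`.  Every item
that can be evaluated is on the stack. -/
structure Peeling (row : ℕ → ℕ → ℕ) (b : ℕ → ℝ) (q : ℕ) (U : Finset ℕ) (val : ℕ → ℝ)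
    (σ : RAMState) : Prop where
  peel : Peel row b q U val
  tables : Tables row b q (slots U) val σ
  vals : σ.realArr 0 = val
  done : ∀ i < q, σ.natArr 5 i = if i ∈ U then 0 else 1
  stack_lt : ∀ x < σ.nat 34, σ.natArr 4 x < q
  stack : ∀ i ∈ U, 5 ≤ (isoSlots row U i).card → ∃ x < σ.nat 34, σ.natArr 4 x = i

/-- Removal of an entry from the stack that cannot be evaluated. -/
theorem Peeling.pop {row : ℕ → ℕ → ℕ} {b : ℕ → ℝ} {q : ℕ} {U : Finset ℕ} {val : ℕ → ℝ}
    {σ σ' : RAMState} (h : Peeling row b q U val σ) {sp : ℕ} (hsp : σ.nat 34 = sp + 1)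
    (hbad : σ.natArr 4 sp ∈ U → ¬ 5 ≤ (isoSlots row U (σ.natArr 4 sp)).card)
    (h34 : σ'.nat 34 = sp) (h2 : σ'.natArr 2 = σ.natArr 2)
    (h3 : σ'.natArr 3 = σ.natArr 3) (h4 : σ'.natArr 4 = σ.natArr 4)
    (h5 : σ'.natArr 5 = σ.natArr 5) (hr : σ'.realArr 3 = σ.realArr 3)
    (hr0 : σ'.realArr 0 = σ.realArr 0) : Peeling row b q U val σ' := by
  refine ⟨h.peel, h.tables.congr h2 h3 hr, hr0.trans h.vals, ?_, ?_, ?_⟩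
  · rw [h5]; exact h.done
  · rw [h4, h34]
    exact fun x hx => h.stack_lt x (by omega)
  · intro i hi hiso
    rw [h4, h34]
    obtain ⟨x, hx, hx'⟩ := h.stack i hi hiso
    refine ⟨x, ?_, hx'⟩
    by_contra hlt
    have : x = sp := by omega
    subst this
    rw [hx'] at hbad
    exact hbad hi hiso

/-- The peeling takes linear time: every evaluation pushes at most eight items, so the height of the
stack plus a multiple of the number of unevaluated items decreases.  At the end no item can be
evaluated. -/
theorem peelProg_spec (σ : RAMState) (q : ℕ) (hE : PeelEnv cell q σ)
    (hT : Tables (itemRow I cell) I.meas q (slots (Finset.range q)) (fun _ => 0) σ)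
    (h34 : σ.nat 34 = q) (h4 : ∀ i < q, σ.natArr 4 i = i) (h5 : σ.natArr 5 = fun _ => 0)
    (h0 : σ.realArr 0 = fun _ => 0) :
    peelProg.Reaches I σ (1300 * q + 1) (fun σ' => ∃ U val,
      Peel (itemRow I cell) I.meas q U val ∧ σ'.realArr 0 = val ∧
      ∀ i ∈ U, (isoSlots (itemRow I cell) U i).card < 5) := by
  set row := itemRow I cell with hrow
  refine reaches_loop (fun n τ => ∃ U val, Peeling row I.meas q U val τ ∧
    100 * τ.nat 34 + 1200 * U.card + 1 ≤ n) ?_ ?_ ?_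
  · rintro n τ ⟨U, val, hP, hn⟩ hf hb
    have hE' : PeelEnv cell q τ := by
      refine hE.congr ?_ (hf.natArr 0 (by decide))
      rintro x (rfl | rfl | rfl | rfl | rfl | rfl)
      · exact hf.nat 13 (by decide)
      · exact hf.nat 29 (by decide)
      · exact hf.nat 30 (by decide)
      · exact hf.nat 37 (by decide)
      · exact hf.nat 38 (by decide)
      · exact hf.nat 40 (by decide)
    have h29 := hE'.n29
    have h30 := hE'.n30
    simp only [Holds, h29] at hb
    obtain ⟨sp, hsp⟩ : ∃ sp, τ.nat 34 = sp + 1 := ⟨τ.nat 34 - 1, by omega⟩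
    set i := τ.natArr 4 sp with hi
    have hiq : i < q := hP.stack_lt sp (by omega)
    have hdone := hP.done i hiq
    -- the entry on top of the stack is popped in either case
    have hpop : ∀ (p : RAMProg) (T : ℕ) (Q : RAMState → Prop),
        (∀ υ, υ.nat 34 = sp → υ.nat 9 = i → υ.nat 20 = (if i ∈ U then 0 else 1) →
          PeelEnv cell q υ → υ.natArr = τ.natArr → υ.realArr = τ.realArr → p.Reaches I υ T Q) →
        (block (natSub 34 34 30) [natLoad 9 4 34, natLoad 20 5 9] ;; p).Reaches I τ (3 + T) Q := by
      intro p T Q h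
      refine Reaches.seq (T₁ := 3) (T₂ := T) (Q₁ := fun υ => υ.nat 34 = sp ∧ υ.nat 9 = i ∧
        υ.nat 20 = (if i ∈ U then 0 else 1) ∧ PeelEnv cell q υ ∧ υ.natArr = τ.natArr ∧
        υ.realArr = τ.realArr) (reaches_block _ _ _ (by simp) ?_) ?_ le_rfl
      · refine ⟨by simp [apply, hsp, h30], by simp [apply, hsp, h30, hi],
          by simp [apply, hsp, h30, ← hi, hdone], hE'.congr ?_ (by simp [apply]), by simp [apply],
          by simp [apply]⟩
        rintro x (rfl | rfl | rfl | rfl | rfl | rfl) <;> simp [apply]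
      · rintro υ ⟨a, b, c, d, e, f⟩ -
        exact h υ a b c d e f
    by_cases hgood : i ∈ U ∧ 5 ≤ (isoSlots row U i).card
    · obtain ⟨hiU, hiso⟩ := hgood
      refine ⟨3 + 230, 100 * (sp + 8) + 1200 * (U.erase i).card + 1, ?_, hpop _ _ _ ?_⟩
      · have := Finset.card_erase_add_one hiU
        omega
      intro υ u34 u9 u20 uE ua ur
      have uT := hP.tables.congr (σ' := υ) (by rw [ua]) (by rw [ua]) (by rw [ur])
      refine reaches_ite (T₁ := 229) (by omega) (fun _ => ?_) (fun hb' => ?_)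
      swap
      · rw [if_pos hiU] at u20
        simp only [Holds, u20, uE.n30] at hb'
        omega
      refine Reaches.seq (T₁ := 77) (T₂ := 152) (scanProg_spec υ q uE U val uT i hiq hiU u9) ?_
        (by omega)
      rintro ξ ⟨x17, x5, x19⟩ hf1
      rw [← hrow] at x17 x5
      have x9 := (hf1.nat 9 (by decide)).trans u9
      have x34 := (hf1.nat 34 (by decide)).trans u34
      have xE : PeelEnv cell q ξ := by
        refine uE.congr ?_ (hf1.natArr 0 (by decide))
        rintro x (rfl | rfl | rfl | rfl | rfl | rfl)
        · exact hf1.nat 13 (by decide)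
        · exact hf1.nat 29 (by decide)
        · exact hf1.nat 30 (by decide)
        · exact hf1.nat 37 (by decide)
        · exact hf1.nat 38 (by decide)
        · exact hf1.nat 40 (by decide)
      have xT := uT.congr (σ' := ξ) (hf1.natArr 2 (by decide)) (hf1.natArr 3 (by decide))
        (hf1.realArr 3 (by decide))
      have x4 : ξ.natArr 4 = τ.natArr 4 := (hf1.natArr 4 (by decide)).trans (by rw [ua])
      have xa5 : ξ.natArr 5 = τ.natArr 5 := (hf1.natArr 5 (by decide)).trans (by rw [ua])
      have x0 : ξ.realArr 0 = τ.realArr 0 := (hf1.realArr 0 (by decide)).trans (by rw [ur])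
      refine reaches_ite (T₁ := 150) (by omega) (fun _ => ?_) (fun hb' => ?_)
      swap
      · simp only [Holds, x17, xE.n38] at hb'
        omega
      refine (evalProg_spec ξ q xE U hP.peel.subset val xT i hiU x9 x19
        (peelValue row I.meas q U val i) (by rw [x5, x17]; rfl) ?_).weaken le_rfl ?_
      · rw [x34, x4]; exact fun x hx => hP.stack_lt x (by omega)
      rintro ρ ⟨rT, r0, r5, r34, r34', rst, rold, rnew⟩ -
      refine ⟨U.erase i, _, ⟨hP.peel.step hiU hiso, rT, ?_, ?_, rst, ?_⟩, ?_⟩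
      · rw [r0, x0, hP.vals]
      · intro i' hi'
        rw [r5, xa5, Function.update_apply, hP.done i' hi']
        by_cases h : i' = i <;> simp [h, Finset.mem_erase]
      · intro i' hi' hiso'
        obtain ⟨hne, hiU'⟩ := Finset.mem_erase.1 hi'
        by_cases h : 5 ≤ (isoSlots row U i').card
        · obtain ⟨x, hx, hx'⟩ := hP.stack i' hiU' h
          have hxsp : x ≠ sp := by
            rintro rfl
            exact hne (hx'.symm.trans hi.symm)
          exact ⟨x, by omega, by rw [rold x (by omega), x4, hx']⟩
        · -- some row of `i'` has become isolated
          obtain ⟨j, hj, hj'⟩ : ∃ j ∈ isoSlots row (U.erase i) i', j ∉ isoSlots row U i' := by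
            by_contra! hcon
            exact h (hiso'.trans (Finset.card_le_card hcon))
          simp only [isoSlots, Finset.mem_filter, Finset.mem_range] at hj hj'
          rcases rnew (i', j) (by simp [slots, hj.1, hne, hiU']) hj.2 with h1 | h1
          · exact absurd ⟨hj.1, h1⟩ hj'
          · exact h1
      · omega
    · have hbad : τ.natArr 4 sp ∈ U → ¬ 5 ≤ (isoSlots row U (τ.natArr 4 sp)).card :=
        fun h h' => hgood ⟨h, h'⟩
      refine ⟨3 + 96, 100 * sp + 1200 * U.card + 1, by omega, hpop _ _ _ ?_⟩
      intro υ u34 u9 u20 uE ua ur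
      have uT := hP.tables.congr (σ' := υ) (by rw [ua]) (by rw [ua]) (by rw [ur])
      refine reaches_ite (T₁ := 95) (by omega) (fun hb' => ?_) (fun _ => ?_)
      · have hiU : i ∈ U := by
          by_contra h
          rw [if_neg h] at u20
          simp only [Holds, u20, uE.n30] at hb'
          omega
        refine Reaches.seq (T₁ := 77) (T₂ := 18) (scanProg_spec υ q uE U val uT i hiq hiU u9) ?_
          (by omega)
        rintro ξ ⟨x17, -, -⟩ hf1
        rw [← hrow] at x17
        refine reaches_ite (T₁ := 1) (by omega) (fun hb' => ?_) (fun _ => ?_)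
        · simp only [Holds, x17, hf1.nat 38 (by decide), uE.n38] at hb'
          exact absurd ⟨hiU, hb'⟩ hgood
        · refine reaches_instr _ le_rfl ⟨U, val, hP.pop hsp hbad ?_ ?_ ?_ ?_ ?_ ?_ ?_, ?_⟩
          · simpa [apply, hf1.nat 34 (by decide)] using u34
          · simp [apply, hf1.natArr 2 (by decide), ua]
          · simp [apply, hf1.natArr 3 (by decide), ua]
          · simp [apply, hf1.natArr 4 (by decide), ua]
          · simp [apply, hf1.natArr 5 (by decide), ua]
          · simp [apply, hf1.realArr 3 (by decide), ur]
          · simp [apply, hf1.realArr 0 (by decide), ur]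
          · simp [apply, hf1.nat 34 (by decide), u34]
      · refine reaches_instr _ (by omega) ⟨U, val, hP.pop hsp hbad ?_ ?_ ?_ ?_ ?_ ?_ ?_, ?_⟩
        all_goals simp [apply, u34, ua, ur]
  · rintro n τ ⟨U, val, hP, hn⟩ hf hb
    have h29 := (hf.nat 29 (by decide)).trans hE.n29
    simp only [Holds, h29] at hb
    refine ⟨by omega, U, val, hP.peel, hP.vals, fun i hi => ?_⟩
    by_contra h
    obtain ⟨x, hx, -⟩ := hP.stack i hi (by omega)
    omega
  · refine ⟨Finset.range q, fun _ => 0, ⟨.start _, hT, h0, ?_, ?_, ?_⟩, ?_⟩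
    · intro i hi
      simp [h5, hi]
    · rw [h34]; exact fun x hx => by rw [h4 x hx]; exact hx
    · intro i hi _
      have := Finset.mem_range.1 hi
      exact ⟨i, by omega, h4 i this⟩
    · simp only [Finset.card_range]; omega

/-- The recovery algorithm: select cells by a descent through the tree, then find their values by
peeling.  The constant `K` determines the number of cells that are selected at each depth. -/
def recoverProg (K : ℕ) : RAMProg :=
  descentProg K ;; tableProg ;; peelProg ;; instr (natAdd 0 13 29)

theorem recoverProg_spec (I : SketchInput) (K l k s m : ℕ) (d q : ℕ)
    (hd : d = startDepth (K * (k + s)) l) (hq : q = numCells d + (l - d) * 4 ^ d) :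
    (recoverProg K).Reaches I (RAMState.init l k s m) (30000 * q + 7 * l + 3 * K + 40)
      (fun σ => σ.nat 0 = q ∧ ListAt (σ.natArr 0) 0 (descentList I d (l - d)) ∧ ∃ U val,
        Peel (itemRow I (fun i => (descentList I d (l - d)).getD i 0)) I.meas q U val ∧
        σ.realArr 0 = val ∧
        ∀ i ∈ U, (isoSlots (itemRow I (fun i => (descentList I d (l - d)).getD i 0)) U i).card
          < 5) := by
  have hlen : (descentList I d (l - d)).length = q := by rw [length_descentList, hq]
  refine Reaches.seq (T₂ := 94 * q + 1300 * q + 10) (descentProg_spec I K l k s m d hd) ?_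
    (by omega)
  rintro σ ⟨hD, ha, hr⟩ -
  set L := descentList I d (l - d) with hL
  have hget : ∀ τ : RAMState, ListAt (τ.natArr 0) 0 L → ∀ i < q, τ.natArr 0 i = L.getD i 0 := by
    intro τ h i hi
    have := h i (by omega)
    rw [zero_add] at this
    rw [this, List.getD_eq_getElem _ _ (by omega)]
  refine Reaches.seq (T₂ := 1300 * q + 4) (tableProg_spec (cell := fun i => L.getD i 0) σ q
    (by rw [hD.n13, hlen]) hD.n29 hD.n30 (hget σ hD.cells) (ha 2 (by simp)) (ha 3 (by simp))) ?_
    (by omega)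
  rintro τ ⟨tE, tT, t34, t4⟩ hf
  have hc := hD.cells
  rw [← hf.natArr 0 (by decide)] at hc
  refine Reaches.seq (T₂ := 1) (peelProg_spec τ q tE tT t34 t4
    ((hf.natArr 5 (by decide)).trans (ha 5 (by simp)))
    ((hf.realArr 0 (by decide)).trans (hr 0 (by simp)))) ?_ (by omega)
  rintro υ ⟨U, val, h1, h2, h3⟩ hf
  have u13 := (hf.nat 13 (by decide)).trans tE.n13
  have u29 := (hf.nat 29 (by decide)).trans tE.n29
  rw [← hf.natArr 0 (by decide)] at hc
  exact reaches_instr _ le_rfl ⟨by simp [apply, u13, u29], by simpa [apply] using hc, U, val, h1,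
    by simpa [apply] using h2, h3⟩

end Spec

/-! ### The error of peeling -/

section PeelError

variable {row : ℕ → ℕ → ℕ} {b z val : ℕ → ℝ} {q : ℕ} {U : Finset ℕ} {R : Finset ℕ}

theorem mem_inRow {P : Finset (ℕ × ℕ)} {r : ℕ} {x : ℕ × ℕ} :
    x ∈ inRow row P r ↔ x ∈ P ∧ row x.1 x.2 = r := by simp [inRow]

theorem mem_slots {x : ℕ × ℕ} : x ∈ slots U ↔ x.1 ∈ U ∧ x.2 < 8 := by simp [slots]

/-- In an isolated row, the residual is the value of the item up to the noise in the row and the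
errors of the items that were evaluated before. -/
theorem rowResidual_eq (hU : U ⊆ Finset.range q) {i j : ℕ} (hi : i ∈ U)
    (hj : j ∈ isoSlots row U i) :
    rowResidual row b (slots (Finset.range q) \ slots U) val (row i j) = z i +
      (b (row i j) - ∑ x ∈ inRow row (slots (Finset.range q)) (row i j), z x.1) -
      ∑ x ∈ inRow row (slots (Finset.range q \ U)) (row i j), (val x.1 - z x.1) := by
  simp only [isoSlots, Finset.mem_filter, Finset.mem_range] at hj
  obtain ⟨w, hw⟩ := Finset.card_eq_one.1 hj.2
  have hmem : (i, j) ∈ inRow row (slots U) (row i j) := by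
    rw [mem_inRow, mem_slots]; exact ⟨⟨hi, hj.1⟩, rfl⟩
  have hsd : slots (Finset.range q) \ slots U = slots (Finset.range q \ U) := by
    ext x; simp only [Finset.mem_sdiff, mem_slots]; tauto
  have hunion : inRow row (slots (Finset.range q)) (row i j) =
      insert (i, j) (inRow row (slots (Finset.range q \ U)) (row i j)) := by
    ext x
    have h1 : x ∈ inRow row (slots U) (row i j) ↔ x = (i, j) := by
      rw [hw] at hmem ⊢
      rw [Finset.mem_singleton.1 hmem, Finset.mem_singleton]
    rw [mem_inRow, mem_slots] at h1
    rw [Finset.mem_insert, mem_inRow, mem_inRow, mem_slots, mem_slots, ← h1, Finset.mem_sdiff]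
    have := @hU x.1
    tauto
  have hnot : (i, j) ∉ inRow row (slots (Finset.range q \ U)) (row i j) := by
    simp [mem_inRow, mem_slots, hi]
  rw [rowResidual, hsd, hunion, Finset.sum_insert hnot, Finset.sum_sub_distrib]
  ring

/-- The error budget.  A row is live while it contains an item that has not been evaluated.  The
rows that determine a new value are live before but not after the evaluation, so their noise is used
only once; and an evaluated item is in at most three live rows. -/
theorem Peel.error_le (h : Peel row b q U val)
    (hinj : ∀ i < q, ∀ j < 8, ∀ j' < 8, row i j = row i j' → j = j')
    (hR : ∀ i < q, ∀ j < 8, row i j ∈ R) :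
    5 * ∑ i ∈ Finset.range q \ U, |val i - z i| +
      ∑ r ∈ R.filter (fun r => (inRow row (slots U) r).Nonempty),
        (|b r - ∑ x ∈ inRow row (slots (Finset.range q)) r, z x.1| +
          ∑ x ∈ inRow row (slots (Finset.range q \ U)) r, |val x.1 - z x.1|) ≤
    ∑ r ∈ R, |b r - ∑ x ∈ inRow row (slots (Finset.range q)) r, z x.1| +
      3 * ∑ i ∈ Finset.range q \ U, |val i - z i| := by
  set e : ℕ → ℝ := fun r => b r - ∑ x ∈ inRow row (slots (Finset.range q)) r, z x.1 with he
  change _ + ∑ r ∈ R.filter _, (|e r| + _) ≤ ∑ r ∈ R, |e r| + _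
  induction h with
  | start val =>
    simp only [sdiff_self, Finset.bot_eq_empty, Finset.sum_empty, mul_zero, zero_add, add_zero]
    have : ∀ r, inRow row (slots ∅) r = ∅ := by
      intro r; ext x; simp [mem_inRow, mem_slots]
    simp only [this, Finset.sum_empty, add_zero]
    exact Finset.sum_le_sum_of_subset_of_nonneg (Finset.filter_subset _ _)
      fun _ _ _ => abs_nonneg _
  | @step U val i hp hi hiso ih =>
    set v := peelValue row b q U val i with hv
    have hU := hp.subset
    have hiq := Finset.mem_range.1 (hU hi)
    set D := Finset.range q \ U with hD
    have hiD : i ∉ D := by simp [hD, hi]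
    have hD' : Finset.range q \ U.erase i = insert i D := by
      rw [Finset.sdiff_erase (hU hi)]
    have hval : ∀ i' ∈ D, Function.update val i v i' = val i' := fun i' h =>
      Function.update_of_ne (fun h' : i' = i => hiD (h' ▸ h)) _ _
    set F : ℕ → ℝ := fun r => |e r| + ∑ x ∈ inRow row (slots D) r, |val x.1 - z x.1| with hF
    set T := isoSlots row U i with hT
    have hT8 : T ⊆ Finset.range 8 := Finset.filter_subset _ _
    -- the error of the new value
    have hnew : 5 * |v - z i| ≤ ∑ j ∈ T, F (row i j) := by
      have hc : (5 : ℝ) ≤ T.card := by exact_mod_cast hiso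
      have h1 : (T.card : ℝ) * (v - z i) = ∑ j ∈ T, (e (row i j) -
          ∑ x ∈ inRow row (slots D) (row i j), (val x.1 - z x.1)) := by
        rw [mul_sub, hv, peelValue, ← hT, mul_div_cancel₀ _ (by positivity),
          Finset.sum_congr rfl (fun j hj => rowResidual_eq (z := z) hU hi hj), ← nsmul_eq_mul,
          ← Finset.sum_const, ← Finset.sum_sub_distrib]
        refine Finset.sum_congr rfl fun j _ => ?_
        rw [he]; ring
      calc 5 * |v - z i| ≤ T.card * |v - z i| := by gcongr
        _ = |(T.card : ℝ) * (v - z i)| := by rw [abs_mul, Nat.abs_cast]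
        _ ≤ ∑ j ∈ T, F (row i j) := by
          rw [h1]
          refine (Finset.abs_sum_le_sum_abs _ _).trans (Finset.sum_le_sum fun j _ => ?_)
          exact (abs_sub _ _).trans (add_le_add le_rfl (Finset.abs_sum_le_sum_abs _ _))
    -- the live rows
    set Lv : Finset ℕ → Finset ℕ := fun U => R.filter (fun r => (inRow row (slots U) r).Nonempty)
      with hLv
    have hinjT : Set.InjOn (fun j => row i j) T := fun j hj j' hj' h =>
      hinj i hiq j (Finset.mem_range.1 (hT8 hj)) j' (Finset.mem_range.1 (hT8 hj')) h
    have hdisj : Disjoint (Lv (U.erase i)) (T.image fun j => row i j) := by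
      rw [Finset.disjoint_right]
      intro r hr hr'
      obtain ⟨j, hj, rfl⟩ := Finset.mem_image.1 hr
      obtain ⟨x, hx⟩ := (Finset.mem_filter.1 hr').2
      rw [mem_inRow, mem_slots, Finset.mem_erase] at hx
      have hj' := (Finset.mem_filter.1 hj)
      obtain ⟨w, hw⟩ := Finset.card_eq_one.1 hj'.2
      have a1 : x ∈ inRow row (slots U) (row i j) := by
        rw [mem_inRow, mem_slots]; exact ⟨⟨hx.1.1.2, hx.1.2⟩, hx.2⟩
      have a2 : (i, j) ∈ inRow row (slots U) (row i j) := by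
        rw [mem_inRow, mem_slots]; exact ⟨⟨hi, Finset.mem_range.1 hj'.1⟩, rfl⟩
      rw [hw, Finset.mem_singleton] at a1 a2
      exact hx.1.1.1 (by rw [a1, ← a2])
    have hsub : Lv (U.erase i) ∪ (T.image fun j => row i j) ⊆ Lv U := by
      intro r hr
      rcases Finset.mem_union.1 hr with hr | hr
      · rw [hLv, Finset.mem_filter] at hr ⊢
        obtain ⟨x, hx⟩ := hr.2
        refine ⟨hr.1, x, ?_⟩
        rw [mem_inRow, mem_slots, Finset.mem_erase] at hx
        rw [mem_inRow, mem_slots]; exact ⟨⟨hx.1.1.2, hx.1.2⟩, hx.2⟩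
      · obtain ⟨j, hj, rfl⟩ := Finset.mem_image.1 hr
        have hj8 := Finset.mem_range.1 (hT8 hj)
        rw [hLv, Finset.mem_filter]
        exact ⟨hR i hiq j hj8, (i, j), by rw [mem_inRow, mem_slots]; exact ⟨⟨hi, hj8⟩, rfl⟩⟩
    have hFsum : ∑ r ∈ Lv (U.erase i), F r + ∑ j ∈ T, F (row i j) ≤ ∑ r ∈ Lv U, F r := by
      rw [← Finset.sum_image hinjT, ← Finset.sum_union hdisj]
      refine Finset.sum_le_sum_of_subset_of_nonneg hsub fun r _ _ => ?_
      exact add_nonneg (abs_nonneg _) (Finset.sum_nonneg fun _ _ => abs_nonneg _)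
    -- the rows in which the error of the new value can be seen
    have hG : ∀ r, ∑ x ∈ inRow row (slots (insert i D)) r,
        |Function.update val i v x.1 - z x.1| =
        ∑ x ∈ inRow row (slots D) r, |val x.1 - z x.1| +
          ∑ j ∈ Finset.range 8, if row i j = r then |v - z i| else 0 := by
      intro r
      have h1 : inRow row (slots (insert i D)) r = inRow row (slots D) r ∪
          ((Finset.range 8).filter (fun j => row i j = r)).image (fun j => (i, j)) := by
        ext ⟨x, y⟩
        simp only [mem_inRow, mem_slots, Finset.mem_union, Finset.mem_insert, Finset.mem_image,
          Finset.mem_filter, Finset.mem_range, Prod.mk.injEq]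
        constructor
        · rintro ⟨⟨rfl | h, h'⟩, h''⟩
          · exact Or.inr ⟨y, ⟨h', h''⟩, rfl, rfl⟩
          · exact Or.inl ⟨⟨h, h'⟩, h''⟩
        · rintro (⟨⟨h, h'⟩, h''⟩ | ⟨j, ⟨h, h'⟩, rfl, rfl⟩)
          · exact ⟨⟨Or.inr h, h'⟩, h''⟩
          · exact ⟨⟨Or.inl rfl, h⟩, h'⟩
      have h2 : Disjoint (inRow row (slots D) r)
          (((Finset.range 8).filter (fun j => row i j = r)).image (fun j => (i, j))) := by
        rw [Finset.disjoint_left]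
        rintro ⟨x, y⟩ hx hy
        obtain ⟨j, -, hj⟩ := Finset.mem_image.1 hy
        rw [mem_inRow, mem_slots] at hx
        simp only [Prod.mk.injEq] at hj
        exact hiD (hj.1 ▸ hx.1.1)
      rw [h1, Finset.sum_union h2, Finset.sum_image (by intro a _ b _ h; simpa using h),
        ← Finset.sum_filter]
      congr 1
      · refine Finset.sum_congr rfl fun x hx => ?_
        rw [mem_inRow, mem_slots] at hx
        rw [hval _ hx.1.1]
      · refine Finset.sum_congr rfl fun x hx => ?_
        simp
    have hthree : ∑ r ∈ Lv (U.erase i), ∑ j ∈ Finset.range 8,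
        (if row i j = r then |v - z i| else 0) ≤ 3 * |v - z i| := by
      rw [Finset.sum_comm]
      have h1 : ∀ j ∈ Finset.range 8, (∑ r ∈ Lv (U.erase i),
          if row i j = r then |v - z i| else 0) ≤ if j ∈ T then 0 else |v - z i| := by
        intro j hj
        rw [Finset.sum_ite_eq]
        split_ifs with h2 h3 h3
        · exact absurd (Finset.mem_image_of_mem _ h3) (Finset.disjoint_left.1 hdisj h2)
        · exact le_rfl
        · exact le_rfl
        · exact abs_nonneg _
      refine (Finset.sum_le_sum h1).trans ?_
      rw [Finset.sum_ite, Finset.sum_const_zero, zero_add, Finset.sum_const, nsmul_eq_mul]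
      gcongr
      have h2 : (Finset.range 8).filter (fun j => j ∉ T) = Finset.range 8 \ T := by
        ext; simp
      have h3 := Finset.card_sdiff_add_card_eq_card hT8
      rw [Finset.card_range] at h3
      rw [h2]
      exact_mod_cast (by omega : (Finset.range 8 \ T).card ≤ 3)
    rw [hD']
    have hs : ∑ i' ∈ insert i D, |Function.update val i v i' - z i'| =
        |v - z i| + ∑ i' ∈ D, |val i' - z i'| := by
      rw [Finset.sum_insert hiD, Function.update_self,
        Finset.sum_congr rfl fun i' h => by rw [hval i' h]]
    have hlive : ∑ r ∈ Lv (U.erase i), (|e r| + ∑ x ∈ inRow row (slots (insert i D)) r,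
        |Function.update val i v x.1 - z x.1|) ≤ ∑ r ∈ Lv (U.erase i), F r + 3 * |v - z i| := by
      simp only [hG, ← add_assoc]
      rw [Finset.sum_add_distrib]
      exact add_le_add le_rfl hthree
    rw [hs]
    change _ + ∑ r ∈ Lv (U.erase i), _ ≤ _
    change _ + ∑ r ∈ Lv U, F r ≤ _ at ih
    linarith

/-- If every nonempty set of items contains one with five isolated rows, then all items are
evaluated, and the total error is at most half of the total noise. -/
theorem Peel.total_error_le (h : Peel row b q U val)
    (hinj : ∀ i < q, ∀ j < 8, ∀ j' < 8, row i j = row i j' → j = j')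
    (hR : ∀ i < q, ∀ j < 8, row i j ∈ R)
    (hlast : ∀ i ∈ U, (isoSlots row U i).card < 5)
    (hexp : ∀ W ⊆ Finset.range q, W.Nonempty → ∃ i ∈ W, 5 ≤ (isoSlots row W i).card) :
    2 * ∑ i ∈ Finset.range q, |val i - z i| ≤
      ∑ r ∈ R, |b r - ∑ x ∈ inRow row (slots (Finset.range q)) r, z x.1| := by
  have hU : U = ∅ := by
    by_contra hne
    obtain ⟨i, hi, h5⟩ := hexp U h.subset (Finset.nonempty_iff_ne_empty.2 hne)
    have := hlast i hi
    omega
  subst hU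
  have := h.error_le (z := z) hinj hR
  rw [Finset.sdiff_empty] at this
  have h0 : 0 ≤ ∑ r ∈ R.filter (fun r => (inRow row (slots ∅) r).Nonempty),
        (|b r - ∑ x ∈ inRow row (slots (Finset.range q)) r, z x.1| +
          ∑ x ∈ inRow row (slots (Finset.range q)) r, |val x.1 - z x.1|) :=
    Finset.sum_nonneg fun r _ =>
      add_nonneg (abs_nonneg _) (Finset.sum_nonneg fun _ _ => abs_nonneg _)
  linarith

end PeelError

/-! ### Collisions of random hash functions -/

section Repeats

variable {D β τ : Type*} [DecidableEq D] [DecidableEq τ] [DecidableEq β]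

/-- The elements of `U` with the same label `κ` and the same hash value as an element of `U` that
comes earlier in the order `ord`. -/
def repeats (ord : D → ℕ) (κ : D → τ) (h : D → β) (U : Finset D) : Finset D :=
  U.filter fun x => ∃ y ∈ U, ord y < ord x ∧ κ y = κ x ∧ h y = h x

/-- The elements of `U` with the same label and the same hash value as another element of `U`. -/
def collisions (κ : D → τ) (h : D → β) (U : Finset D) : Finset D :=
  U.filter fun x => ∃ y ∈ U, y ≠ x ∧ κ y = κ x ∧ h y = h x

/-- In each class of colliding elements, all but the first are repeats. -/
theorem card_collisions_le (ord : D → ℕ) (κ : D → τ) (h : D → β) (U : Finset D)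
    (hord : ∀ x y, κ x = κ y → ord x = ord y → x = y) :
    (collisions κ h U).card ≤ 2 * (repeats ord κ h U).card := by
  have h1 : (collisions κ h U \ repeats ord κ h U).card ≤ (repeats ord κ h U).card := by
    have : ∀ x ∈ collisions κ h U \ repeats ord κ h U,
        ∃ y ∈ repeats ord κ h U, κ y = κ x ∧ h y = h x := by
      intro x hx
      simp only [collisions, repeats, Finset.mem_sdiff, Finset.mem_filter, not_and] at hx
      obtain ⟨⟨hxU, y, hyU, hne, hκ, hh⟩, hno⟩ := hx
      refine ⟨y, ?_, hκ, hh⟩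
      rw [repeats, Finset.mem_filter]
      refine ⟨hyU, x, hxU, ?_, hκ.symm, hh.symm⟩
      rcases lt_trichotomy (ord y) (ord x) with hlt | heq | hgt
      · exact absurd ⟨y, hyU, hlt, hκ, hh⟩ (hno hxU)
      · exact absurd (hord y x hκ heq) hne
      · exact hgt
    choose! f hf using this
    refine Finset.card_le_card_of_injOn f (fun x hx => (hf x hx).1) ?_
    intro x hx y hy hxy
    have hx' := hf x hx
    have hy' := hf y hy
    have hκ : κ x = κ y := by rw [← hx'.2.1, ← hy'.2.1, hxy]
    have hh : h x = h y := by rw [← hx'.2.2, ← hy'.2.2, hxy]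
    simp only [collisions, repeats, Finset.coe_sdiff, Set.mem_sdiff, Finset.mem_coe,
      Finset.mem_filter, not_and] at hx hy
    rcases lt_trichotomy (ord x) (ord y) with hlt | heq | hgt
    · exact absurd ⟨x, hx.1.1, hlt, hκ, hh⟩ (hy.2 hy.1.1)
    · exact hord x y hκ heq
    · exact absurd ⟨y, hy.1.1, hgt, hκ.symm, hh.symm⟩ (hx.2 hx.1.1)
  have h2 : collisions κ h U ⊆ (collisions κ h U \ repeats ord κ h U) ∪ repeats ord κ h U := by
    intro x hx
    by_cases hr : x ∈ repeats ord κ h U <;> simp [hx, hr]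
  have := (Finset.card_le_card h2).trans (Finset.card_union_le _ _)
  omega

variable [Fintype D] [Fintype β]

/-- The hash functions that are prescribed outside `W`, and on `Z` copy earlier values, are
determined by their values on `W \ Z`. -/
theorem card_prescribed_le (ord : D → ℕ) (g : D → β) (W Z : Finset D) (f : D → D) :
    (Finset.univ.filter fun h : D → β => (∀ x ∉ W, h x = g x) ∧
      ∀ x ∈ Z, ord (f x) < ord x ∧ h x = h (f x)).card ≤ Fintype.card β ^ (W \ Z).card := by
  have : Fintype.card β ^ (W \ Z).card = Fintype.card ({x // x ∈ W \ Z} → β) := by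
    rw [Fintype.card_fun, Fintype.card_coe]
  rw [this, ← Finset.card_univ]
  refine Finset.card_le_card_of_injOn (fun h x => h x.1) (fun _ _ => Finset.mem_univ _) ?_
  intro h hh h' hh' heq
  simp only [Finset.coe_filter, Finset.mem_univ, true_and, Set.mem_ofPred_eq] at hh hh'
  have key : ∀ n x, ord x = n → h x = h' x := by
    intro n
    induction n using Nat.strong_induction_on with
    | _ n ih =>
      intro x hx
      by_cases hZ : x ∈ Z
      · rw [(hh.2 x hZ).2, (hh'.2 x hZ).2]
        exact ih _ (hx ▸ (hh.2 x hZ).1) _ rfl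
      · by_cases hW : x ∈ W
        · exact congrFun heq ⟨x, Finset.mem_sdiff.2 ⟨hW, hZ⟩⟩
        · rw [hh.1 x hW, hh'.1 x hW]
  funext x
  exact key _ x rfl

/-- A union bound over the positions of `z` repeats and over the earlier elements. -/
theorem card_many_repeats_le (ord : D → ℕ) (κ : D → τ) (g : D → β) (W U : Finset D) (hUW : U ⊆ W)
    (n z : ℕ) (hn : ∀ x ∈ U, (U.filter fun y => κ y = κ x).card ≤ n) :
    (Finset.univ.filter fun h : D → β => (∀ x ∉ W, h x = g x) ∧
      z ≤ (repeats ord κ h U).card).card ≤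
      U.card.choose z * n ^ z * Fintype.card β ^ (W.card - z) := by
  let F : Finset D → Finset (D → D) := fun Z =>
    Fintype.piFinset fun x => if x ∈ Z then U.filter (fun y => κ y = κ x) else {x}
  have hsub : (Finset.univ.filter fun h : D → β => (∀ x ∉ W, h x = g x) ∧
      z ≤ (repeats ord κ h U).card) ⊆
      (Finset.powersetCard z U).biUnion fun Z => (F Z).biUnion fun f =>
        Finset.univ.filter fun h : D → β => (∀ x ∉ W, h x = g x) ∧
          ∀ x ∈ Z, ord (f x) < ord x ∧ h x = h (f x) := by
    intro h hh
    simp only [Finset.mem_filter, Finset.mem_univ, true_and] at hh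
    obtain ⟨Z, hZ, hcard⟩ := Finset.exists_subset_card_eq hh.2
    have hZ' : ∀ x ∈ Z, ∃ y ∈ U, ord y < ord x ∧ κ y = κ x ∧ h y = h x := fun x hx =>
      (Finset.mem_filter.1 (hZ hx)).2
    choose! f hf using hZ'
    simp only [Finset.mem_biUnion, Finset.mem_powersetCard, Finset.mem_filter, Finset.mem_univ,
      true_and]
    refine ⟨Z, ⟨hZ.trans (Finset.filter_subset _ _), hcard⟩, fun x => if x ∈ Z then f x else x, ?_,
      hh.1, fun x hx => ?_⟩
    · rw [Fintype.mem_piFinset]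
      intro x
      by_cases hx : x ∈ Z
      · simp [hx, (hf x hx).1, (hf x hx).2.2.1]
      · simp [hx]
    · simp only [hx, if_true]
      exact ⟨(hf x hx).2.1, (hf x hx).2.2.2.symm⟩
  refine (Finset.card_le_card hsub).trans ?_
  have hF : ∀ Z ∈ Finset.powersetCard z U, (F Z).card ≤ n ^ z := by
    intro Z hZ
    rw [Finset.mem_powersetCard] at hZ
    rw [Fintype.card_piFinset, ← hZ.2]
    calc ∏ x, (if x ∈ Z then U.filter (fun y => κ y = κ x) else {x}).card
        ≤ ∏ x, (if x ∈ Z then n else 1) := Finset.prod_le_prod' fun x _ => by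
          split_ifs with hx
          · exact hn x (hZ.1 hx)
          · simp
      _ = n ^ Z.card := by simp
  calc _ ≤ ∑ Z ∈ Finset.powersetCard z U, n ^ z * Fintype.card β ^ (W.card - z) := by
        refine Finset.card_biUnion_le.trans (Finset.sum_le_sum fun Z hZ => ?_)
        refine Finset.card_biUnion_le.trans ?_
        refine (Finset.sum_le_card_nsmul _ _ (Fintype.card β ^ (W.card - z)) fun f _ => ?_).trans ?_
        · refine (card_prescribed_le ord g W Z f).trans_eq ?_
          rw [Finset.mem_powersetCard] at hZ
          rw [Finset.card_sdiff_of_subset (hZ.1.trans hUW), hZ.2]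
        · rw [smul_eq_mul]
          exact Nat.mul_le_mul_right _ (hF Z hZ)
    _ = _ := by rw [Finset.sum_const, Finset.card_powersetCard, smul_eq_mul, mul_assoc]

/-- The bound remains true if the set `U h` depends on the hash values outside `W ⊇ U h`. -/
theorem card_many_repeats_adaptive_le (ord : D → ℕ) (κ : D → τ) (W : Finset D)
    (U : (D → β) → Finset D) (hUW : ∀ h, U h ⊆ W)
    (hU : ∀ h h', (∀ x ∉ W, h x = h' x) → U h = U h') (n z : ℕ) (hn : ∀ h, (U h).card ≤ n) :
    (Finset.univ.filter fun h : D → β => z ≤ (repeats ord κ h (U h)).card).card ≤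
      n.choose z * n ^ z * Fintype.card β ^ (Fintype.card D - z) := by
  by_cases hz : z ≤ W.card
  swap
  · have : (Finset.univ.filter fun h : D → β => z ≤ (repeats ord κ h (U h)).card) = ∅ := by
      rw [Finset.filter_eq_empty_iff]
      intro h _ hh
      have h1 : (repeats ord κ h (U h)).card ≤ (U h).card :=
        Finset.card_le_card (Finset.filter_subset _ _)
      have h2 := Finset.card_le_card (hUW h)
      omega
    rw [this]; simp
  let res : (D → β) → ({x // x ∈ Wᶜ} → β) := fun h x => h x.1
  refine (Finset.card_le_mul_card_image (f := res) _
    (n.choose z * n ^ z * Fintype.card β ^ (W.card - z)) ?_).trans ?_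
  · intro r hr
    obtain ⟨g, -, rfl⟩ := Finset.mem_image.1 hr
    refine (Finset.card_le_card (t := Finset.univ.filter fun h : D → β => (∀ x ∉ W, h x = g x) ∧
      z ≤ (repeats ord κ h (U g)).card) ?_).trans ((card_many_repeats_le ord κ g W (U g) (hUW g) n z
        fun x _ => (Finset.card_filter_le _ _).trans (hn g)).trans ?_)
    · intro h hh
      simp only [Finset.mem_filter, Finset.mem_univ, true_and] at hh ⊢
      have hx : ∀ x ∉ W, h x = g x := fun x hx => congrFun hh.2 ⟨x, by simpa using hx⟩
      exact ⟨hx, hU h g hx ▸ hh.1⟩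
    · gcongr
      exact hn g
  · have h1 : (Finset.image res (Finset.univ.filter fun h : D → β =>
        z ≤ (repeats ord κ h (U h)).card)).card ≤ Fintype.card β ^ (Fintype.card D - W.card) := by
      refine (Finset.card_le_univ _).trans_eq ?_
      rw [Fintype.card_fun, Fintype.card_coe, Finset.card_compl]
    refine (Nat.mul_le_mul_left _ h1).trans_eq ?_
    rw [mul_assoc, ← pow_add]
    have := Finset.card_le_univ W
    congr 2
    omega

end Repeats

/-- The probability that some set of `u` of the `q` items has `2u` repeats is small. -/
theorem choose_mul_repeats_le {q u : ℕ} (hu : 1 ≤ u) (huq : u ≤ q) :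
    (q.choose u : ℝ) * ((8 * u).choose (2 * u) * (u : ℝ) ^ (2 * u)) / (128 * q) ^ (2 * u) ≤
      1 / q * (1 / 4) ^ u := by
  have hq : (0 : ℝ) < q := by exact_mod_cast (by omega : 0 < q)
  have hu0 : (0 : ℝ) < u := by exact_mod_cast hu
  have h1 : (q.choose u : ℝ) ≤ q ^ u / (u.factorial : ℝ) := Nat.choose_le_pow_div u q
  have h2 : ((8 * u).choose (2 * u) : ℝ) ≤ 256 ^ u := by
    have : (8 * u).choose (2 * u) ≤ 2 ^ (8 * u) := Nat.choose_le_two_pow _ _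
    calc ((8 * u).choose (2 * u) : ℝ) ≤ ((2 ^ (8 * u) : ℕ) : ℝ) := by exact_mod_cast this
      _ = 256 ^ u := by rw [pow_mul]; norm_num
  have h3 : (u : ℝ) ^ u / u.factorial ≤ 3 ^ u := by
    refine (Real.pow_div_factorial_le_exp u hu0.le u).trans ?_
    have : Real.exp u = Real.exp 1 ^ u := by rw [← Real.exp_nat_mul, mul_one]
    rw [this]
    exact pow_le_pow_left₀ (Real.exp_pos _).le (Real.exp_one_lt_three.le) u
  have h4 : ((u : ℝ) / q) ^ u ≤ u / q := by
    have : (u : ℝ) / q ≤ 1 := by rw [div_le_one hq]; exact_mod_cast huq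
    calc ((u : ℝ) / q) ^ u ≤ (u / q) ^ 1 := pow_le_pow_of_le_one (by positivity) this hu
      _ = u / q := pow_one _
  have h5 : (u : ℝ) ≤ 2 ^ u := by exact_mod_cast Nat.lt_two_pow_self.le
  calc (q.choose u : ℝ) * ((8 * u).choose (2 * u) * (u : ℝ) ^ (2 * u)) / (128 * q) ^ (2 * u)
      ≤ (q ^ u / (u.factorial : ℝ)) * (256 ^ u * (u : ℝ) ^ (2 * u)) / (128 * q) ^ (2 * u) := by
        gcongr
    _ = (256 / 128 ^ 2) ^ u * ((u : ℝ) ^ u / u.factorial) * (u / q) ^ u := by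
        have hf : (u.factorial : ℝ) ≠ 0 := by positivity
        rw [div_pow, div_pow, mul_pow, ← pow_mul]
        field_simp
        ring
    _ ≤ (256 / 128 ^ 2) ^ u * 3 ^ u * (2 ^ u / q) := by
        gcongr
        exact h4.trans (by gcongr)
    _ = 1 / q * ((256 / 128 ^ 2) * 3 * 2) ^ u := by rw [mul_pow, mul_pow]; ring
    _ ≤ 1 / q * (1 / 4) ^ u := by
        gcongr
        norm_num

theorem sum_quarter_pow_le (q : ℕ) : ∑ u ∈ Finset.Icc 1 q, (1 / 4 : ℝ) ^ u ≤ 1 / 2 := by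
  have : ∀ q : ℕ, ∑ u ∈ Finset.Icc 1 q, (1 / 4 : ℝ) ^ u ≤ 1 / 2 - (1 / 4) ^ q / 2 := by
    intro q
    induction q with
    | zero => simp
    | succ q ih =>
      rw [Finset.sum_Icc_succ_top (by omega), pow_succ]
      have : (0 : ℝ) < (1 / 4) ^ q := by positivity
      linarith
  have h := this q
  have : (0 : ℝ) < (1 / 4) ^ q := by positivity
  linarith

/-! ### Loss in the descent -/

section Step

variable {α β : Type*} [DecidableEq β]

theorem sum_fiber_le (κ : α → β) (G : Finset α) (T : Finset β) (w : α → ℝ) (hw : ∀ c ∈ G, 0 ≤ w c) :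
    ∑ b ∈ T, ∑ c ∈ G.filter (fun c => κ c = b), w c ≤ ∑ c ∈ G, w c := by
  rw [← Finset.sum_fiberwise_of_maps_to (s := G) (t := T ∪ G.image κ) (g := κ)
    (fun c hc => Finset.mem_union_right _ (Finset.mem_image_of_mem κ hc))]
  exact Finset.sum_le_sum_of_subset_of_nonneg Finset.subset_union_left fun b _ _ =>
    Finset.sum_nonneg fun c hc => hw c (Finset.mem_filter.1 hc).1

variable [DecidableEq α]

/-- One step of the descent loses little of a sparse nonnegative vector `y'`.  Each candidate in
`C` is estimated by the sum of `y` over its bucket in the level `G`.  As `y' ≥ 0`, a bucket with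
estimate at most `p` hides at most `p` of `y'`, up to the noise `y - y'`.  On the other
hand `p` is small, because many candidates outside the support of `y'`, alone in their
buckets among the candidates, have an estimate of at least `p`. -/
theorem sum_dropped_le (κ : α → β) (G C K : Finset α) (hC : C ⊆ G) (y y' : α → ℝ)
    (hy' : ∀ c ∈ G, 0 ≤ y' c) {s X : ℕ} (hs : (G.filter fun c => y' c ≠ 0).card ≤ s)
    (hsX : 16 * s ≤ X) (p : ℝ)
    (hdrop : ∀ c ∈ C, c ∉ K → ∑ c' ∈ G.filter (fun c' => κ c' = κ c), y c' ≤ p)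
    (hmany : X ≤ 4 * (C.filter fun c => p ≤ ∑ c' ∈ G.filter (fun c' => κ c' = κ c), y c').card)
    (hcol : 16 * (collisions (fun _ => ()) κ C).card ≤ X) :
    ∑ c ∈ G \ K, y' c ≤ 3 / 2 * ∑ c ∈ G \ C, y' c + 3 / 2 * ∑ c ∈ G, |y c - y' c| := by
  set E := ∑ c ∈ G, |y c - y' c| with hE
  set D := (C \ K).filter fun c => y' c ≠ 0 with hD
  have hDG : D ⊆ G := fun c hc => hC (Finset.mem_sdiff.1 (Finset.mem_filter.1 hc).1).1
  have hA : ∑ c ∈ G \ K, y' c ≤ ∑ c ∈ G \ C, y' c + ∑ c ∈ D, y' c := by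
    have h1 : ∑ c ∈ D, y' c = ∑ c ∈ C \ K, y' c := Finset.sum_filter_ne_zero _
    rw [h1, ← Finset.sum_union (by
      rw [Finset.disjoint_left]; intro c hc hc'
      exact (Finset.mem_sdiff.1 hc).2 (Finset.mem_sdiff.1 hc').1)]
    refine Finset.sum_le_sum_of_subset_of_nonneg (fun c hc => ?_) fun c hc _ => hy' c ?_
    · by_cases h : c ∈ C <;> simp_all
    · rcases Finset.mem_union.1 hc with h | h
      · exact (Finset.mem_sdiff.1 h).1
      · exact hC (Finset.mem_sdiff.1 h).1
  have hB : ∑ c ∈ D, y' c ≤ s * max p 0 + E := by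
    rw [← Finset.sum_fiberwise_of_maps_to (s := D) (t := D.image κ) (g := κ)
      (fun c hc => Finset.mem_image_of_mem κ hc)]
    have h1 : ∀ b ∈ D.image κ, ∑ c ∈ D with κ c = b, y' c ≤
        max p 0 + ∑ c ∈ G.filter (fun c => κ c = b), |y c - y' c| := by
      intro b hb
      obtain ⟨c, hc, rfl⟩ := Finset.mem_image.1 hb
      have h2 : ∑ c' ∈ D with κ c' = κ c, y' c' ≤ ∑ c' ∈ G with κ c' = κ c, y' c' :=
        Finset.sum_le_sum_of_subset_of_nonneg (Finset.filter_subset_filter _ hDG) fun c hc _ =>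
          hy' c (Finset.mem_filter.1 hc).1
      have h3 : ∑ c' ∈ G with κ c' = κ c, y' c' ≤
          ∑ c' ∈ G with κ c' = κ c, y c' + ∑ c' ∈ G with κ c' = κ c, |y c' - y' c'| := by
        rw [← Finset.sum_add_distrib]
        exact Finset.sum_le_sum fun c' _ => by linarith [neg_abs_le (y c' - y' c')]
      have hc1 := Finset.mem_sdiff.1 (Finset.mem_filter.1 hc).1
      linarith [hdrop c hc1.1 hc1.2, le_max_left p 0]
    refine (Finset.sum_le_sum h1).trans ?_
    rw [Finset.sum_add_distrib, Finset.sum_const, nsmul_eq_mul]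
    refine add_le_add ?_ (sum_fiber_le κ G _ _ fun c _ => abs_nonneg _)
    refine mul_le_mul_of_nonneg_right ?_ (le_max_right _ _)
    have : (D.image κ).card ≤ s := Finset.card_image_le.trans (le_trans (Finset.card_le_card
      fun c hc => Finset.mem_filter.2 ⟨hDG hc, (Finset.mem_filter.1 hc).2⟩) hs)
    exact_mod_cast this
  set F := C.filter fun c => p ≤ ∑ c' ∈ G.filter (fun c' => κ c' = κ c), y c' with hF
  set N := G.filter fun c => y' c ≠ 0 with hN
  set H := F \ (N ∪ collisions (fun _ => ()) κ C) with hH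
  have hcard : X ≤ 8 * H.card := by
    have h1 : F.card ≤ H.card + (N ∪ collisions (fun _ => ()) κ C).card := by
      rw [hH]
      have := Finset.le_card_sdiff (N ∪ collisions (fun _ => ()) κ C) F
      omega
    have h2 := Finset.card_union_le N (collisions (fun _ => ()) κ C)
    omega
  have hHprop : ∀ c ∈ H, c ∈ C ∧ p ≤ ∑ c' ∈ G.filter (fun c' => κ c' = κ c), y c' ∧ y' c = 0 ∧
      ∀ c' ∈ C, κ c' = κ c → c' = c := by
    intro c hc
    rw [hH, Finset.mem_sdiff, Finset.mem_union, hF, Finset.mem_filter, hN, Finset.mem_filter,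
      collisions, Finset.mem_filter] at hc
    refine ⟨hc.1.1, hc.1.2, ?_, ?_⟩
    · by_contra h
      exact hc.2 (Or.inl ⟨hC hc.1.1, h⟩)
    · intro c' hc' hκ
      by_contra h
      exact hc.2 (Or.inr ⟨hc.1.1, c', hc', h, rfl, hκ⟩)
  have hp : H.card * p ≤ E + ∑ c ∈ G \ C, y' c := by
    let w : α → ℝ := fun c => |y c - y' c| + if c ∈ C then 0 else y' c
    have hw : ∑ c ∈ G, w c = E + ∑ c ∈ G \ C, y' c := by
      simp only [w, Finset.sum_add_distrib, hE, Finset.sdiff_eq_filter, Finset.sum_filter, ite_not]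
    rw [← hw]
    calc (H.card : ℝ) * p = ∑ c ∈ H, p := by simp
      _ ≤ ∑ c ∈ H, ∑ c' ∈ G.filter (fun c' => κ c' = κ c), w c' := by
        refine Finset.sum_le_sum fun c hc => ?_
        obtain ⟨h1, h2, h3, h4⟩ := hHprop c hc
        refine h2.trans (Finset.sum_le_sum fun c' hc' => ?_)
        by_cases hcC : c' ∈ C
        · obtain rfl := h4 c' hcC (Finset.mem_filter.1 hc').2
          simp only [w, hcC, if_true, h3, sub_zero, add_zero]
          exact le_abs_self _
        · simp only [w, hcC, if_false]
          linarith [le_abs_self (y c' - y' c')]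
      _ = ∑ b ∈ H.image κ, ∑ c' ∈ G.filter (fun c' => κ c' = b), w c' := by
        rw [Finset.sum_image]
        intro a ha b hb hab
        exact (hHprop b hb).2.2.2 a (hHprop a ha).1 hab
      _ ≤ _ := sum_fiber_le κ G _ _ fun c hc => by
        have := hy' c hc
        simp only [w]
        split_ifs <;> positivity
  have hE0 : 0 ≤ E := Finset.sum_nonneg fun c _ => abs_nonneg _
  have hO0 : 0 ≤ ∑ c ∈ G \ C, y' c := Finset.sum_nonneg fun c hc => hy' c (Finset.mem_sdiff.1 hc).1
  have hsp : s * max p 0 ≤ 1 / 2 * (E + ∑ c ∈ G \ C, y' c) := by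
    rcases le_total p 0 with h | h
    · rw [max_eq_right h]; simp; positivity
    · rw [max_eq_left h]
      have : (2 * s : ℝ) ≤ H.card := by exact_mod_cast (by omega : 2 * s ≤ H.card)
      nlinarith
  linarith

end Step

/-- The cells at depth `d`. -/
def levelCells (d : ℕ) : Finset ℕ := Finset.Ico (numCells d - 4 ^ d) (numCells d)

theorem three_mul_numCells (d : ℕ) : 3 * numCells d + 1 = 4 * 4 ^ d := by
  induction d with
  | zero => simp [numCells]
  | succ d ih => rw [numCells_succ, pow_succ]; omega

theorem mem_levelCells {d c : ℕ} :
    c ∈ levelCells d ↔ 4 ^ d ≤ 3 * c + 1 ∧ 3 * c + 1 < 4 * 4 ^ d := by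
  have := three_mul_numCells d
  rw [levelCells, Finset.mem_Ico]
  omega

theorem log_of_mem_levelCells {d c : ℕ} (h : c ∈ levelCells d) : Nat.log 4 (3 * c + 1) = d := by
  rw [mem_levelCells] at h
  exact Nat.log_eq_of_pow_le_of_lt_pow h.1 (by rw [pow_succ]; omega)

theorem mem_levelCells_log (c : ℕ) : c ∈ levelCells (Nat.log 4 (3 * c + 1)) := by
  rw [mem_levelCells]
  refine ⟨Nat.pow_log_le_self 4 (by omega), ?_⟩
  have := Nat.lt_pow_succ_log_self (b := 4) (by norm_num) (3 * c + 1)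
  rw [pow_succ] at this
  omega

theorem mem_childList {ks : List ℕ} {c : ℕ} : c ∈ childList ks ↔ c ≠ 0 ∧ (c - 1) / 4 ∈ ks := by
  simp only [childList, List.mem_flatMap, List.mem_cons, List.not_mem_nil, or_false]
  constructor
  · rintro ⟨p, hp, h⟩
    have : (c - 1) / 4 = p := by omega
    exact ⟨by omega, this ▸ hp⟩
  · rintro ⟨h0, h⟩
    exact ⟨_, h, by omega⟩

theorem nodup_childList {ks : List ℕ} (h : ks.Nodup) : (childList ks).Nodup := by
  rw [childList, List.nodup_flatMap]
  refine ⟨fun p _ => by simp, h.imp fun {p q} hpq => ?_⟩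
  simp only [Function.onFun, List.disjoint_left, List.mem_cons, List.not_mem_nil, or_false]
  omega

theorem mem_levelCells_succ {d c : ℕ} :
    c ∈ levelCells (d + 1) ↔ c ≠ 0 ∧ (c - 1) / 4 ∈ levelCells d := by
  have := three_mul_numCells d
  rw [mem_levelCells, mem_levelCells, pow_succ]
  omega

theorem countN_overwrite (P : ℝ → Prop) [DecidablePred P] (a : ℕ → ℝ) (l : List ℝ) :
    countN P (overwrite a l) l.length = (l.filter (fun x => P x)).length := by
  induction l using List.reverseRecOn with
  | nil => simp [countN]
  | append_singleton l x ih =>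
    rw [List.length_append, List.length_singleton, countN_succ, overwrite_concat,
      countN_congr (b := overwrite a l) fun i hi => Function.update_of_ne (by omega) _ _, ih]
    by_cases h : P x <;> simp [List.filter_append, h]

/-- In a step of the descent, no discarded candidate has a value above the pivot, while a
quarter of the number of the selected cells is exceeded by the number of candidates with at least
this value. -/
theorem levelStep_spec (val : ℕ → ℝ) (st : List ℕ × (ℕ → ℝ)) (e : ℕ) (hlen : st.1.length = 4 ^ e)
    (hnd : st.1.Nodup) : (levelStep val st).1.Nodup ∧
      (∀ c ∈ (levelStep val st).1, c ∈ childList st.1) ∧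
      ∃ p, (∀ c ∈ childList st.1, c ∉ (levelStep val st).1 → val c ≤ p) ∧
        4 ^ e ≤ 4 * ((childList st.1).toFinset.filter fun c => p ≤ val c).card := by
  set cand := childList st.1 with hcand
  have hcl : cand.length = 4 ^ (e + 1) := by rw [hcand, length_childList, hlen, pow_succ]; ring
  have hcn : cand.Nodup := nodup_childList hnd
  set p := (pivot 64 cand.length (overwrite st.2 (cand.map val))).1 with hp
  have hstep : (levelStep val st).1 =
    (cand.filter (fun c => p < val c) ++ cand.filter (fun c => ¬ p < val c)).take st.1.length := rfl
  have hperm : (cand.filter (fun c => p < val c) ++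
      cand.filter (fun c => ¬ p < val c)).Perm cand := by
    have := List.filter_append_perm (fun c => decide (p < val c)) cand
    simpa only [← decide_not] using this
  have hspec := pivot_spec cand.length 6 (e + 1) (overwrite st.2 (cand.map val)) (by norm_num) hcl
  have hlm : cand.length = (cand.map val).length := by simp
  have hcount : ∀ P : ℝ → Prop, ∀ [DecidablePred P],
      countN P (overwrite st.2 (cand.map val)) cand.length =
        (cand.filter fun c => P (val c)).length := by
    intro P _
    rw [hlm, countN_overwrite, List.filter_map, List.length_map]
    rfl
  norm_num only at hspec
  rw [← hp, hcount, hcount, hcl] at hspec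
  refine ⟨?_, ?_, p, ?_, ?_⟩
  · rw [hstep]
    exact (List.take_sublist _ _).nodup (hperm.nodup_iff.2 hcn)
  · intro c hc
    rw [hstep] at hc
    exact hperm.mem_iff.1 (List.mem_of_mem_take hc)
  · intro c hc hno
    by_contra hlt
    rw [not_le] at hlt
    apply hno
    rw [hstep, List.take_append]
    refine List.mem_append_left _ ?_
    rw [List.take_of_length_le]
    · simp [hc, hlt]
    · have h2 := hspec.2
      rw [hlen]
      have : ((cand.filter fun c => p < val c).length : ℝ) ≤ ((4 ^ e : ℕ) : ℝ) := by
        refine h2.trans ?_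
        push_cast
        have : (0 : ℝ) < 4 ^ e := by positivity
        rw [pow_succ]
        linarith
      exact_mod_cast this
  · have h1 := hspec.1
    have h3 : (cand.toFinset.filter fun c => p ≤ val c).card =
        (cand.filter fun c => p ≤ val c).length := by
      rw [← List.toFinset_card_of_nodup (hcn.filter _), List.toFinset_filter]
      simp
    rw [h3]
    rw [pow_succ] at h1
    omega

theorem levelState_congr {val val' : ℕ → ℝ} (st : List ℕ × (ℕ → ℝ)) : ∀ j,
    (∀ i < j, ∀ c ∈ childList (levelState val st i).1, val c = val' c) →
      levelState val st j = levelState val' st j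
  | 0, _ => rfl
  | j + 1, h => by
    rw [levelState, levelState, ← levelState_congr st j fun i hi => h i (by omega)]
    have h1 : (childList (levelState val st j).1).map val =
        (childList (levelState val st j).1).map val' := List.map_congr_left (h j (by omega))
    have h2 : ∀ p, (childList (levelState val st j).1).filter (fun c => p < val c) =
        (childList (levelState val st j).1).filter (fun c => p < val' c) := fun p =>
      List.filter_congr fun c hc => by rw [h j (by omega) c hc]
    have h3 : ∀ p, (childList (levelState val st j).1).filter (fun c => ¬ p < val c) =
        (childList (levelState val st j).1).filter (fun c => ¬ p < val' c) := fun p =>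
      List.filter_congr fun c hc => by rw [h j (by omega) c hc]
    rw [levelStep, levelStep]
    simp only [h1, h2, h3]

theorem startState_nodup (d : ℕ) : (startState d).1.Nodup :=
  List.nodup_range.map fun a b h => by simpa using h

theorem mem_startState {d c : ℕ} : c ∈ (startState d).1 ↔ c ∈ levelCells d := by
  have := pow_le_numCells d
  simp only [startState, List.mem_map, List.mem_range, levelCells, Finset.mem_Ico]
  constructor
  · rintro ⟨i, hi, rfl⟩; omega
  · intro h; exact ⟨c - (numCells d - 4 ^ d), by omega, by omega⟩

theorem length_startState (d : ℕ) : (startState d).1.length = 4 ^ d := by simp [startState]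

theorem levelState_nodup (val : ℕ → ℝ) (d : ℕ) : ∀ j, (levelState val (startState d) j).1.Nodup
  | 0 => startState_nodup d
  | j + 1 => (levelStep_spec val _ d ((length_levelState _ _ j).trans (length_startState d))
      (levelState_nodup val d j)).1

theorem mem_levelState (val : ℕ → ℝ) (d : ℕ) : ∀ j, ∀ c ∈ (levelState val (startState d) j).1,
    c ∈ levelCells (d + j)
  | 0, c, hc => mem_startState.1 hc
  | j + 1, c, hc => by
    have := (levelStep_spec val _ d ((length_levelState _ _ j).trans (length_startState d))
      (levelState_nodup val d j)).2.1 c hc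
    rw [mem_childList] at this
    rw [← add_assoc, mem_levelCells_succ]
    exact ⟨this.1, mem_levelState val d j _ this.2⟩

theorem mem_childList_levelState {val : ℕ → ℝ} {d j c : ℕ}
    (h : c ∈ childList (levelState val (startState d) j).1) : c ∈ levelCells (d + j + 1) := by
  rw [mem_childList] at h
  exact mem_levelCells_succ.2 ⟨h.1, mem_levelState val d j _ h.2⟩

theorem levelCells_succ (d : ℕ) :
    levelCells (d + 1) = Finset.Ico (numCells d) (numCells (d + 1)) := by
  rw [levelCells, numCells_succ, Nat.add_sub_cancel]

theorem range_numCells_succ (d : ℕ) :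
    Finset.range (numCells (d + 1)) = Finset.range (numCells d) ∪ levelCells (d + 1) := by
  ext c
  have : numCells d ≤ numCells (d + 1) := numCells_succ d ▸ Nat.le_add_right _ _
  simp only [levelCells_succ, Finset.mem_range, Finset.mem_union, Finset.mem_Ico]
  omega

theorem disjoint_range_levelCells (d : ℕ) :
    Disjoint (Finset.range (numCells d)) (levelCells (d + 1)) := by
  rw [Finset.disjoint_left]
  intro c hc hc'
  rw [levelCells_succ, Finset.mem_Ico] at hc'
  rw [Finset.mem_range] at hc
  omega

theorem levelCells_subset_range {d e : ℕ} (h : d ≤ e) :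
    levelCells d ⊆ Finset.range (numCells e) := by
  intro c hc
  have h1 : 4 ^ d ≤ 4 ^ e := Nat.pow_le_pow_right (by norm_num) h
  have h2 := three_mul_numCells e
  rw [mem_levelCells] at hc
  rw [Finset.mem_range]
  omega

theorem mem_outList (val : ℕ → ℝ) (d : ℕ) : ∀ j,
    ∀ c ∈ outList val (startState d) (List.range (numCells d)) j, c < numCells (d + j)
  | 0, c, hc => List.mem_range.1 hc
  | j + 1, c, hc => by
    have : numCells (d + j) ≤ numCells (d + j + 1) := numCells_succ (d + j) ▸ Nat.le_add_right _ _
    rw [outList, List.mem_append] at hc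
    rcases hc with hc | hc
    · have := mem_outList val d j c hc
      rw [← add_assoc]
      omega
    · exact Finset.mem_range.1 (levelCells_subset_range le_rfl (mem_levelState val d (j + 1) c hc))

theorem outList_nodup (val : ℕ → ℝ) (d : ℕ) : ∀ j,
    (outList val (startState d) (List.range (numCells d)) j).Nodup
  | 0 => List.nodup_range
  | j + 1 => by
    rw [outList, List.nodup_append']
    refine ⟨outList_nodup val d j, levelState_nodup val d (j + 1), ?_⟩
    rw [List.disjoint_left]
    intro c hc hc'
    exact Finset.disjoint_left.1 (disjoint_range_levelCells (d + j))
      (Finset.mem_range.2 (mem_outList val d j c hc)) (mem_levelState val d (j + 1) c hc')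

/-- In the signal model, the children of the discarded cells carry at most half of the mass of
these cells. -/
theorem two_mul_sum_children_le (y' : ℕ → ℝ) (d : ℕ) (ks : List ℕ)
    (hmodel : ∀ p ∈ levelCells d, 2 * ∑ c ∈ levelCells (d + 1) with (c - 1) / 4 = p, y' c ≤ y' p)
    (hy' : ∀ c, 0 ≤ y' c) :
    2 * ∑ c ∈ levelCells (d + 1) \ (childList ks).toFinset, y' c ≤
      ∑ p ∈ levelCells d \ ks.toFinset, y' p := by
  rw [← Finset.sum_fiberwise_of_maps_to (t := levelCells d \ ks.toFinset)
    (g := fun c => (c - 1) / 4),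
    Finset.mul_sum]
  · refine Finset.sum_le_sum fun p hp => ?_
    refine le_trans ?_ (hmodel p (Finset.mem_sdiff.1 hp).1)
    refine mul_le_mul_of_nonneg_left ?_ zero_le_two
    exact Finset.sum_le_sum_of_subset_of_nonneg
      (Finset.filter_subset_filter _ Finset.sdiff_subset) fun c _ _ => hy' c
  · intro c hc
    rw [Finset.mem_sdiff, mem_levelCells_succ, List.mem_toFinset, mem_childList] at hc
    rw [Finset.mem_sdiff, List.mem_toFinset]
    exact ⟨hc.1.2, fun h => hc.2 ⟨hc.1.1, h⟩⟩

/-- The sum of `y` over the cells at the depth of `c` with the same hash value. -/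
def bucketSum (κ : ℕ → ℕ) (y : ℕ → ℝ) (c : ℕ) : ℝ :=
  ∑ c' ∈ levelCells (Nat.log 4 (3 * c + 1)) with κ c' = κ c, y c'

/-- The part of the model vector `y'` outside the selected cells is controlled by the noise.  The
induction is on the sum of this part and three times its restriction to the last level. -/
theorem sum_outside_model_le (κ : ℕ → ℕ) (val y y' : ℕ → ℝ) (d : ℕ) (hy' : ∀ c, 0 ≤ y' c) :
    ∀ L, (∀ j < L, ∀ c ∈ levelCells (d + j + 1), val c = bucketSum κ y c) →
    (∀ j < L, ∀ p ∈ levelCells (d + j),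
      2 * ∑ c ∈ levelCells (d + j + 1) with (c - 1) / 4 = p, y' c ≤ y' p) →
    (∀ j < L, 16 * ((levelCells (d + j + 1)).filter fun c => y' c ≠ 0).card ≤ 4 ^ d) →
    (∀ j < L, 16 * (collisions (fun _ => ()) κ
      (childList (levelState val (startState d) j).1).toFinset).card ≤ 4 ^ d) →
    ∑ c ∈ Finset.range (numCells (d + L)) \
        (outList val (startState d) (List.range (numCells d)) L).toFinset, y' c +
      3 * ∑ c ∈ levelCells (d + L) \ (levelState val (startState d) L).1.toFinset, y' c ≤
      6 * ∑ c ∈ Finset.range (numCells (d + L)), |y c - y' c|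
  | 0, _, _, _, _ => by
    have h1 : Finset.range (numCells (d + 0)) \
        (outList val (startState d) (List.range (numCells d)) 0).toFinset = ∅ := by
      rw [Finset.sdiff_eq_empty_iff_subset]
      intro c hc
      simpa [outList] using hc
    have h2 : levelCells (d + 0) \ (levelState val (startState d) 0).1.toFinset = ∅ := by
      rw [Finset.sdiff_eq_empty_iff_subset]
      intro c hc
      exact List.mem_toFinset.2 (mem_startState.2 hc)
    rw [h1, h2]
    have : 0 ≤ ∑ c ∈ Finset.range (numCells (d + 0)), |y c - y' c| :=
      Finset.sum_nonneg fun _ _ => abs_nonneg _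
    simpa using this
  | L + 1, hval, hmodel, hsupp, hcol => by
    have ih := sum_outside_model_le κ val y y' d hy' L (fun j hj => hval j (by omega))
      (fun j hj => hmodel j (by omega)) (fun j hj => hsupp j (by omega))
      (fun j hj => hcol j (by omega))
    obtain ⟨-, hsub, p, hdrop, hmany⟩ := levelStep_spec val (levelState val (startState d) L) d
      ((length_levelState _ _ L).trans (length_startState d)) (levelState_nodup val d L)
    set ks := (levelState val (startState d) L).1
    set ks' := (levelState val (startState d) (L + 1)).1
    set Q := outList val (startState d) (List.range (numCells d)) L
    have hCG : (childList ks).toFinset ⊆ levelCells (d + L + 1) := fun c hc =>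
      mem_childList_levelState (List.mem_toFinset.1 hc)
    have hest : ∀ c ∈ childList ks,
        ∑ c' ∈ levelCells (d + L + 1) with κ c' = κ c, y c' = val c := by
      intro c hc
      have hc' := mem_childList_levelState hc
      rw [hval L (by omega) c hc', bucketSum, log_of_mem_levelCells hc']
    have hstep := sum_dropped_le κ (levelCells (d + L + 1)) (childList ks).toFinset ks'.toFinset
      hCG y y' (fun c _ => hy' c) (s := ((levelCells (d + L + 1)).filter fun c => y' c ≠ 0).card)
      (X := 4 ^ d) le_rfl (hsupp L (by omega)) p ?_ ?_ (hcol L (by omega))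
    · have hhalf := two_mul_sum_children_le y' (d + L) ks (hmodel L (by omega)) hy'
      have hQ : Finset.range (numCells (d + (L + 1))) \ (outList val (startState d)
          (List.range (numCells d)) (L + 1)).toFinset =
          (Finset.range (numCells (d + L)) \ Q.toFinset) ∪
            (levelCells (d + L + 1) \ ks'.toFinset) := by
        rw [← add_assoc, range_numCells_succ, outList, List.toFinset_append]
        ext c
        have h1 : c ∈ Q → c ∉ levelCells (d + L + 1) := fun h => Finset.disjoint_left.1
          (disjoint_range_levelCells (d + L)) (Finset.mem_range.2 (mem_outList val d L c h))
        have h2 : c ∈ ks' → c ∉ Finset.range (numCells (d + L)) := fun h h' =>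
          Finset.disjoint_left.1 (disjoint_range_levelCells (d + L)) h'
            (mem_levelState val d (L + 1) c h)
        simp only [Finset.mem_sdiff, Finset.mem_union, List.mem_toFinset]
        tauto
      have hE : ∑ c ∈ Finset.range (numCells (d + (L + 1))), |y c - y' c| =
          ∑ c ∈ Finset.range (numCells (d + L)), |y c - y' c| +
            ∑ c ∈ levelCells (d + L + 1), |y c - y' c| := by
        rw [← add_assoc, range_numCells_succ,
          Finset.sum_union (disjoint_range_levelCells (d + L))]
      rw [hQ, Finset.sum_union, hE, ← add_assoc]
      · linarith
      · exact Finset.disjoint_of_subset_left Finset.sdiff_subset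
          (Finset.disjoint_of_subset_right Finset.sdiff_subset (disjoint_range_levelCells (d + L)))
    · intro c hc hno
      rw [List.mem_toFinset] at hc hno
      rw [hest c hc]
      exact hdrop c hc hno
    · refine hmany.trans_eq ?_
      congr 2
      refine Finset.filter_congr fun c hc => ?_
      rw [hest c (List.mem_toFinset.1 hc)]

/-- The descent finds all but a part of `y` that is controlled by its distance to the model. -/
theorem sum_outside_le (κ : ℕ → ℕ) (val y y' : ℕ → ℝ) (d L : ℕ) (hy' : ∀ c, 0 ≤ y' c)
    (hval : ∀ j < L, ∀ c ∈ levelCells (d + j + 1), val c = bucketSum κ y c)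
    (hmodel : ∀ j < L, ∀ p ∈ levelCells (d + j),
      2 * ∑ c ∈ levelCells (d + j + 1) with (c - 1) / 4 = p, y' c ≤ y' p)
    (hsupp : ∀ j < L, 16 * ((levelCells (d + j + 1)).filter fun c => y' c ≠ 0).card ≤ 4 ^ d)
    (hcol : ∀ j < L, 16 * (collisions (fun _ => ()) κ
      (childList (levelState val (startState d) j).1).toFinset).card ≤ 4 ^ d) :
    ∑ c ∈ Finset.range (numCells (d + L)) \
        (outList val (startState d) (List.range (numCells d)) L).toFinset, |y c| ≤
      7 * ∑ c ∈ Finset.range (numCells (d + L)), |y c - y' c| := by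
  have h1 := sum_outside_model_le κ val y y' d hy' L hval hmodel hsupp hcol
  have h2 : 0 ≤ ∑ c ∈ levelCells (d + L) \ (levelState val (startState d) L).1.toFinset, y' c :=
    Finset.sum_nonneg fun c _ => hy' c
  have h3 : ∑ c ∈ Finset.range (numCells (d + L)) \
        (outList val (startState d) (List.range (numCells d)) L).toFinset, |y c - y' c| ≤
      ∑ c ∈ Finset.range (numCells (d + L)), |y c - y' c| :=
    Finset.sum_le_sum_of_subset_of_nonneg Finset.sdiff_subset fun c _ _ => abs_nonneg _
  have h4 : ∑ c ∈ Finset.range (numCells (d + L)) \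
        (outList val (startState d) (List.range (numCells d)) L).toFinset, |y c| ≤
      ∑ c ∈ Finset.range (numCells (d + L)) \
        (outList val (startState d) (List.range (numCells d)) L).toFinset, y' c +
      ∑ c ∈ Finset.range (numCells (d + L)) \
        (outList val (startState d) (List.range (numCells d)) L).toFinset, |y c - y' c| := by
    rw [← Finset.sum_add_distrib]
    refine Finset.sum_le_sum fun c _ => ?_
    have := abs_add_le (y' c) (y c - y' c)
    rwa [add_sub_cancel, abs_of_nonneg (hy' c)] at this
  linarith

/-! ### The measurements -/

/-- The rows of the nonzero entries in the column of cell `c`.  The first one is in the hash table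
of size `B₁` for the depth of `c`, the others are in eight hash tables of size `B₂` for all
cells. -/
def hashRow (d L B₁ B₂ : ℕ) (κ : ℕ → ℕ) (η : ℕ × ℕ → ℕ) (c : ℕ) : ℕ → ℕ
  | 0 => (Nat.log 4 (3 * c + 1) - d) * B₁ + κ c
  | j + 1 => (L + 1) * B₁ + j * B₂ + η (c, j)

theorem mul_add_inj {B a b x y : ℕ} (hx : x < B) (hy : y < B) :
    a * B + x = b * B + y ↔ a = b ∧ x = y := by
  constructor
  · intro h
    have h1 : a = b := by
      have h2 := congrArg (· / B) h
      simpa [Nat.add_div_of_dvd_right, Nat.mul_div_cancel _ (by omega : 0 < B),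
        Nat.div_eq_of_lt hx, Nat.div_eq_of_lt hy] using h2
    subst h1
    exact ⟨rfl, by omega⟩
  · rintro ⟨rfl, rfl⟩; rfl

theorem log_le_of_lt_numCells {c l : ℕ} (h : c < numCells l) : Nat.log 4 (3 * c + 1) ≤ l := by
  have := three_mul_numCells l
  have h1 : 3 * c + 1 < 4 ^ (l + 1) := by rw [pow_succ]; omega
  exact Nat.lt_succ_iff.1 (Nat.log_lt_of_lt_pow (by omega) h1)

section HashRow

variable {d l B₁ B₂ : ℕ} {κ : ℕ → ℕ} {η : ℕ × ℕ → ℕ}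

theorem hashRow_zero_lt (hκ : ∀ c, κ c < B₁) {c : ℕ} (hc : c < numCells l) :
    hashRow d (l - d) B₁ B₂ κ η c 0 < (l - d + 1) * B₁ := by
  have h1 := log_le_of_lt_numCells hc
  have h2 := hκ c
  have h3 : (Nat.log 4 (3 * c + 1) - d) * B₁ ≤ (l - d) * B₁ := Nat.mul_le_mul_right _ (by omega)
  rw [hashRow, add_mul]
  omega

theorem hashRow_succ_inj (hη : ∀ x, η x < B₂) {L c c' j j' : ℕ} :
    hashRow d L B₁ B₂ κ η c (j + 1) = hashRow d L B₁ B₂ κ η c' (j' + 1) ↔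
      j = j' ∧ η (c, j) = η (c', j') := by
  rw [hashRow, hashRow, ← mul_add_inj (hη (c, j)) (hη (c', j'))]
  omega

theorem hashRow_succ_lt (hη : ∀ x, η x < B₂) {L c j : ℕ} (hj : j < 8) :
    hashRow d L B₁ B₂ κ η c (j + 1) < (L + 1) * B₁ + 8 * B₂ := by
  have h1 : j * B₂ ≤ 7 * B₂ := Nat.mul_le_mul_right _ (by omega)
  have := hη (c, j)
  rw [hashRow]
  omega

/-- The input consists of the measurements of `y` in the hash tables. -/
structure ReadsTables (I : SketchInput) (l d B₁ B₂ : ℕ) (κ : ℕ → ℕ) (η : ℕ × ℕ → ℕ)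
    (y : ℕ → ℝ) : Prop where
  hash_lt : ∀ c, κ c < B₁
  slot_lt : ∀ x, η x < B₂
  colRow : ∀ c < numCells l, ∀ j < 9, I.colRow c j = hashRow d (l - d) B₁ B₂ κ η c j
  meas : ∀ r < (l - d + 1) * B₁ + 8 * B₂, I.meas r = ∑ c ∈ Finset.range (numCells l),
    ∑ j ∈ Finset.range 9, if hashRow d (l - d) B₁ B₂ κ η c j = r then y c else 0

variable {I : SketchInput} {y : ℕ → ℝ} (hI : ReadsTables I l d B₁ B₂ κ η y)
include hI

theorem ReadsTables.cellVal_eq {j c : ℕ} (hj : d + j + 1 ≤ l) (hc : c ∈ levelCells (d + j + 1)) :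
    I.cellVal c = bucketSum κ y c := by
  have hlog := log_of_mem_levelCells hc
  have hcl : c < numCells l := Finset.mem_range.1 (levelCells_subset_range hj hc)
  have hlt := hashRow_zero_lt (d := d) (B₂ := B₂) (η := η) hI.hash_lt hcl
  rw [SketchInput.cellVal, hI.colRow c hcl 0 (by norm_num), hI.meas _ (by omega), bucketSum, hlog,
    ← Finset.sum_filter_add_sum_filter_not (Finset.range (numCells l)) (· ∈ levelCells (d + j + 1))]
  have hno : ∀ c', ∀ i ∈ Finset.range 8,
      (if hashRow d (l - d) B₁ B₂ κ η c' (i + 1) = hashRow d (l - d) B₁ B₂ κ η c 0 then y c' else 0)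
        = 0 := by
    intro c' i _
    rw [if_neg]
    have : (l - d + 1) * B₁ ≤ hashRow d (l - d) B₁ B₂ κ η c' (i + 1) := by
      conv_rhs => rw [hashRow]
      omega
    omega
  simp only [Finset.sum_range_succ' _ 8, Finset.sum_eq_zero (hno _), zero_add]
  have hiff : ∀ c', hashRow d (l - d) B₁ B₂ κ η c' 0 = hashRow d (l - d) B₁ B₂ κ η c 0 ↔
      c' ∈ levelCells (d + j + 1) ∧ κ c' = κ c := by
    intro c'
    rw [eq_comm, hashRow, hashRow, mul_add_inj (hI.hash_lt c) (hI.hash_lt c'), hlog,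
      eq_comm (a := κ c)]
    refine and_congr_left fun _ => ⟨fun h => ?_, fun h => by rw [log_of_mem_levelCells h]⟩
    have := mem_levelCells_log c'
    rwa [show Nat.log 4 (3 * c' + 1) = d + j + 1 by omega] at this
  have h2 : ∑ c' ∈ Finset.range (numCells l) with c' ∉ levelCells (d + j + 1),
      (if hashRow d (l - d) B₁ B₂ κ η c' 0 = hashRow d (l - d) B₁ B₂ κ η c 0 then y c' else 0)
        = 0 := by
    refine Finset.sum_eq_zero fun c' hc' => if_neg fun h => ?_
    exact (Finset.mem_filter.1 hc').2 ((hiff c').1 h).1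
  have h3 : (Finset.range (numCells l)).filter (· ∈ levelCells (d + j + 1)) =
      levelCells (d + j + 1) := by
    ext c'
    rw [Finset.mem_filter]
    exact ⟨fun h => h.2, fun h => ⟨levelCells_subset_range hj h, h⟩⟩
  rw [h2, add_zero, h3, Finset.sum_filter]
  refine Finset.sum_congr rfl fun c' hc' => ?_
  congr 1
  rw [hiff]
  simp [hc']

/-- If for every set of selected cells the number of repeats in the eight tables is less than twice
the size of the set, then in every set of items there is one with five isolated rows. -/
theorem ReadsTables.exists_isolated {q : ℕ} {cell : ℕ → ℕ} (hlt : ∀ i < q, cell i < numCells l)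
    (hinj : ∀ i < q, ∀ i' < q, cell i = cell i' → i = i')
    (hrep : ∀ U ⊆ (Finset.range q).image cell, U.Nonempty →
      (repeats Prod.fst Prod.snd η (U ×ˢ Finset.range 8)).card < 2 * U.card)
    (W : Finset ℕ) (hW : W ⊆ Finset.range q) (hne : W.Nonempty) :
    ∃ i ∈ W, 5 ≤ (isoSlots (itemRow I cell) W i).card := by
  have hWq : ∀ i ∈ W, i < q := fun i hi => Finset.mem_range.1 (hW hi)
  have hcard : (W.image cell).card = W.card := Finset.card_image_of_injOn fun i hi i' hi' h =>
    hinj i (hWq i hi) i' (hWq i' hi') h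
  have h1 := hrep (W.image cell) (Finset.image_subset_image hW) (hne.image cell)
  have h2 := card_collisions_le Prod.fst Prod.snd η (W.image cell ×ˢ Finset.range 8)
    fun x y h h' => Prod.ext h' h
  by_contra! hno
  have hrow : ∀ i ∈ W, ∀ j < 8, itemRow I cell i j =
      hashRow d (l - d) B₁ B₂ κ η (cell i) (j + 1) := fun i hi j hj =>
    hI.colRow _ (hlt i (hWq i hi)) _ (by omega)
  -- the slots of an item that are not isolated collide
  have h3 : (W.sigma fun i => Finset.range 8 \ isoSlots (itemRow I cell) W i).card ≤
      (collisions Prod.snd η (W.image cell ×ˢ Finset.range 8)).card := by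
    refine Finset.card_le_card_of_injOn (fun x => (cell x.1, x.2)) ?_ ?_
    · rintro ⟨i, j⟩ hx
      simp only [Finset.coe_sigma, Set.mem_sigma_iff, Finset.mem_coe, Finset.mem_sdiff,
        Finset.mem_range, isoSlots, Finset.mem_filter, not_and] at hx
      obtain ⟨hi, hj, hiso⟩ := hx
      have hmem : (i, j) ∈ inRow (itemRow I cell) (slots W) (itemRow I cell i j) :=
        mem_inRow.2 ⟨mem_slots.2 ⟨hi, hj⟩, rfl⟩
      obtain ⟨x, hx, hxne⟩ : ∃ x ∈ inRow (itemRow I cell) (slots W) (itemRow I cell i j),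
          x ≠ (i, j) := by
        by_contra! hall
        exact hiso hj (Finset.card_eq_one.2 ⟨(i, j), Finset.eq_singleton_iff_unique_mem.2
          ⟨hmem, hall⟩⟩)
      rw [mem_inRow, mem_slots] at hx
      obtain ⟨⟨hx1, hx2⟩, hx3⟩ := hx
      rw [hrow _ hx1 _ hx2, hrow _ hi _ hj, hashRow_succ_inj hI.slot_lt] at hx3
      simp only [collisions, Finset.coe_filter, Set.mem_ofPred_eq, Finset.mem_product,
        Finset.mem_range, Finset.mem_image]
      refine ⟨⟨⟨i, hi, rfl⟩, hj⟩, (cell x.1, x.2), ⟨⟨x.1, hx1, rfl⟩, hx2⟩, ?_, hx3.1, hx3.2⟩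
      intro h
      rw [Prod.mk.injEq] at h
      exact hxne (Prod.ext (hinj _ (hWq _ hx1) _ (hWq _ hi) h.1) h.2)
    · rintro ⟨i, j⟩ hx ⟨i', j'⟩ hx' h
      simp only [Finset.coe_sigma, Set.mem_sigma_iff, Finset.mem_coe] at hx hx'
      simp only [Prod.mk.injEq] at h
      obtain rfl := hinj i (hWq i hx.1) i' (hWq i' hx'.1) h.1
      rw [h.2]
  have h4 : 4 * W.card ≤
      (W.sigma fun i => Finset.range 8 \ isoSlots (itemRow I cell) W i).card := by
    rw [Finset.card_sigma, mul_comm, ← smul_eq_mul]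
    refine Finset.card_nsmul_le_sum _ _ _ fun i hi => ?_
    have h5 := Finset.le_card_sdiff (isoSlots (itemRow I cell) W i) (Finset.range 8)
    have h6 := hno i hi
    rw [Finset.card_range] at h5
    omega
  omega

/-- The noise in the eight tables comes from the cells that are not selected, each of which
contributes to eight rows. -/
theorem ReadsTables.noise_le {q : ℕ} {cell : ℕ → ℕ} (hlt : ∀ i < q, cell i < numCells l)
    (hinj : ∀ i < q, ∀ i' < q, cell i = cell i' → i = i') :
    ∑ r ∈ Finset.Ico ((l - d + 1) * B₁) ((l - d + 1) * B₁ + 8 * B₂),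
      |I.meas r - ∑ x ∈ inRow (itemRow I cell) (slots (Finset.range q)) r, y (cell x.1)| ≤
      8 * ∑ c ∈ Finset.range (numCells l) \ (Finset.range q).image cell, |y c| := by
  set Q := (Finset.range q).image cell with hQ
  have hQsub : Q ⊆ Finset.range (numCells l) := by
    intro c hc
    obtain ⟨i, hi, rfl⟩ := Finset.mem_image.1 hc
    exact Finset.mem_range.2 (hlt i (Finset.mem_range.1 hi))
  let ρ := hashRow d (l - d) B₁ B₂ κ η
  have hrow : ∀ r ∈ Finset.Ico ((l - d + 1) * B₁) ((l - d + 1) * B₁ + 8 * B₂),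
      I.meas r - ∑ x ∈ inRow (itemRow I cell) (slots (Finset.range q)) r, y (cell x.1) =
      ∑ c ∈ Finset.range (numCells l) \ Q, ∑ j ∈ Finset.range 8,
        if ρ c (j + 1) = r then y c else 0 := by
    intro r hr
    rw [Finset.mem_Ico] at hr
    have h1 : I.meas r = ∑ c ∈ Finset.range (numCells l), ∑ j ∈ Finset.range 8,
        if ρ c (j + 1) = r then y c else 0 := by
      rw [hI.meas r hr.2]
      refine Finset.sum_congr rfl fun c hc => ?_
      have := hashRow_zero_lt (d := d) (B₂ := B₂) (η := η) hI.hash_lt (Finset.mem_range.1 hc)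
      rw [Finset.sum_range_succ', if_neg (by omega), add_zero]
    have h2 : ∑ x ∈ inRow (itemRow I cell) (slots (Finset.range q)) r, y (cell x.1) =
        ∑ c ∈ Q, ∑ j ∈ Finset.range 8, if ρ c (j + 1) = r then y c else 0 := by
      rw [hQ, Finset.sum_image fun i hi i' hi' h =>
        hinj i (Finset.mem_range.1 hi) i' (Finset.mem_range.1 hi') h, inRow, Finset.sum_filter,
        slots, Finset.sum_product]
      refine Finset.sum_congr rfl fun i hi => Finset.sum_congr rfl fun j hj => ?_
      rw [itemRow, hI.colRow _ (hlt i (Finset.mem_range.1 hi)) _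
        (by have := Finset.mem_range.1 hj; omega)]
    rw [h1, h2, ← Finset.sum_sdiff hQsub]
    ring
  calc _ ≤ ∑ r ∈ Finset.Ico ((l - d + 1) * B₁) ((l - d + 1) * B₁ + 8 * B₂),
        ∑ c ∈ Finset.range (numCells l) \ Q, ∑ j ∈ Finset.range 8,
          if ρ c (j + 1) = r then |y c| else 0 := by
        refine Finset.sum_le_sum fun r hr => ?_
        rw [hrow r hr]
        refine (Finset.abs_sum_le_sum_abs _ _).trans (Finset.sum_le_sum fun c _ => ?_)
        refine (Finset.abs_sum_le_sum_abs _ _).trans (Finset.sum_le_sum fun j _ => ?_)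
        split_ifs <;> simp
    _ = ∑ c ∈ Finset.range (numCells l) \ Q, ∑ j ∈ Finset.range 8,
        ∑ r ∈ Finset.Ico ((l - d + 1) * B₁) ((l - d + 1) * B₁ + 8 * B₂),
          if ρ c (j + 1) = r then |y c| else 0 := by
        rw [Finset.sum_comm]
        exact Finset.sum_congr rfl fun c _ => Finset.sum_comm
    _ ≤ ∑ c ∈ Finset.range (numCells l) \ Q, ∑ j ∈ Finset.range 8, |y c| := by
        refine Finset.sum_le_sum fun c _ => Finset.sum_le_sum fun j _ => ?_
        rw [Finset.sum_ite_eq]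
        split_ifs
        · exact le_rfl
        · exact abs_nonneg _
    _ = _ := by simp [Finset.mul_sum]

/-- The total error of the output, in terms of the mass of the cells that are not selected. -/
theorem ReadsTables.output_error_le {q : ℕ} {cell : ℕ → ℕ} (hlt : ∀ i < q, cell i < numCells l)
    (hinj : ∀ i < q, ∀ i' < q, cell i = cell i' → i = i') {U : Finset ℕ} {val : ℕ → ℝ}
    (hpeel : Peel (itemRow I cell) I.meas q U val)
    (hlast : ∀ i ∈ U, (isoSlots (itemRow I cell) U i).card < 5)
    (hrep : ∀ U ⊆ (Finset.range q).image cell, U.Nonempty →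
      (repeats Prod.fst Prod.snd η (U ×ˢ Finset.range 8)).card < 2 * U.card) :
    ∑ c ∈ Finset.range (numCells l),
      |(∑ i ∈ Finset.range q, if cell i = c then val i else 0) - y c| ≤
      5 * ∑ c ∈ Finset.range (numCells l) \ (Finset.range q).image cell, |y c| := by
  have hrow : ∀ i < q, ∀ j < 8, itemRow I cell i j =
      hashRow d (l - d) B₁ B₂ κ η (cell i) (j + 1) := fun i hi j hj =>
    hI.colRow _ (hlt i hi) _ (by omega)
  have h1 := hpeel.total_error_le (z := fun i => y (cell i))
    (R := Finset.Ico ((l - d + 1) * B₁) ((l - d + 1) * B₁ + 8 * B₂))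
    (fun i hi j hj j' hj' h => by
      rw [hrow i hi j hj, hrow i hi j' hj', hashRow_succ_inj hI.slot_lt] at h
      exact h.1)
    (fun i hi j hj => by
      rw [hrow i hi j hj, Finset.mem_Ico]
      refine ⟨?_, hashRow_succ_lt hI.slot_lt hj⟩
      rw [hashRow]; omega)
    hlast (hI.exists_isolated hlt hinj hrep)
  have h2 := hI.noise_le hlt hinj
  set Q := (Finset.range q).image cell with hQ
  have hQsub : Q ⊆ Finset.range (numCells l) := by
    intro c hc
    obtain ⟨i, hi, rfl⟩ := Finset.mem_image.1 hc
    exact Finset.mem_range.2 (hlt i (Finset.mem_range.1 hi))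
  have h3 : ∑ c ∈ Q, |(∑ i ∈ Finset.range q, if cell i = c then val i else 0) - y c| =
      ∑ i ∈ Finset.range q, |val i - y (cell i)| := by
    rw [hQ, Finset.sum_image fun i hi i' hi' h =>
        hinj i (Finset.mem_range.1 hi) i' (Finset.mem_range.1 hi') h]
    refine Finset.sum_congr rfl fun i hi => ?_
    rw [Finset.sum_eq_single_of_mem i hi, if_pos rfl]
    intro i' hi' hne
    exact if_neg fun h => hne (hinj i' (Finset.mem_range.1 hi') i (Finset.mem_range.1 hi) h)
  have h4 : ∑ c ∈ Finset.range (numCells l) \ Q,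
      |(∑ i ∈ Finset.range q, if cell i = c then val i else 0) - y c| =
      ∑ c ∈ Finset.range (numCells l) \ Q, |y c| := by
    refine Finset.sum_congr rfl fun c hc => ?_
    rw [Finset.sum_eq_zero, zero_sub, abs_neg]
    intro i hi
    refine if_neg fun h => (Finset.mem_sdiff.1 hc).2 ?_
    rw [← h]
    exact Finset.mem_image_of_mem cell hi
  rw [← Finset.sum_sdiff hQsub, h3, h4]
  linarith

end HashRow

/-- The function `f` on `{0, …, t - 1}`, extended by zero. -/
def zeroExtend {α : Type*} [Zero α] {t : ℕ} (f : Fin t → α) (c : ℕ) : α :=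
  if h : c < t then f ⟨c, h⟩ else 0

theorem zeroExtend_val {α : Type*} [Zero α] {t : ℕ} (f : Fin t → α) (c : Fin t) :
    zeroExtend f c = f c := by simp [zeroExtend]

/-- The matrix with entries `1` in the rows `ρ c 0, …, ρ c (w - 1)` of each column `c` and zeros
elsewhere. -/
noncomputable def columnMatrix (m : ℕ) {t : ℕ} (w : ℕ) (ρ : ℕ → ℕ → ℕ) :
    Matrix (Fin m) (Fin t) ℝ :=
  fun i c => if ∃ j < w, ρ c j = i then 1 else 0

section ColumnMatrix

variable {m t w : ℕ} {ρ : ℕ → ℕ → ℕ} (hlt : ∀ c < t, ∀ j < w, ρ c j < m)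
  (hmono : ∀ c < t, ∀ i j, i < j → j < w → ρ c i < ρ c j)
include hlt hmono

theorem columnRows_columnMatrix (c : Fin t) :
    columnRows (columnMatrix m w ρ) c =
      List.ofFn fun j : Fin w => (⟨ρ c j, hlt c c.2 j j.2⟩ : Fin m) := by
  have hs : StrictMono fun j : Fin w => (⟨ρ c j, hlt c c.2 j j.2⟩ : Fin m) := fun i j hij =>
    hmono c c.2 i j hij j.2
  have hset : (Finset.univ.filter fun i => columnMatrix m w ρ i c ≠ 0) =
      (List.ofFn fun j : Fin w => (⟨ρ c j, hlt c c.2 j j.2⟩ : Fin m)).toFinset := by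
    ext i
    simp only [columnMatrix, Finset.mem_filter, Finset.mem_univ, true_and, List.mem_toFinset,
      List.mem_ofFn, ne_eq, ite_eq_right_iff, one_ne_zero, imp_false, not_not]
    constructor
    · rintro ⟨j, hj, h⟩; exact ⟨⟨j, hj⟩, Fin.ext h⟩
    · rintro ⟨j, rfl⟩; exact ⟨j, j.2, rfl⟩
  rw [columnRows, hset]
  have h1 := List.sortedLT_ofFn_iff.2 hs
  exact (List.toFinset_sort _ h1.nodup).2 h1.sortedLE.pairwise

theorem colRow_sketchInput (b : Fin m → ℝ) {c j : ℕ} (hc : c < t) (hj : j < w) :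
    (sketchInput (columnMatrix m w ρ : Matrix (Fin m) (Fin t) ℝ) b).colRow c j = ρ c j := by
  simp only [sketchInput, hc, dif_pos, columnRows_columnMatrix hlt hmono ⟨c, hc⟩]
  rw [List.getElem?_eq_getElem (by simpa using hj)]
  simp

omit hlt in
theorem meas_sketchInput (y : Fin t → ℝ) {r : ℕ} (hr : r < m) :
    (sketchInput (columnMatrix m w ρ : Matrix (Fin m) (Fin t) ℝ)
      ((columnMatrix m w ρ).mulVec y)).meas r =
      ∑ c ∈ Finset.range t, ∑ j ∈ Finset.range w, if ρ c j = r then zeroExtend y c else 0 := by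
  simp only [sketchInput, hr, dif_pos, Matrix.mulVec, dotProduct]
  rw [← Fin.sum_univ_eq_sum_range (fun c => ∑ j ∈ Finset.range w,
    if ρ c j = r then zeroExtend y c else 0)]
  refine Finset.sum_congr rfl fun c _ => ?_
  rw [zeroExtend_val, columnMatrix]
  split_ifs with h
  · obtain ⟨j, hj, hjr⟩ := h
    rw [Finset.sum_eq_single_of_mem j (Finset.mem_range.2 hj), if_pos hjr, one_mul]
    intro i hi hne
    refine if_neg fun h => ?_
    have hi := Finset.mem_range.1 hi
    rcases lt_or_gt_of_ne hne with h' | h'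
    · have := hmono c c.2 i j h' hj
      simp only at hjr; omega
    · have := hmono c c.2 j i h' hi
      simp only at hjr; omega
  · rw [zero_mul, Finset.sum_eq_zero]
    intro j hj
    exact if_neg fun h' => h ⟨j, Finset.mem_range.1 hj, h'⟩

end ColumnMatrix

/-- The numbers of rows of the matrix. -/
def numRows (l d B₁ B₂ : ℕ) : ℕ := (l - d + 1) * B₁ + 8 * B₂

/-- A choice of all hash functions: one that is used at each depth, and eight that are used for
all cells. -/
abbrev Hashes (l B₁ B₂ : ℕ) : Type := (Cell l → Fin B₁) × (Cell l × Fin 8 → Fin B₂)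

/-- The hash function for the estimates at each depth. -/
def levelHash {l B₁ : ℕ} (h : Cell l → Fin B₁) : ℕ → ℕ := zeroExtend fun c => (h c : ℕ)

/-- The hash functions of the eight tables. -/
def tableHash {l B₂ : ℕ} (h : Cell l × Fin 8 → Fin B₂) (x : ℕ × ℕ) : ℕ :=
  if hx : x.1 < numCells l ∧ x.2 < 8 then h (⟨x.1, hx.1⟩, ⟨x.2, hx.2⟩) else 0

/-- The measurement matrix. -/
noncomputable def hashMatrix (l d B₁ B₂ : ℕ) (ω : Hashes l B₁ B₂) :
    Matrix (Fin (numRows l d B₁ B₂)) (Cell l) ℝ :=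
  columnMatrix _ 9 (hashRow d (l - d) B₁ B₂ (levelHash ω.1) (tableHash ω.2))

theorem levelHash_lt {l B₁ : ℕ} (hB : 0 < B₁) (h : Cell l → Fin B₁) (c : ℕ) :
    levelHash h c < B₁ := by
  rw [levelHash, zeroExtend]; split_ifs <;> omega

theorem tableHash_lt {l B₂ : ℕ} (hB : 0 < B₂) (h : Cell l × Fin 8 → Fin B₂) (x : ℕ × ℕ) :
    tableHash h x < B₂ := by
  rw [tableHash]; split_ifs <;> omega

theorem readsTables_sketchInput {l d B₁ B₂ : ℕ} (hB₁ : 0 < B₁) (hB₂ : 0 < B₂)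
    (ω : Hashes l B₁ B₂) (y : Cell l → ℝ) :
    ReadsTables (sketchInput (hashMatrix l d B₁ B₂ ω) ((hashMatrix l d B₁ B₂ ω).mulVec y)) l d B₁ B₂
      (levelHash ω.1) (tableHash ω.2) (zeroExtend y) := by
  have h1 := levelHash_lt hB₁ ω.1
  have h2 := tableHash_lt hB₂ ω.2
  have hlt : ∀ c < numCells l, ∀ j < 9,
      hashRow d (l - d) B₁ B₂ (levelHash ω.1) (tableHash ω.2) c j < numRows l d B₁ B₂ := by
    rintro c hc (_ | j) hj
    · have := hashRow_zero_lt (d := d) (B₂ := B₂) (η := tableHash ω.2) h1 hc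
      rw [numRows]; omega
    · exact hashRow_succ_lt h2 (by omega)
  have hmono : ∀ c < numCells l, ∀ i j, i < j → j < 9 →
      hashRow d (l - d) B₁ B₂ (levelHash ω.1) (tableHash ω.2) c i <
      hashRow d (l - d) B₁ B₂ (levelHash ω.1) (tableHash ω.2) c j := by
    rintro c hc (_ | i) (_ | j) hij hj
    · omega
    · have := hashRow_zero_lt (d := d) (B₂ := B₂) (η := tableHash ω.2) h1 hc
      refine this.trans_le ?_
      rw [hashRow]; omega
    · omega
    · have h3 := h2 (c, i)
      have h4 : (i + 1) * B₂ ≤ j * B₂ := Nat.mul_le_mul_right _ (by omega)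
      rw [add_mul] at h4
      rw [hashRow, hashRow]
      omega
  exact ⟨h1, h2, fun c hc j hj => colRow_sketchInput hlt hmono _ hc hj,
    fun r hr => meas_sketchInput hmono y hr⟩

/-! ### The probability of failure -/

section Transfer

variable {D D' β β' τ τ' : Type*} [DecidableEq τ] [DecidableEq β] [DecidableEq D']
  [DecidableEq τ'] [DecidableEq β']

theorem card_repeats_image {e : D → D'} (he : Function.Injective e) {ord : D → ℕ} {ord' : D' → ℕ}
    {κ : D → τ} {κ' : D' → τ'} {h : D → β} {h' : D' → β'} (hord : ∀ x, ord' (e x) = ord x)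
    (hκ : ∀ x y, κ' (e y) = κ' (e x) ↔ κ y = κ x) (hh : ∀ x y, h' (e y) = h' (e x) ↔ h y = h x)
    (U : Finset D) :
    (repeats ord' κ' h' (U.image e)).card = (repeats ord κ h U).card := by
  rw [← Finset.card_image_of_injective _ he]
  congr 1
  ext x
  simp only [repeats, Finset.mem_filter, Finset.mem_image]
  constructor
  · rintro ⟨⟨a, ha, rfl⟩, _, ⟨b, hb, rfl⟩, h1, h2, h3⟩
    exact ⟨a, ⟨ha, b, hb, by rwa [hord, hord] at h1, (hκ a b).1 h2, (hh a b).1 h3⟩, rfl⟩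
  · rintro ⟨a, ⟨ha, b, hb, h1, h2, h3⟩, rfl⟩
    exact ⟨⟨a, ha, rfl⟩, _, ⟨b, hb, rfl⟩, by rwa [hord, hord], (hκ a b).2 h2, (hh a b).2 h3⟩

end Transfer

/-- The candidates in the step of the descent from depth `d + j`. -/
noncomputable def candidates (d : ℕ) (κ : ℕ → ℕ) (y : ℕ → ℝ) (j : ℕ) : Finset ℕ :=
  (childList (levelState (bucketSum κ y) (startState d) j).1).toFinset

/-- The cells that are selected in a descent of `L` steps from depth `d`. -/
noncomputable def selected (d L : ℕ) (κ : ℕ → ℕ) (y : ℕ → ℝ) : Finset ℕ :=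
  (outList (bucketSum κ y) (startState d) (List.range (numCells d)) L).toFinset

theorem candidates_subset (d : ℕ) (κ : ℕ → ℕ) (y : ℕ → ℝ) (j : ℕ) :
    candidates d κ y j ⊆ levelCells (d + j + 1) := fun _ hc =>
  mem_childList_levelState (List.mem_toFinset.1 hc)

theorem card_candidates_le (d : ℕ) (κ : ℕ → ℕ) (y : ℕ → ℝ) (j : ℕ) :
    (candidates d κ y j).card ≤ 4 * 4 ^ d := by
  refine (List.toFinset_card_le _).trans ?_
  rw [length_childList, length_levelState, length_startState]

theorem candidates_congr {d : ℕ} {κ κ' : ℕ → ℕ} (y : ℕ → ℝ) {j : ℕ}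
    (h : ∀ c ∉ levelCells (d + j + 1), κ c = κ' c) :
    candidates d κ y j = candidates d κ' y j := by
  rw [candidates, candidates, levelState_congr (val := bucketSum κ y) (val' := bucketSum κ' y)]
  intro i hi c hc
  have hc' := mem_childList_levelState hc
  have hne : ∀ c ∈ levelCells (d + i + 1), κ c = κ' c := fun c hc => h c fun hc'' => by
    have := (log_of_mem_levelCells hc).symm.trans (log_of_mem_levelCells hc'')
    omega
  rw [bucketSum, bucketSum, log_of_mem_levelCells hc']
  refine Finset.sum_congr (Finset.filter_congr fun x hx => ?_) fun _ _ => rfl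
  rw [hne x hx, hne c hc']

theorem card_selected (d L : ℕ) (κ : ℕ → ℕ) (y : ℕ → ℝ) :
    (selected d L κ y).card = numCells d + L * 4 ^ d := by
  rw [selected, List.toFinset_card_of_nodup (outList_nodup _ _ _)]
  induction L with
  | zero => simp [outList]
  | succ L ih =>
    rw [outList, List.length_append, ih, length_levelState, length_startState]
    ring

theorem selected_subset (d L : ℕ) (κ : ℕ → ℕ) (y : ℕ → ℝ) :
    selected d L κ y ⊆ Finset.range (numCells (d + L)) := fun c hc =>
  Finset.mem_range.2 (mem_outList _ _ _ c (List.mem_toFinset.1 hc))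

/-- The cells whose numbers are in a given set. -/
def cellsOf (l : ℕ) (U : Finset ℕ) : Finset (Cell l) := Finset.univ.filter fun c => (c : ℕ) ∈ U

theorem image_cellsOf {l : ℕ} {U : Finset ℕ} (h : U ⊆ Finset.range (numCells l)) :
    (cellsOf l U).image Fin.val = U := by
  ext c
  simp only [cellsOf, Finset.mem_image, Finset.mem_filter, Finset.mem_univ, true_and]
  constructor
  · rintro ⟨x, hx, rfl⟩; exact hx
  · intro hc; exact ⟨⟨c, Finset.mem_range.1 (h hc)⟩, hc, rfl⟩

theorem card_cellsOf {l : ℕ} {U : Finset ℕ} (h : U ⊆ Finset.range (numCells l)) :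
    (cellsOf l U).card = U.card := by
  conv_rhs => rw [← image_cellsOf h]
  exact (Finset.card_image_of_injective _ Fin.val_injective).symm

theorem card_repeats_levelHash {l B : ℕ} (h : Cell l → Fin B) {U : Finset ℕ}
    (hU : U ⊆ Finset.range (numCells l)) :
    (repeats id (fun _ => ()) (levelHash h) U).card =
      (repeats (fun c : Cell l => (c : ℕ)) (fun _ => ()) h (cellsOf l U)).card := by
  conv_lhs => rw [← image_cellsOf hU]
  refine card_repeats_image Fin.val_injective (fun _ => rfl) (κ := fun _ => ())
    (fun _ _ => Iff.rfl) (fun x y => ?_) _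
  rw [levelHash, zeroExtend_val, zeroExtend_val]
  exact Fin.val_inj

theorem card_repeats_tableHash {l B : ℕ} (h : Cell l × Fin 8 → Fin B) {U : Finset ℕ}
    (hU : U ⊆ Finset.range (numCells l)) :
    (repeats Prod.fst Prod.snd (tableHash h) (U ×ˢ Finset.range 8)).card =
      (repeats (fun x : Cell l × Fin 8 => (x.1 : ℕ)) Prod.snd h
        (cellsOf l U ×ˢ Finset.univ)).card := by
  have he : U ×ˢ Finset.range 8 = (cellsOf l U ×ˢ (Finset.univ : Finset (Fin 8))).image
      (Prod.map Fin.val Fin.val) := by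
    rw [Finset.prodMap_image_product, image_cellsOf hU]
    rfl
  rw [he]
  refine card_repeats_image (Fin.val_injective.prodMap Fin.val_injective) (fun _ => rfl)
    (κ := Prod.snd)
    (fun x y => Fin.val_inj) (fun x y => ?_) _
  simp only [tableHash, Prod.map, x.1.2, x.2.2, y.1.2, y.2.2, and_self, dif_pos, Fin.eta,
    Prod.mk.eta]
  exact Fin.val_inj

/-- The candidates depend only on the hash values at smaller depths, and their number is
proportional to the size of the table, so many repeats are unlikely.  As there are
`4 * 4 ^ d = 128z` candidates, the factor `2 ^ 131` outweighs the `2 ^ (128z)` sets of positions. -/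
theorem card_level_failure_le {l d j z : ℕ} (y : ℕ → ℝ) (hj : d + j + 1 ≤ l)
    (hz : 4 ^ d = 32 * z) :
    (Finset.univ.filter fun h : Cell l → Fin (2 ^ 131 * 4 ^ d) =>
      z ≤ (repeats id (fun _ => ()) (levelHash h) (candidates d (levelHash h) y j)).card).card *
      2 ^ z ≤ (2 ^ 131 * 4 ^ d) ^ numCells l := by
  have hsub : ∀ κ, candidates d κ y j ⊆ Finset.range (numCells l) := fun κ =>
    (candidates_subset d κ y j).trans (levelCells_subset_range hj)
  have h1 := card_many_repeats_adaptive_le (β := Fin (2 ^ 131 * 4 ^ d)) (fun c : Cell l => (c : ℕ))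
    (fun _ => ()) (cellsOf l (levelCells (d + j + 1)))
    (fun h => cellsOf l (candidates d (levelHash h) y j))
    (fun h c hc => by
      simp only [cellsOf, Finset.mem_filter, Finset.mem_univ, true_and] at hc ⊢
      exact candidates_subset _ _ _ _ hc)
    (fun h h' hh => by
      rw [candidates_congr]
      intro c hc
      rw [levelHash, levelHash, zeroExtend, zeroExtend]
      split_ifs with hlt
      · rw [hh ⟨c, hlt⟩]
        simpa [cellsOf] using hc
      · rfl)
    (4 * 4 ^ d) z
    (fun h => by rw [card_cellsOf (hsub _)]; exact card_candidates_le _ _ _ _)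
  simp only [Fintype.card_fin] at h1
  simp only [card_repeats_levelHash _ (hsub _)]
  have hzN : z ≤ numCells l := by
    have h2 := pow_le_numCells l
    have h3 : 4 ^ d ≤ 4 ^ l := Nat.pow_le_pow_right (by norm_num) (by omega)
    omega
  have h4 : (4 * 4 ^ d).choose z ≤ (2 ^ 128) ^ z := by
    refine (Nat.choose_le_two_pow _ _).trans_eq ?_
    rw [← pow_mul, hz]
    congr 1
    ring
  refine (Nat.mul_le_mul_right _ h1).trans ?_
  calc (4 * 4 ^ d).choose z * (4 * 4 ^ d) ^ z * (2 ^ 131 * 4 ^ d) ^ (numCells l - z) * 2 ^ z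
      ≤ (2 ^ 128) ^ z * (4 * 4 ^ d) ^ z * (2 ^ 131 * 4 ^ d) ^ (numCells l - z) * 2 ^ z := by gcongr
    _ = (2 ^ 131 * 4 ^ d) ^ z * (2 ^ 131 * 4 ^ d) ^ (numCells l - z) := by
        have : (2 ^ 131 * 4 ^ d) ^ z = (2 ^ 128) ^ z * (4 * 4 ^ d) ^ z * 2 ^ z := by
          rw [← mul_pow, ← mul_pow]
          congr 1
          ring
        rw [this]; ring
    _ = _ := by rw [← pow_add]; congr 1; omega

/-- A union bound over the sets of selected cells. -/
theorem card_table_failure_le {l q : ℕ} (hq : 1 ≤ q) (Q : Finset (Cell l)) (hQ : Q.card = q) :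
    ((Finset.univ.filter fun h : Cell l × Fin 8 → Fin (128 * q) => ∃ U ⊆ Q, U.Nonempty ∧
      2 * U.card ≤ (repeats (fun x => (x.1 : ℕ)) Prod.snd h (U ×ˢ Finset.univ)).card).card : ℝ) ≤
      1 / (2 * q) * (128 * q) ^ (numCells l * 8) := by
  have hqN : q ≤ numCells l := by
    rw [← hQ]; exact (Finset.card_le_univ Q).trans_eq (Fintype.card_fin _)
  let F : Finset (Cell l) → Finset (Cell l × Fin 8 → Fin (128 * q)) := fun U =>
    Finset.univ.filter fun h =>
      2 * U.card ≤ (repeats (fun x => (x.1 : ℕ)) Prod.snd h (U ×ˢ Finset.univ)).card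
  have hsub : (Finset.univ.filter fun h : Cell l × Fin 8 → Fin (128 * q) => ∃ U ⊆ Q, U.Nonempty ∧
      2 * U.card ≤ (repeats (fun x => (x.1 : ℕ)) Prod.snd h (U ×ˢ Finset.univ)).card) ⊆
      (Finset.Icc 1 q).biUnion fun u => (Finset.powersetCard u Q).biUnion F := by
    intro h hh
    obtain ⟨U, hU, hne, hrep⟩ := (Finset.mem_filter.1 hh).2
    refine Finset.mem_biUnion.2 ⟨U.card, Finset.mem_Icc.2 ⟨hne.card_pos, ?_⟩,
      Finset.mem_biUnion.2 ⟨U, Finset.mem_powersetCard.2 ⟨hU, rfl⟩,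
        Finset.mem_filter.2 ⟨Finset.mem_univ _, hrep⟩⟩⟩
    rw [← hQ]
    exact Finset.card_le_card hU
  have hF : ∀ u, ∀ U ∈ Finset.powersetCard u Q, (F U).card ≤
      (8 * u).choose (2 * u) * u ^ (2 * u) * (128 * q) ^ (numCells l * 8 - 2 * u) := by
    intro u U hU
    have hcard := (Finset.mem_powersetCard.1 hU).2
    have h0 : 0 < 128 * q := by omega
    have := card_many_repeats_le (β := Fin (128 * q)) (fun x : Cell l × Fin 8 => (x.1 : ℕ)) Prod.snd
      (fun _ => ⟨0, h0⟩) Finset.univ (U ×ˢ Finset.univ) (Finset.subset_univ _) u (2 * u) ?_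
    · simp only [Finset.mem_univ, not_true_eq_false, false_imp_iff, implies_true, true_and,
        Finset.card_product, hcard, Finset.card_univ, Fintype.card_prod, Fintype.card_fin] at this
      simp only [F, hcard]
      rwa [mul_comm 8 u]
    · rintro ⟨c, j⟩ _
      rw [← hcard]
      refine Finset.card_le_card_of_injOn Prod.fst ?_ ?_
      · rintro ⟨a, b⟩ hx
        simp only [Finset.coe_filter, Set.mem_ofPred_eq, Finset.mem_product] at hx
        exact hx.1.1
      · rintro ⟨a, b⟩ hx ⟨a', b'⟩ hx' h
        simp only [Finset.coe_filter, Set.mem_ofPred_eq] at hx hx'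
        exact Prod.ext h (hx.2.trans hx'.2.symm)
  have hq0 : (0 : ℝ) < q := by exact_mod_cast hq
  have hterm : ∀ u ∈ Finset.Icc 1 q, (((Finset.powersetCard u Q).biUnion F).card : ℝ) ≤
      1 / q * (1 / 4) ^ u * (128 * q) ^ (numCells l * 8) := by
    intro u hu
    rw [Finset.mem_Icc] at hu
    have h1 : ((Finset.powersetCard u Q).biUnion F).card ≤ q.choose u *
        ((8 * u).choose (2 * u) * u ^ (2 * u) * (128 * q) ^ (numCells l * 8 - 2 * u)) := by
      refine Finset.card_biUnion_le.trans ((Finset.sum_le_card_nsmul _ _ _ (hF u)).trans_eq ?_)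
      rw [Finset.card_powersetCard, hQ, smul_eq_mul]
    calc (((Finset.powersetCard u Q).biUnion F).card : ℝ) ≤ ((q.choose u *
        ((8 * u).choose (2 * u) * u ^ (2 * u) *
          (128 * q) ^ (numCells l * 8 - 2 * u)) : ℕ) : ℝ) := by
          exact_mod_cast h1
      _ = (q.choose u : ℝ) * ((8 * u).choose (2 * u) * (u : ℝ) ^ (2 * u)) / (128 * q) ^ (2 * u) *
          (128 * q) ^ (numCells l * 8) := by
          have : ((128 : ℝ) * q) ^ (numCells l * 8) =
              (128 * q) ^ (numCells l * 8 - 2 * u) * (128 * q) ^ (2 * u) := by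
            rw [← pow_add]; congr 1; omega
          rw [this]
          push_cast
          field_simp
      _ ≤ _ := by
          gcongr
          exact choose_mul_repeats_le hu.1 hu.2
  calc _ ≤ (((Finset.Icc 1 q).biUnion fun u => (Finset.powersetCard u Q).biUnion F).card : ℝ) := by
        exact_mod_cast Finset.card_le_card hsub
    _ ≤ ∑ u ∈ Finset.Icc 1 q, (((Finset.powersetCard u Q).biUnion F).card : ℝ) := by
        exact_mod_cast Finset.card_biUnion_le
    _ ≤ ∑ u ∈ Finset.Icc 1 q, 1 / (q : ℝ) * (1 / 4) ^ u * (128 * q) ^ (numCells l * 8) :=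
        Finset.sum_le_sum hterm
    _ = 1 / q * (∑ u ∈ Finset.Icc 1 q, (1 / 4) ^ u) * (128 * q) ^ (numCells l * 8) := by
        rw [Finset.mul_sum, Finset.sum_mul]
    _ ≤ 1 / q * (1 / 2) * (128 * q) ^ (numCells l * 8) := by
        gcongr
        exact sum_quarter_pow_le q
    _ = _ := by ring

/-- The hash functions are good for the signal `y`: at each depth, the number of repeats among the
candidates is less than `1 / 32` of the number of selected cells, and among the slots of any
selected cells there are on average fewer than two repeats per cell. -/
structure GoodHashes (l d : ℕ) (y : ℕ → ℝ) (κ : ℕ → ℕ) (η : ℕ × ℕ → ℕ) : Prop where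
  level : ∀ j < l - d, 32 * (repeats id (fun _ => ()) κ (candidates d κ y j)).card < 4 ^ d
  table : ∀ U ⊆ selected d (l - d) κ y, U.Nonempty →
    (repeats Prod.fst Prod.snd η (U ×ˢ Finset.range 8)).card < 2 * U.card

open Classical in
/-- The level hash functions fail with probability at most `2⁻ᶻ` at each depth, and for any given
choice of them the table hash functions fail with probability at most `1 / (2q)`. -/
theorem card_bad_hashes_le {l d q z : ℕ} (y : ℕ → ℝ) (hd : d ≤ l) (hz : d < l → 4 ^ d = 32 * z)
    (hq : q = numCells d + (l - d) * 4 ^ d) :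
    ((Finset.univ.filter fun ω : Hashes l (2 ^ 131 * 4 ^ d) (128 * q) =>
      ¬ GoodHashes l d y (levelHash ω.1) (tableHash ω.2)).card : ℝ) ≤
      ((l - d : ℕ) * (1 / 2) ^ z + 1 / (2 * q)) *
        Fintype.card (Hashes l (2 ^ 131 * 4 ^ d) (128 * q)) := by
  set B₁ := 2 ^ 131 * 4 ^ d with hB₁
  set B₂ := 128 * q with hB₂
  have hq1 : 1 ≤ q := by have := numCells_pos d; omega
  let F₁ : ℕ → Finset (Cell l → Fin B₁) := fun j => Finset.univ.filter fun h =>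
    z ≤ (repeats id (fun _ => ()) (levelHash h) (candidates d (levelHash h) y j)).card
  let F₂ : (Cell l → Fin B₁) → Finset (Cell l × Fin 8 → Fin B₂) := fun h₁ =>
    Finset.univ.filter fun h => ∃ U ⊆ cellsOf l (selected d (l - d) (levelHash h₁) y), U.Nonempty ∧
      2 * U.card ≤ (repeats (fun x => (x.1 : ℕ)) Prod.snd h (U ×ˢ Finset.univ)).card
  have hsel : ∀ κ, selected d (l - d) κ y ⊆ Finset.range (numCells l) := fun κ => by
    have := selected_subset d (l - d) κ y
    rwa [Nat.add_sub_cancel' hd] at this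
  have hsub : (Finset.univ.filter fun ω : Hashes l B₁ B₂ =>
      ¬ GoodHashes l d y (levelHash ω.1) (tableHash ω.2)) ⊆
      (((Finset.range (l - d)).biUnion F₁) ×ˢ Finset.univ) ∪
        (Finset.univ.filter fun ω : Hashes l B₁ B₂ => ω.2 ∈ F₂ ω.1) := by
    rintro ⟨h₁, h₂⟩ hω
    rw [Finset.mem_filter] at hω
    by_contra hno
    simp only [Finset.mem_union, Finset.mem_product, Finset.mem_biUnion, Finset.mem_range,
      Finset.mem_univ, and_true, Finset.mem_filter, true_and, not_or, not_exists, not_and, F₁, F₂,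
      not_le] at hno
    refine hω.2 ⟨fun j hj => ?_, fun U hU hne => ?_⟩
    · have h := hno.1 j hj
      rw [hz (by omega)]
      exact Nat.mul_lt_mul_of_pos_left h (by norm_num)
    · have hUr := hU.trans (hsel _)
      rw [card_repeats_tableHash _ hUr, ← card_cellsOf hUr]
      refine hno.2 (cellsOf l U) (fun c hc => ?_) ?_
      · simp only [cellsOf, Finset.mem_filter, Finset.mem_univ, true_and] at hc ⊢
        exact hU hc
      · rw [← Finset.card_pos, card_cellsOf hUr]
        exact hne.card_pos
  have hcard : (Fintype.card (Hashes l B₁ B₂) : ℝ) =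
      (B₁ : ℝ) ^ numCells l * (128 * q) ^ (numCells l * 8) := by
    simp [Fintype.card_prod, hB₂]
  have h1 : (((Finset.range (l - d)).biUnion F₁).card : ℝ) ≤
      (l - d : ℕ) * (1 / 2) ^ z * (B₁ : ℝ) ^ numCells l := by
    have : ∀ j ∈ Finset.range (l - d), ((F₁ j).card : ℝ) ≤ (1 / 2) ^ z * (B₁ : ℝ) ^ numCells l := by
      intro j hj
      rw [Finset.mem_range] at hj
      have h := card_level_failure_le (l := l) (j := j) y (by omega) (hz (by omega))
      have h' : ((F₁ j).card : ℝ) * 2 ^ z ≤ (B₁ : ℝ) ^ numCells l := by exact_mod_cast h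
      rw [one_div, inv_pow, inv_mul_eq_div, le_div_iff₀ (by positivity)]
      exact h'
    calc (((Finset.range (l - d)).biUnion F₁).card : ℝ)
        ≤ ∑ j ∈ Finset.range (l - d), ((F₁ j).card : ℝ) := by exact_mod_cast Finset.card_biUnion_le
      _ ≤ _ := by
        refine (Finset.sum_le_card_nsmul _ _ _ this).trans_eq ?_
        rw [Finset.card_range, nsmul_eq_mul, mul_assoc]
  have h2 : ((Finset.univ.filter fun ω : Hashes l B₁ B₂ => ω.2 ∈ F₂ ω.1).card : ℝ) ≤
      (B₁ : ℝ) ^ numCells l * (1 / (2 * q) * (128 * q) ^ (numCells l * 8)) := by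
    have e : (Finset.univ.filter fun ω : Hashes l B₁ B₂ => ω.2 ∈ F₂ ω.1).card =
        ∑ h₁, (F₂ h₁).card := by
      rw [Finset.card_filter, Fintype.sum_prod_type]
      refine Finset.sum_congr rfl fun h₁ _ => ?_
      rw [← Finset.card_filter]
      congr 1
      ext h
      simp
    rw [e, Nat.cast_sum]
    refine (Finset.sum_le_card_nsmul _ _ ((1 / (2 * q) : ℝ) * (128 * q) ^ (numCells l * 8))
      fun h₁ _ => ?_).trans_eq ?_
    · refine card_table_failure_le hq1 _ ?_
      rw [card_cellsOf (hsel _), card_selected, hq]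
    · rw [nsmul_eq_mul, Finset.card_univ, Fintype.card_fun]
      simp
  calc _ ≤ ((((Finset.range (l - d)).biUnion F₁) ×ˢ
        (Finset.univ : Finset (Cell l × Fin 8 → Fin B₂))).card : ℝ) +
        ((Finset.univ.filter fun ω : Hashes l B₁ B₂ => ω.2 ∈ F₂ ω.1).card : ℝ) := by
        exact_mod_cast (Finset.card_le_card hsub).trans (Finset.card_union_le _ _)
    _ ≤ (l - d : ℕ) * (1 / 2) ^ z * (B₁ : ℝ) ^ numCells l * (128 * q) ^ (numCells l * 8) +
        (B₁ : ℝ) ^ numCells l * (1 / (2 * q) * (128 * q) ^ (numCells l * 8)) := by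
        refine add_le_add ?_ h2
        rw [Finset.card_product, Nat.cast_mul]
        have : (((Finset.univ : Finset (Cell l × Fin 8 → Fin B₂)).card : ℕ) : ℝ) =
            (128 * q) ^ (numCells l * 8) := by
          simp [Finset.card_univ, hB₂]
        rw [this]
        exact mul_le_mul_of_nonneg_right h1 (by positivity)
    _ = _ := by rw [hcard]; ring

/-! ### The guarantee for good hash functions -/

section TreeModel

variable {l s : ℕ} {y' : Cell l → ℝ} (hy' : y' ∈ treeModel l s)
include hy'

theorem nonneg_of_mem_treeModel (c : ℕ) : 0 ≤ zeroExtend y' c := by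
  rw [zeroExtend]
  split_ifs with h
  · exact le_trans (mul_nonneg zero_le_two (Finset.sum_nonneg fun _ _ => abs_nonneg _))
      (hy'.2 ⟨c, h⟩)
  · exact le_rfl

theorem two_mul_sum_le_of_mem_treeModel {e p : ℕ} (he : e + 1 ≤ l) (hp : p ∈ levelCells e) :
    2 * ∑ c ∈ levelCells (e + 1) with (c - 1) / 4 = p, zeroExtend y' c ≤ zeroExtend y' p := by
  have hpl : p < numCells l :=
    Finset.mem_range.1 (levelCells_subset_range (by omega : e ≤ l) hp)
  have hch : ∀ x, x ∈ children (⟨p, hpl⟩ : Cell l) ↔ (x : ℕ) ≠ 0 ∧ ((x : ℕ) - 1) / 4 = p := by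
    intro x
    rw [children, Finset.mem_filter]
    simp [IsChild]
  have hset : (levelCells (e + 1)).filter (fun c => (c - 1) / 4 = p) =
      (children (⟨p, hpl⟩ : Cell l)).image Fin.val := by
    ext c
    simp only [Finset.mem_filter, Finset.mem_image, hch]
    constructor
    · rintro ⟨hc, hcp⟩
      exact ⟨⟨c, Finset.mem_range.1 (levelCells_subset_range he hc)⟩,
        ⟨(mem_levelCells_succ.1 hc).1, hcp⟩, rfl⟩
    · rintro ⟨x, ⟨hx0, hxp⟩, rfl⟩
      exact ⟨mem_levelCells_succ.2 ⟨hx0, hxp ▸ hp⟩, hxp⟩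
  rw [hset, Finset.sum_image Fin.val_injective.injOn, zeroExtend, dif_pos hpl]
  refine le_trans (mul_le_mul_of_nonneg_left (Finset.sum_le_sum fun c _ => ?_) zero_le_two)
    (hy'.2 ⟨p, hpl⟩)
  rw [zeroExtend_val]
  exact le_abs_self _

theorem card_support_le_of_mem_treeModel {e : ℕ} (he : e ≤ l) :
    ((levelCells e).filter fun c => zeroExtend y' c ≠ 0).card ≤ s := by
  obtain ⟨S, hS, hsupp⟩ := hy'.1
  refine le_trans ?_ (hS.2.2 (l - e) (Nat.sub_le _ _))
  rw [← Finset.card_image_of_injective (S ∩ grid l (l - e)) Fin.val_injective]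
  refine Finset.card_le_card fun c hc => ?_
  rw [Finset.mem_filter] at hc
  have hcl : c < numCells l := Finset.mem_range.1 (levelCells_subset_range he hc.1)
  refine Finset.mem_image.2 ⟨⟨c, hcl⟩, Finset.mem_inter.2 ⟨?_, ?_⟩, rfl⟩
  · refine hsupp ?_
    have := hc.2
    rwa [zeroExtend, dif_pos hcl] at this
  · rw [grid, Finset.mem_filter, cellDepth]
    refine ⟨Finset.mem_univ _, ?_⟩
    simp only [log_of_mem_levelCells hc.1]
    omega

end TreeModel

theorem l1norm_eq_sum_range {t : ℕ} (f : Fin t → ℝ) (g : ℕ → ℝ) (h : ∀ c : Fin t, f c = g c) :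
    l1norm f = ∑ c ∈ Finset.range t, |g c| := by
  rw [l1norm, ← Fin.sum_univ_eq_sum_range (fun c => |g c|)]
  exact Finset.sum_congr rfl fun c _ => by rw [h]

theorem ReadsTables.descentList_eq {I : SketchInput} {l d B₁ B₂ : ℕ} {κ : ℕ → ℕ} {η : ℕ × ℕ → ℕ}
    {y : ℕ → ℝ} (hI : ReadsTables I l d B₁ B₂ κ η y) :
    ∀ j, d + j ≤ l →
      descentList I d j = outList (bucketSum κ y) (startState d) (List.range (numCells d)) j
  | 0, _ => rfl
  | j + 1, h => by
    have ih := hI.descentList_eq j (by omega)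
    rw [descentList] at ih ⊢
    rw [outList, outList, ih, levelState_congr (val := I.cellVal) (val' := bucketSum κ y)]
    intro i hi c hc
    exact hI.cellVal_eq (by omega) (mem_childList_levelState hc)

/-- If the hash functions are good, then the error of the output is within a constant factor of
the distance to the model. -/
theorem GoodHashes.output_error_le {I : SketchInput} {l d s B₁ B₂ : ℕ} {κ : ℕ → ℕ} {η : ℕ × ℕ → ℕ}
    {y y' : Cell l → ℝ} (hgood : GoodHashes l d (zeroExtend y) κ η)
    (hI : ReadsTables I l d B₁ B₂ κ η (zeroExtend y)) (hd : d ≤ l) (hs : d < l → 16 * s ≤ 4 ^ d)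
    (hy' : y' ∈ treeModel l s) {q : ℕ} (hq : q = numCells d + (l - d) * 4 ^ d) {U : Finset ℕ}
    {val : ℕ → ℝ}
    (hpeel : Peel (itemRow I fun i => (descentList I d (l - d)).getD i 0) I.meas q U val)
    (hlast : ∀ i ∈ U,
      (isoSlots (itemRow I fun i => (descentList I d (l - d)).getD i 0) U i).card < 5)
    {z : Cell l → ℝ} (hz : ∀ c : Cell l, z c = ∑ i ∈ Finset.range q,
      if (descentList I d (l - d)).getD i 0 = (c : ℕ) then val i else 0) :
    l1norm (z - y) ≤ 35 * l1norm (y - y') := by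
  have hlist := hI.descentList_eq (l - d) (by omega)
  have hlen : (descentList I d (l - d)).length = q := by rw [length_descentList, hq]
  have hget : ∀ i (h : i < q), (descentList I d (l - d)).getD i 0 =
      (descentList I d (l - d))[i]'(hlen ▸ h) := fun i h =>
    List.getD_eq_getElem _ _ (hlen ▸ h)
  have himg : (Finset.range q).image (fun i => (descentList I d (l - d)).getD i 0) =
      selected d (l - d) κ (zeroExtend y) := by
    rw [selected, ← hlist]
    ext c
    rw [Finset.mem_image, List.mem_toFinset, List.mem_iff_getElem]
    constructor
    · rintro ⟨i, hi, rfl⟩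
      rw [Finset.mem_range] at hi
      exact ⟨i, hlen ▸ hi, (hget i hi).symm⟩
    · rintro ⟨i, hi, rfl⟩
      rw [hlen] at hi
      exact ⟨i, Finset.mem_range.2 hi, hget i hi⟩
  have hsel := selected_subset d (l - d) κ (zeroExtend y)
  rw [Nat.add_sub_cancel' hd] at hsel
  have hnd : (descentList I d (l - d)).Nodup := hlist ▸ outList_nodup _ _ _
  have h1 := hI.output_error_le (q := q) (cell := fun i => (descentList I d (l - d)).getD i 0)
    (fun i hi => by
      refine Finset.mem_range.1 (hsel ?_)
      rw [← himg]
      exact Finset.mem_image_of_mem _ (Finset.mem_range.2 hi))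
    (fun i hi i' hi' h => by
      simp only [hget i hi, hget i' hi'] at h
      exact (List.Nodup.getElem_inj_iff hnd).1 h)
    hpeel hlast (fun U hU => hgood.table U (himg ▸ hU))
  have h2 := sum_outside_le κ (bucketSum κ (zeroExtend y)) (zeroExtend y) (zeroExtend y') d (l - d)
    (nonneg_of_mem_treeModel hy') (fun _ _ _ _ => rfl)
    (fun j hj p hp => two_mul_sum_le_of_mem_treeModel hy' (by omega) hp)
    (fun j hj => (Nat.mul_le_mul_left 16
      (card_support_le_of_mem_treeModel hy' (by omega))).trans (hs (by omega)))
    (fun j hj => by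
      have h3 := card_collisions_le id (fun _ => ()) κ (candidates d κ (zeroExtend y) j)
        fun x y _ h => h
      have h4 := hgood.level j hj
      rw [candidates] at h3 h4
      omega)
  rw [Nat.add_sub_cancel' hd] at h2
  rw [himg, selected] at h1
  rw [l1norm_eq_sum_range (z - y) (fun c => (∑ i ∈ Finset.range q,
      if (descentList I d (l - d)).getD i 0 = c then val i else 0) - zeroExtend y c)
      fun c => by rw [Pi.sub_apply, hz, zeroExtend_val],
    l1norm_eq_sum_range (y - y') (fun c => zeroExtend y c - zeroExtend y' c)
      fun c => by rw [Pi.sub_apply, zeroExtend_val, zeroExtend_val]]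
  linarith

/-! ### Parameters -/

theorem natCast_le_log_div {l d k : ℕ} (hk : 1 ≤ k) (hX : d < l → k ≤ 4 ^ d)
    (hn : 2 * k < 4 ^ l) : ((l - d : ℕ) : ℝ) ≤ Real.log ((4 ^ l : ℕ) / k) := by
  have hk0 : (0 : ℝ) < k := by exact_mod_cast hk
  rcases Nat.lt_or_ge d l with h | h
  · have h1 : ((4 : ℝ) ^ (l - d)) ≤ (4 ^ l : ℕ) / k := by
      rw [le_div_iff₀ hk0]
      have : 4 ^ (l - d) * k ≤ 4 ^ l := by
        calc 4 ^ (l - d) * k ≤ 4 ^ (l - d) * 4 ^ d := Nat.mul_le_mul_left _ (hX h)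
          _ = 4 ^ l := by rw [← pow_add]; congr 1; omega
      exact_mod_cast this
    have h2 : Real.exp ((l - d : ℕ) : ℝ) ≤ 4 ^ (l - d) := by
      rw [← Real.exp_one_pow]
      exact pow_le_pow_left₀ (Real.exp_pos _).le (by linarith [Real.exp_one_lt_three]) _
    rw [Real.le_log_iff_exp_le (by positivity)]
    exact h2.trans h1
  · rw [Nat.sub_eq_zero_of_le h, Nat.cast_zero]
    refine Real.log_nonneg ?_
    rw [le_div_iff₀ hk0]
    exact_mod_cast (by omega : 1 * k ≤ 4 ^ l)

theorem half_le_log_div {l k : ℕ} (hk : 1 ≤ k) (hn : 2 * k < 4 ^ l) :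
    1 / 2 ≤ Real.log ((4 ^ l : ℕ) / k) := by
  have hk0 : (0 : ℝ) < k := by exact_mod_cast hk
  have h1 : (2 : ℝ) ≤ (4 ^ l : ℕ) / k := by
    rw [le_div_iff₀ hk0]
    exact_mod_cast hn.le
  have := Real.log_le_log zero_lt_two h1
  linarith [Real.log_two_gt_d9]

theorem natCast_le_mul_log_div {l k : ℕ} (hk : 1 ≤ k) (hn : 2 * k < 4 ^ l) :
    (l : ℝ) ≤ 3 * (k * Real.log ((4 ^ l : ℕ) / k)) := by
  have hk1 : (1 : ℝ) ≤ k := by exact_mod_cast hk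
  have h1 := half_le_log_div hk hn
  have h2 : Real.log ((4 ^ l : ℕ) / k) = l * Real.log 4 - Real.log k := by
    rw [Real.log_div (by positivity) (by positivity)]
    push_cast
    rw [Real.log_pow]
  have h3 : 1 ≤ Real.log 4 := by
    rw [show (4 : ℝ) = 2 ^ 2 by norm_num, Real.log_pow]
    push_cast
    linarith [Real.log_two_gt_d9]
  have h4 : Real.log k ≤ k := (Real.log_le_sub_one_of_pos (by linarith)).trans (by linarith)
  have h5 : (l : ℝ) * 1 ≤ l * Real.log 4 := mul_le_mul_of_nonneg_left h3 (Nat.cast_nonneg l)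
  nlinarith

/-- The number of levels is at most `exp (k / c₂)`, while the failure probability at each level is
exponentially small in a large multiple of `k`. -/
theorem level_failure_le {l d k z K : ℕ} {c₂ : ℝ} (hc₂ : 0 < c₂) (hk : 1 ≤ k) (hl : 1 ≤ l)
    (hlog : c₂ * Real.log (Real.log (4 ^ l : ℕ)) ≤ k) (hK : 64 * (1 + 1 / c₂) ≤ K)
    (hz : K * k ≤ 32 * z) :
    ((l - d : ℕ) : ℝ) * (1 / 2) ^ z ≤ 1 / (2 * k) := by
  have hk1 : (1 : ℝ) ≤ k := by exact_mod_cast hk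
  have hl1 : (1 : ℝ) ≤ l := by exact_mod_cast hl
  have h4 : 1 ≤ Real.log 4 := by
    rw [show (4 : ℝ) = 2 ^ 2 by norm_num, Real.log_pow]
    push_cast
    linarith [Real.log_two_gt_d9]
  have h1 : (l : ℝ) ≤ Real.exp (k / c₂) := by
    rw [← Real.log_le_iff_le_exp (by linarith), le_div_iff₀ hc₂, mul_comm]
    refine le_trans (mul_le_mul_of_nonneg_left ?_ hc₂.le) hlog
    refine Real.log_le_log (by linarith) ?_
    push_cast
    rw [Real.log_pow]
    nlinarith
  have h2 : (1 / 2 : ℝ) ^ z ≤ Real.exp (-(k * (1 + 1 / c₂))) := by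
    have hzr : (K : ℝ) * k ≤ 32 * z := by exact_mod_cast hz
    have h3 : (1 / 2 : ℝ) = Real.exp (-Real.log 2) := by
      rw [Real.exp_neg, Real.exp_log zero_lt_two, one_div]
    rw [h3, ← Real.exp_nat_mul, Real.exp_le_exp]
    have h5 : (z : ℝ) * (1 / 2) ≤ z * Real.log 2 :=
      mul_le_mul_of_nonneg_left (by linarith [Real.log_two_gt_d9]) (Nat.cast_nonneg z)
    have h6 : 64 * (1 + 1 / c₂) * k ≤ K * k := mul_le_mul_of_nonneg_right hK (by linarith)
    linarith
  have h3 : 2 * (k : ℝ) ≤ Real.exp k := by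
    have h5 := Real.add_one_le_exp ((k : ℝ) - 1)
    have h6 : Real.exp k = Real.exp (k - 1) * Real.exp 1 := by rw [← Real.exp_add]; ring_nf
    have h7 := Real.exp_one_gt_d9
    rw [h6]
    nlinarith
  calc ((l - d : ℕ) : ℝ) * (1 / 2) ^ z ≤ Real.exp (k / c₂) * Real.exp (-(k * (1 + 1 / c₂))) := by
        refine mul_le_mul (le_trans ?_ h1) h2 (by positivity) (Real.exp_pos _).le
        exact_mod_cast Nat.sub_le l d
    _ = 1 / Real.exp k := by
        rw [← Real.exp_add, one_div (Real.exp _), ← Real.exp_neg]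
        congr 1
        field_simp
        ring
    _ ≤ 1 / (2 * k) := one_div_le_one_div_of_le (by linarith) h3

/-- Running the recovery program, with the properties of its result. -/
structure Recovered (I : SketchInput) (K l k s m d q : ℕ) (σ : RAMState) : Prop where
  run : ∃ τ ≤ 30000 * q + 7 * l + 3 * K + 40,
    (recoverProg K).Exec I (RAMState.init l k s m) τ σ
  len : σ.outLen = q
  list : ListAt (σ.natArr 0) 0 (descentList I d (l - d))
  peel : ∃ U, Peel (itemRow I fun i => (descentList I d (l - d)).getD i 0) I.meas q U
    (σ.realArr 0) ∧
    ∀ i ∈ U, (isoSlots (itemRow I fun i => (descentList I d (l - d)).getD i 0) U i).card < 5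

theorem exists_recovered (I : SketchInput) (K l k s m : ℕ) {d q : ℕ}
    (hd : d = startDepth (K * (k + s)) l) (hq : q = numCells d + (l - d) * 4 ^ d) :
    ∃ σ, Recovered I K l k s m d q σ := by
  obtain ⟨τ, σ, hexec, hτ, h0, hlist, U, val, hpeel, hval, hlast⟩ :=
    recoverProg_spec I K l k s m d q hd hq
  exact ⟨σ, ⟨τ, hτ, hexec⟩, h0, hlist, U, hval ▸ hpeel, hlast⟩

theorem Recovered.output_eq {I : SketchInput} {K l k s m d q : ℕ} {σ : RAMState}
    (h : Recovered I K l k s m d q σ) (hq : q = numCells d + (l - d) * 4 ^ d) (c : Cell l) :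
    σ.output l c = ∑ i ∈ Finset.range q,
      if (descentList I d (l - d)).getD i 0 = (c : ℕ) then σ.realArr 0 i else 0 := by
  have hlen : (descentList I d (l - d)).length = q := by rw [length_descentList, hq]
  rw [RAMState.output, h.len]
  refine Finset.sum_congr rfl fun i hi => ?_
  rw [Finset.mem_range] at hi
  have := h.list i (hlen ▸ hi)
  rw [zero_add] at this
  rw [this, List.getD_eq_getElem _ _ (hlen ▸ hi)]

/-- The number of rows and the running time are proportional to this number. -/
theorem size_le {l d k s K : ℕ} {c₁ ε : ℝ} (hk : 1 ≤ k) (hn : 2 * k < 4 ^ l)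
    (hε : 0 < ε) (hε1 : ε ≤ 1) (hs : (s : ℝ) ≤ c₁ * (k / ε ^ 2)) (hX : d < l → k ≤ 4 ^ d)
    (hXK : 4 ^ d ≤ 4 * (K * (k + s))) :
    (((l - d + 2) * 4 ^ d : ℕ) : ℝ) ≤
      20 * K * (1 + c₁) * (k / ε ^ 2 * Real.log ((4 ^ l : ℕ) / k)) := by
  have hk0 : (0 : ℝ) < k := by exact_mod_cast hk
  have h1 := natCast_le_log_div hk hX hn
  have h2 := half_le_log_div hk hn
  have h3 : (k : ℝ) ≤ k / ε ^ 2 := by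
    rw [le_div_iff₀ (by positivity)]
    nlinarith [pow_le_one₀ (n := 2) hε.le hε1]
  have h4 : ((4 ^ d : ℕ) : ℝ) ≤ 4 * K * (1 + c₁) * (k / ε ^ 2) := by
    have : ((4 ^ d : ℕ) : ℝ) ≤ 4 * (K * (k + s)) := by exact_mod_cast hXK
    refine this.trans ?_
    have h5 : (k : ℝ) + s ≤ (1 + c₁) * (k / ε ^ 2) := by linarith
    calc 4 * ((K : ℝ) * (k + s)) ≤ 4 * (K * ((1 + c₁) * (k / ε ^ 2))) := by gcongr
      _ = _ := by ring
  have h5 : ((l - d + 2 : ℕ) : ℝ) ≤ 5 * Real.log ((4 ^ l : ℕ) / k) := by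
    rw [Nat.cast_add, Nat.cast_two]
    linarith
  rw [Nat.cast_mul]
  calc ((l - d + 2 : ℕ) : ℝ) * (4 ^ d : ℕ)
      ≤ 5 * Real.log ((4 ^ l : ℕ) / k) * (4 * K * (1 + c₁) * (k / ε ^ 2)) := by gcongr
    _ = _ := by ring

open Classical in
/-- A bound on the number of bad outcomes is a bound on the probability. -/
theorem ofReal_le_uniform {α : Type} [Fintype α] [Nonempty α] (P : α → Prop) {δ : ℝ}
    (h : ((Finset.univ.filter fun a => ¬ P a).card : ℝ) ≤ δ * Fintype.card α) :
    ENNReal.ofReal (1 - δ) ≤ (PMF.uniformOfFintype α).toOuterMeasure {a | P a} := by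
  have hpos : (0 : ℝ) < Fintype.card α := by exact_mod_cast Fintype.card_pos
  rw [PMF.toOuterMeasure_uniformOfFintype_apply, ← ENNReal.ofReal_natCast,
    ← ENNReal.ofReal_natCast (Fintype.card α), ← ENNReal.ofReal_div_of_pos hpos]
  refine ENNReal.ofReal_le_ofReal ?_
  have h1 : Fintype.card {a | P a} = (Finset.univ.filter P).card := Fintype.card_subtype P
  have h2 : ((Finset.univ.filter P).card : ℝ) + (Finset.univ.filter fun a => ¬ P a).card =
      Fintype.card α := by
    exact_mod_cast Finset.card_filter_add_card_filter_not (s := Finset.univ) P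
  rw [h1, le_div_iff₀ hpos]
  linarith

theorem mainTheorem5 :
    ∃ C : ℝ, 0 < C ∧ ∀ c₁ c₂ : ℝ, 0 < c₁ → 0 < c₂ →
      ∃ (Cm CT a : ℝ) (alg : RAMProg), 0 < Cm ∧ 0 < CT ∧ 0 < a ∧
        ∀ (l n k s : ℕ) (ε : ℝ), n = 4 ^ l → 1 ≤ k → 2 * k < n → 0 < ε → ε ≤ 1 →
          (s : ℝ) ≤ c₁ * (k / ε ^ 2) →
          c₂ * Real.log (Real.log n) ≤ k →
          ∃ (m : ℕ) (P : PMF (Matrix (Fin m) (Cell l) ℝ))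
            (recover : Matrix (Fin m) (Cell l) ℝ → (Fin m → ℝ) → (Cell l → ℝ)),
            (m : ℝ) ≤ Cm * (k / ε ^ 2 * Real.log (n / k)) ∧
            (∀ A ∈ P.support, ∀ y : Cell l → ℝ,
              alg.ComputesWithin l k s A (A.mulVec y) (recover A (A.mulVec y))
                (CT * (k / ε ^ 2 * Real.log (n / k)))) ∧
            ∀ y : Cell l → ℝ,
              ENNReal.ofReal (1 - (k : ℝ) ^ (-a)) ≤
                P.toOuterMeasure {A | ∀ y' ∈ treeModel l s,
                  l1norm (recover A (A.mulVec y) - y) ≤ C * l1norm (y - y')} := by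
  -- the descent loses `7` times, and peeling then costs `5` times the distance to the model
  refine ⟨35, by norm_num, fun c₁ c₂ hc₁ hc₂ => ?_⟩
  -- at least `K * k` cells are kept at each depth, so that a union bound over the
  -- `l ≤ exp (k / c₂)` depths is possible
  obtain ⟨K, hK⟩ := exists_nat_ge (64 * (1 + 1 / c₂))
  have hK64 : 64 ≤ K := by
    have : (64 : ℝ) ≤ K := by
      have : 0 < 1 / c₂ := by positivity
      linarith
    exact_mod_cast this
  refine ⟨2 ^ 132 * (20 * K * (1 + c₁)), 30001 * (20 * K * (1 + c₁)) + 21 + 2 * (3 * K + 40), 1,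
    recoverProg K, by positivity, by positivity, one_pos, ?_⟩
  rintro l n k s ε rfl hk hkn hε hε1 hs hlog
  have hk0 : (0 : ℝ) < k := by exact_mod_cast hk
  have hl : 1 ≤ l := by
    by_contra h
    obtain rfl : l = 0 := by omega
    omega
  obtain ⟨d, hd⟩ : ∃ d, d = startDepth (K * (k + s)) l := ⟨_, rfl⟩
  obtain ⟨q, hq⟩ : ∃ q, q = numCells d + (l - d) * 4 ^ d := ⟨_, rfl⟩
  have hdl : d ≤ l := hd ▸ startDepth_le _ _
  have hXlt : 4 ^ d < 4 * (K * (k + s)) := hd ▸ startDepth_lt _ (by positivity) l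
  have hKX : d < l → K * (k + s) ≤ 4 ^ d := fun h => by
    rcases le_startDepth (K * (k + s)) l with h' | h'
    · omega
    · rwa [hd]
  have hkX : d < l → k ≤ 4 ^ d := fun h => by
    have := hKX h
    nlinarith
  have hdiv : d < l → 4 ^ d = 32 * (4 ^ d / 32) := fun h => by
    have h64 : 64 ≤ 4 ^ d := by
      have := hKX h
      nlinarith
    have h3 : 3 ≤ d := by
      by_contra h3
      have : 4 ^ d ≤ 4 ^ 2 := Nat.pow_le_pow_right (by norm_num) (by omega)
      omega
    obtain ⟨e, rfl⟩ := Nat.exists_eq_add_of_le h3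
    rw [pow_add]
    omega
  have hq1 : 1 ≤ q := by have := numCells_pos d; omega
  have hqX : q ≤ (l - d + 2) * 4 ^ d := by
    have := three_mul_numCells d
    rw [add_mul]
    omega
  have hsize := size_le hk hkn hε hε1 hs hkX hXlt.le
  have hhalf := half_le_log_div hk hkn
  have hll := natCast_le_mul_log_div hk hkn
  have hkε : (k : ℝ) ≤ k / ε ^ 2 := by
    rw [le_div_iff₀ (by positivity)]
    nlinarith [pow_le_one₀ (n := 2) hε.le hε1]
  set R := (k : ℝ) / ε ^ 2 * Real.log ((4 ^ l : ℕ) / k) with hR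
  have hkR : (k : ℝ) * Real.log ((4 ^ l : ℕ) / k) ≤ R :=
    mul_le_mul_of_nonneg_right hkε (by linarith)
  have hR1 : 1 ≤ 2 * R := by
    have : (1 : ℝ) ≤ k := by exact_mod_cast hk
    nlinarith
  have hB₁ : 0 < 2 ^ 131 * 4 ^ d := by positivity
  have hB₂ : 0 < 128 * q := by omega
  have : NeZero (2 ^ 131 * 4 ^ d) := ⟨hB₁.ne'⟩
  have : NeZero (128 * q) := ⟨hB₂.ne'⟩
  -- the program halts on every input, good or bad, and `recover` is whatever it outputs
  choose σ hσ using fun (A : Matrix (Fin (numRows l d (2 ^ 131 * 4 ^ d) (128 * q))) (Cell l) ℝ)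
    (b : Fin (numRows l d (2 ^ 131 * 4 ^ d) (128 * q)) → ℝ) =>
    exists_recovered (sketchInput A b) K l k s (numRows l d (2 ^ 131 * 4 ^ d) (128 * q)) hd hq
  refine ⟨numRows l d (2 ^ 131 * 4 ^ d) (128 * q),
    (PMF.uniformOfFintype (Hashes l (2 ^ 131 * 4 ^ d) (128 * q))).map (hashMatrix l d _ _),
    fun A b => (σ A b).output l, ?_, ?_, ?_⟩
  · have h1 : numRows l d (2 ^ 131 * 4 ^ d) (128 * q) ≤ 2 ^ 132 * ((l - d + 2) * 4 ^ d) := by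
      rw [numRows]
      have : (l - d + 1) * (2 ^ 131 * 4 ^ d) ≤ 2 ^ 131 * ((l - d + 2) * 4 ^ d) := by
        rw [mul_left_comm]
        gcongr
        omega
      omega
    calc ((numRows l d (2 ^ 131 * 4 ^ d) (128 * q) : ℕ) : ℝ)
        ≤ ((2 ^ 132 * ((l - d + 2) * 4 ^ d) : ℕ) : ℝ) := by exact_mod_cast h1
      _ = 2 ^ 132 * (((l - d + 2) * 4 ^ d : ℕ) : ℝ) := by rw [Nat.cast_mul]; norm_num
      _ ≤ 2 ^ 132 * (20 * K * (1 + c₁) * R) := by gcongr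
      _ = _ := by ring
  · intro A _ y
    obtain ⟨τ, hτ, hexec⟩ := (hσ A (A.mulVec y)).run
    refine ⟨τ, σ A (A.mulVec y), hexec, rfl, ?_⟩
    rw [(hσ A (A.mulVec y)).len]
    have h1 : τ + q ≤ 30001 * ((l - d + 2) * 4 ^ d) + 7 * l + (3 * K + 40) := by omega
    have h2 : ((τ + q : ℕ) : ℝ) ≤
        30001 * (((l - d + 2) * 4 ^ d : ℕ) : ℝ) + 7 * l + (3 * K + 40) := by exact_mod_cast h1
    have h3 : (3 * (K : ℝ) + 40) * 1 ≤ (3 * K + 40) * (2 * R) :=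
      mul_le_mul_of_nonneg_left hR1 (by positivity)
    linarith
  · intro y
    rw [PMF.toOuterMeasure_map_apply]
    -- if `d = l`, then all cells are selected, and there are more than `2 * k` of them
    have hkq : k ≤ q := by
      have h1 := pow_le_numCells d
      rcases Nat.lt_or_ge d l with h | h
      · have := hkX h
        omega
      · obtain rfl : d = l := le_antisymm hdl h
        omega
    have hfail : ((l - d : ℕ) : ℝ) * (1 / 2) ^ (4 ^ d / 32) + 1 / (2 * q) ≤ (k : ℝ) ^ (-1 : ℝ) := by
      have h1 : ((l - d : ℕ) : ℝ) * (1 / 2) ^ (4 ^ d / 32) ≤ 1 / (2 * k) := by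
        rcases Nat.lt_or_ge d l with h | h
        · refine level_failure_le hc₂ hk hl hlog hK ?_
          rw [← hdiv h]
          exact le_trans (Nat.mul_le_mul_left _ (by omega)) (hKX h)
        · rw [Nat.sub_eq_zero_of_le h]
          simp
      have h2 : 1 / (2 * (q : ℝ)) ≤ 1 / (2 * k) := by
        have : (k : ℝ) ≤ q := by exact_mod_cast hkq
        gcongr
      rw [Real.rpow_neg_one]
      have : (k : ℝ)⁻¹ = 1 / (2 * k) + 1 / (2 * k) := by field_simp; norm_num
      linarith
    classical
    refine (ofReal_le_uniform (fun ω : Hashes l (2 ^ 131 * 4 ^ d) (128 * q) =>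
      GoodHashes l d (zeroExtend y) (levelHash ω.1) (tableHash ω.2)) (δ := (k : ℝ) ^ (-1 : ℝ))
      ?_).trans (MeasureTheory.measure_mono ?_)
    · refine le_trans ?_ (mul_le_mul_of_nonneg_right hfail (Nat.cast_nonneg _))
      convert card_bad_hashes_le (zeroExtend y) hdl hdiv hq
    · intro ω hω y' hy'
      obtain ⟨U, hpeel, hlast⟩ := (hσ (hashMatrix l d _ _ ω) ((hashMatrix l d _ _ ω).mulVec y)).peel
      refine GoodHashes.output_error_le hω (readsTables_sketchInput hB₁ hB₂ ω y) hdl (fun h => ?_)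
        hy' hq hpeel hlast fun c => (hσ _ _).output_eq hq c
      have := hKX h
      nlinarith
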